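/- **Setting.** Let $S,A$ be finite sets and $H,d\ge 1$. A $B$-bounded linear mixture CMDP has transition kernels $P_h(s'|s,a)=\langle\phi(s'|s,a),\theta_h^*\rangle$ for $h\in[H]$, with a known feature map $\phi:S\times A\times S\to\mathbb R^d$ and unknown $\theta_h^*\in\mathbb R^d$, $\|\theta_h^*\|_2\le B$, such that $\|\phi_V(s,a)\|_2\le 1$ for every $V:S\to[0,1]$, where $\phi_V(s,a)=\sum_{s'}\phi(s'|s,a)V(s')$. The constraint function $g=\{g_h\}$, $g_h:S\times A\to[0,1]$, the threshold $b\in[0,H]$ and the initial state $s_1$ are fixed and known. For a policy $\pi=\{\pi_h(\cdot|s)\}$ and $\ell=\{\ell_h\}$ put $V_h^{\ell,\pi}(s)=\mathbb E_\pi[\sum_{j=h}^H\ell_j(s_j,a_j)\mid s_h=s]$. Before each episode $k\in[K]$ an adversary fixes a reward $r^k=\{r^k_h\}$, $r_h^k:S\times A\to[0,1]$, possibly depending on the past; the agent plays $\pi^k$ starting at $s^k_1=s_1$, with $a_h^k\sim\pi_h^k(\cdot|s_h^k)$ and $s_{h+1}^k\sim P_h(\cdot|s_h^k,a_h^k)$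 for $h\in[H]$, and then sees $r^k$. Let $\pi^*$ maximize $\sum_{k=1}^K V_1^{r^k,\pi}(s_1)$ over all policies $\pi$ with $V_1^{g,\pi}(s_1)\ge b$, and let $$\mathrm{Regret}=\sum_{k=1}^K\big(V_1^{r^k,\pi^*}(s_1)-V_1^{r^k,\pi^k}(s_1)\big),\qquad \mathrm{Violation}=\Big[\sum_{k=1}^K\big(b-V_1^{g,\pi^k}(s_1)\big)\Big]_+ .$$ **Algorithm (PD-POWERS)**, with parameters $\lambda,\alpha,\eta,\theta$ and confidence parameter $\delta$. Write $[x]_{[u,v]}=\max\{\min\{x,v\},u\}$ and $\|x\|_M=\sqrt{x^\top Mx}$. Initialize $\pi^1_h$ uniform, $Y_1=0$, and, for $\ell\in\{r,g\}$ and $h\in[H]$, $\widehat\Sigma_{1,h}^\ell=\widetilde\Sigma_{1,h}^\ell=\lambda I$ and $\widehat b_{1,h}^\ell=\widetilde b_{1,h}^\ell=0$. Put $$\widehat\beta_k=8\sqrt{d\log(1+k/\lambda)\log(8Hk^2/\delta)}+4\sqrt d\log(8Hk^2/\delta)+\sqrt\lambda B,$$ $$\widetilde\beta_k=8H^2\sqrt{d\log(1+kH^4/(d\lambda))\log(8Hk^2/\delta)}+4H^2\log(8Hk^2/\delta)+\sqrt\lambda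 B,$$ $$\check\beta_k=8d\sqrt{\log(1+k/\lambda)\log(8Hk^2/\delta)}+4\sqrt d\log(8Hk^2/\delta)+\sqrt\lambda B .$$ After episode $k$, for $\ell\in\{r,g\}$ (with $\ell_h=r_h^k$, respectively $\ell_h=g_h$), set $V_{k,H+1}^\ell=0$ and, for $h=H,\dots,1$, with $\widehat\theta=(\widehat\Sigma_{k,h}^\ell)^{-1}\widehat b_{k,h}^\ell$, $\widetilde\theta=(\widetilde\Sigma_{k,h}^\ell)^{-1}\widetilde b_{k,h}^\ell$, $V=V^\ell_{k,h+1}$: $$Q_{k,h}^\ell=\big[\ell_h+\langle\widehat\theta,\phi_V\rangle+\widehat\beta_k\|\phi_V\|_{(\widehat\Sigma_{k,h}^\ell)^{-1}}\big]_{[0,H-h+1]},\qquad V_{k,h}^\ell(s)=\sum_a\pi_h^k(a|s)Q_{k,h}^\ell(s,a).$$ At $(s,a)=(s_h^k,a_h^k)$, with $x=\phi_V(s,a)$ and $z=\phi_{V^2}(s,a)$, put $$\bar\sigma^2=\max\Big\{\tfrac{H^2}{d},\ [\langle z,\widetilde\theta\rangle]_{[0,H^2]}-[\langle x,\widehat\theta\rangle]_{[0,H]}^2+\min\{H^2,\widetilde\beta_k\|z\|_{(\widetilde\Sigma^\ell_{k,h})^{-1}}\}+\min\{H^2,2H\check\beta_k\|x\|_{(\widehat\Sigma^\ell_{k,h})^{-1}}\}\Big\}$$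 and update $\widehat\Sigma_{k+1,h}^\ell=\widehat\Sigma_{k,h}^\ell+\bar\sigma^{-2}xx^\top$, $\widehat b_{k+1,h}^\ell=\widehat b_{k,h}^\ell+\bar\sigma^{-2}V(s_{h+1}^k)x$, $\widetilde\Sigma_{k+1,h}^\ell=\widetilde\Sigma_{k,h}^\ell+zz^\top$, $\widetilde b_{k+1,h}^\ell=\widetilde b_{k,h}^\ell+V(s_{h+1}^k)^2z$. Finally $$\pi_h^{k+1}(a|s)\propto\big((1-\theta)\pi_h^k(a|s)+\theta/|A|\big)\exp\!\big(\alpha(Q_{k,h}^r(s,a)+Y_kQ_{k,h}^g(s,a))\big),$$ $$Y_{k+1}=\big[(1-\alpha\eta H^3)Y_k+\eta\big(b-V_{k,1}^g(s_1)-\alpha H^3-2\theta H^2\big)\big]_+ .$$ **Theorem.** There are absolute constants $C>0$ and $m\in\mathbb N$ such that the following holds. Suppose that some policy $\bar\pi$ satisfies $V_1^{g,\bar\pi}(s_1)\ge b+\gamma$ with $\gamma>0$ (Slater condition), that $0<\delta<1$, and that $K\ge\max\{2H,H^2,d^3H^3\}$. Run PD-POWERS with $\lambda=1/B^2$, $\alpha=1/(H^2\sqrt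 K)$, $\eta=1/(H\sqrt K)$, $\theta=1/K$, and put $L=\log(2+dHK|A|B/\delta)$. Then, with probability at least $1-6\delta$, both $$\mathrm{Regret}\le C L^m\Big(\sqrt{dH^4K}+\sqrt{d^2H^3K}+\frac{H^5\sqrt K}{\gamma^2}\Big)$$ and $$\mathrm{Violation}\le C L^m\Big(\sqrt{dH^4K}+\sqrt{d^2H^3K}+\frac{H^3\sqrt K}{\gamma}\Big).$$ -/

import Mathlib

open scoped Matrix
open MeasureTheory

namespace PDPowers

/-! Conventions: episodes are `k = 1, …, K` and steps are `h = 1, …, H`, both as natural numbers.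
Families indexed by steps or episodes are functions on `ℕ`; only the values at the indices above
(and the state at step `H + 1`) matter. -/

/-! ### Linear mixture CMDPs -/

/-- `φ_V(s,a) = ∑_{s'} φ(s'|s,a) V(s')`, where `φ s a s'` stands for `φ(s'|s,a)`. -/
def phiV {S A : Type*} [Fintype S] {d : ℕ} (φ : S → A → S → Fin d → ℝ) (V : S → ℝ)
    (s : S) (a : A) : Fin d → ℝ :=
  ∑ s', V s' • φ s a s'

/-- The part of the CMDP that the agent knows: the horizon, the feature mapping, the bound `B`,
the constraint function, the constraint threshold and the initial state. -/
structure KnownModel (S A : Type*) (d : ℕ) where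
  H : ℕ
  φ : S → A → S → Fin d → ℝ
  B : ℝ
  g : ℕ → S → A → ℝ
  b : ℝ
  s₁ : S

/-- An inhomogeneous, episodic, `B`-bounded linear mixture CMDP (without the rewards, which are
chosen by the adversary). `P h s a s'` is `P_h(s'|s,a)`. -/
structure LinearMixtureCMDP (S A : Type*) [Fintype S] (d : ℕ) extends KnownModel S A d where
  P : ℕ → S → A → S → ℝ
  θstar : ℕ → Fin d → ℝ
  P_nonneg : ∀ h ∈ Set.Icc 1 H, ∀ s a s', 0 ≤ P h s a s'
  P_sum : ∀ h ∈ Set.Icc 1 H, ∀ s a, ∑ s', P h s a s' = 1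
  P_linear : ∀ h ∈ Set.Icc 1 H, ∀ s a s', P h s a s' = φ s a s' ⬝ᵥ θstar h
  norm_θstar_le : ∀ h ∈ Set.Icc 1 H, ‖WithLp.toLp 2 (θstar h)‖ ≤ B
  norm_phiV_le : ∀ V : S → ℝ, (∀ s, V s ∈ Set.Icc (0 : ℝ) 1) →
    ∀ s a, ‖WithLp.toLp 2 (phiV φ V s a)‖ ≤ 1
  g_mem : ∀ h ∈ Set.Icc 1 H, ∀ s a, g h s a ∈ Set.Icc (0 : ℝ) 1
  b_mem : b ∈ Set.Icc (0 : ℝ) H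

/-! ### Policies and value functions -/

/-- Step-dependent randomized policies: `π h s a` is `π_h(a|s)`. -/
def IsPolicy {S A : Type*} [Fintype A] (π : ℕ → S → A → ℝ) : Prop :=
  ∀ h s, π h s ∈ stdSimplex ℝ A

/-- The expectation of `F (s_h,a_h), (s_{h+1},a_{h+1}), …` (with `n` state-action pairs) over the
trajectory started at `s_h = s` with `a_j ∼ π_j(·|s_j)` and `s_{j+1} ∼ P_j(·|s_j,a_j)`. -/
def trajExp {S A : Type*} [Fintype S] [Fintype A] (P : ℕ → S → A → S → ℝ)
    (π : ℕ → S → A → ℝ) : (n : ℕ) → (h : ℕ) → (s : S) → (F : List (S × A) → ℝ) → ℝ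
  | 0, _, _, F => F []
  | n + 1, h, s, F =>
      ∑ a, π h s a * ∑ s', P h s a s' * trajExp P π n (h + 1) s' (fun τ => F ((s, a) :: τ))

/-- The cumulative payoff `∑_j ℓ_j(s_j,a_j)` of a trajectory that starts at step `h`. -/
def payoff {S A : Type*} (ℓ : ℕ → S → A → ℝ) : ℕ → List (S × A) → ℝ
  | _, [] => 0
  | h, (s, a) :: τ => ℓ h s a + payoff ℓ (h + 1) τ

/-- `V_h^{ℓ,π}(s) = E_π[∑_{j=h}^H ℓ_j(s_j,a_j) | s_h = s]`. -/
def value {S A : Type*} [Fintype S] [Fintype A] {d : ℕ} (M : LinearMixtureCMDP S A d)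
    (ℓ : ℕ → S → A → ℝ) (π : ℕ → S → A → ℝ) (h : ℕ) (s : S) : ℝ :=
  trajExp M.P π (M.H + 1 - h) h s (payoff ℓ h)

/-- Feasible policies: `V_1^{g,π}(s_1) ≥ b`. -/
def IsFeasible {S A : Type*} [Fintype S] [Fintype A] {d : ℕ} (M : LinearMixtureCMDP S A d)
    (π : ℕ → S → A → ℝ) : Prop :=
  IsPolicy π ∧ M.b ≤ value M M.g π 1 M.s₁

/-- `π` solves `max ∑_{k=1}^K V_1^{r^k,π}(s_1)` subject to `V_1^{g,π}(s_1) ≥ b`. -/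
def IsOptimal {S A : Type*} [Fintype S] [Fintype A] {d : ℕ} (M : LinearMixtureCMDP S A d)
    (K : ℕ) (r : ℕ → ℕ → S → A → ℝ) (π : ℕ → S → A → ℝ) : Prop :=
  IsFeasible M π ∧ ∀ π', IsFeasible M π' →
    ∑ k ∈ Finset.Icc 1 K, value M (r k) π' 1 M.s₁ ≤ ∑ k ∈ Finset.Icc 1 K, value M (r k) π 1 M.s₁

theorem continuous_trajExp {S A : Type*} [Fintype S] [Fintype A] (P : ℕ → S → A → S → ℝ)
    (n h : ℕ) (s : S) (F : List (S × A) → ℝ) : Continuous fun π => trajExp P π n h s F := by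
  induction n generalizing h s F with
  | zero => exact continuous_const
  | succ n ih =>
    simp only [trajExp]
    refine continuous_finsetSum _ fun a _ => Continuous.mul (by fun_prop) ?_
    exact continuous_finsetSum _ fun s' _ => continuous_const.mul (ih _ _ _)

/-- As soon as a feasible policy exists, so does an optimal one. -/
theorem exists_isOptimal {S A : Type*} [Fintype S] [Fintype A] {d : ℕ}
    (M : LinearMixtureCMDP S A d) (K : ℕ) (r : ℕ → ℕ → S → A → ℝ) (π₀ : ℕ → S → A → ℝ)
    (h₀ : IsFeasible M π₀) : ∃ π, IsOptimal M K r π := by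
  have hc : IsCompact {π : ℕ → S → A → ℝ | IsPolicy π} := by
    have := isCompact_univ_pi (fun _ : ℕ => isCompact_univ_pi
      (fun _ : S => isCompact_stdSimplex ℝ A))
    convert this using 1
    ext π
    simp [IsPolicy, Set.mem_pi]
  have hf : IsCompact {π : ℕ → S → A → ℝ | IsFeasible M π} :=
    hc.inter_right (isClosed_le continuous_const (continuous_trajExp _ _ _ _ _))
  obtain ⟨π, hπ, hmax⟩ := hf.exists_isMaxOn ⟨π₀, h₀⟩
    (f := fun π => ∑ k ∈ Finset.Icc 1 K, value M (r k) π 1 M.s₁)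
    (continuous_finsetSum _ fun k _ => continuous_trajExp _ _ _ _ _).continuousOn
  exact ⟨π, hπ, fun π' h' => hmax h'⟩

/-- Slater condition with constant `γ`. -/
def Slater {S A : Type*} [Fintype S] [Fintype A] {d : ℕ} (M : LinearMixtureCMDP S A d)
    (γ : ℝ) : Prop :=
  0 < γ ∧ ∃ π, IsPolicy π ∧ M.b + γ ≤ value M M.g π 1 M.s₁

/-- Regret of the policies `π^1, …, π^K` against `πstar` for the rewards `r^1, …, r^K`. -/
def regret {S A : Type*} [Fintype S] [Fintype A] {d : ℕ} (M : LinearMixtureCMDP S A d)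
    (K : ℕ) (r : ℕ → ℕ → S → A → ℝ) (πstar : ℕ → S → A → ℝ) (π : ℕ → ℕ → S → A → ℝ) : ℝ :=
  ∑ k ∈ Finset.Icc 1 K, (value M (r k) πstar 1 M.s₁ - value M (r k) (π k) 1 M.s₁)

/-- Constraint violation of the policies `π^1, …, π^K`. -/
def violation {S A : Type*} [Fintype S] [Fintype A] {d : ℕ} (M : LinearMixtureCMDP S A d)
    (K : ℕ) (π : ℕ → ℕ → S → A → ℝ) : ℝ :=
  max (∑ k ∈ Finset.Icc 1 K, (M.b - value M M.g (π k) 1 M.s₁)) 0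

/-! ### The algorithm PD-POWERS -/

/-- The input parameters `λ`, `α`, `η`, `θ` of the algorithm and the confidence parameter `δ`. -/
structure Params where
  lam : ℝ
  alpha : ℝ
  eta : ℝ
  theta : ℝ
  delta : ℝ

/-- `[x]_{[lo,hi]}` -/
noncomputable def clip (lo hi x : ℝ) : ℝ := max (min x hi) lo

/-- `‖x‖_A = √(xᵀ A x)` -/
noncomputable def wnorm {d : ℕ} (A : Matrix (Fin d) (Fin d) ℝ) (x : Fin d → ℝ) : ℝ :=
  Real.sqrt (x ⬝ᵥ (A *ᵥ x))

/-- `β̂_k` -/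
noncomputable def betaHat (d H : ℕ) (B : ℝ) (p : Params) (k : ℕ) : ℝ :=
  8 * Real.sqrt (d * Real.log (1 + k / p.lam) * Real.log (8 * H * k ^ 2 / p.delta))
    + 4 * Real.sqrt d * Real.log (8 * H * k ^ 2 / p.delta) + Real.sqrt p.lam * B

/-- `β̃_k` -/
noncomputable def betaTilde (d H : ℕ) (B : ℝ) (p : Params) (k : ℕ) : ℝ :=
  8 * H ^ 2 * Real.sqrt (d * Real.log (1 + k * H ^ 4 / (d * p.lam))
      * Real.log (8 * H * k ^ 2 / p.delta))
    + 4 * H ^ 2 * Real.log (8 * H * k ^ 2 / p.delta) + Real.sqrt p.lam * B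

/-- `β̌_k` -/
noncomputable def betaCheck (d H : ℕ) (B : ℝ) (p : Params) (k : ℕ) : ℝ :=
  8 * d * Real.sqrt (Real.log (1 + k / p.lam) * Real.log (8 * H * k ^ 2 / p.delta))
    + 4 * Real.sqrt d * Real.log (8 * H * k ^ 2 / p.delta) + Real.sqrt p.lam * B

/-- The regression statistics `Σ̂_{k,h}, b̂_{k,h}, Σ̃_{k,h}, b̃_{k,h}` (functions of `h`) of one of
the two signals `r`, `g` at the start of an episode `k`. -/
structure Ridge (d : ℕ) where
  sigHat : ℕ → Matrix (Fin d) (Fin d) ℝ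
  bHat : ℕ → Fin d → ℝ
  sigTilde : ℕ → Matrix (Fin d) (Fin d) ℝ
  bTilde : ℕ → Fin d → ℝ

/-- `θ̂_{k,h} = Σ̂_{k,h}⁻¹ b̂_{k,h}` -/
noncomputable def Ridge.thetaHat {d : ℕ} (R : Ridge d) (h : ℕ) : Fin d → ℝ :=
  (R.sigHat h)⁻¹ *ᵥ R.bHat h

/-- `θ̃_{k,h} = Σ̃_{k,h}⁻¹ b̃_{k,h}` -/
noncomputable def Ridge.thetaTilde {d : ℕ} (R : Ridge d) (h : ℕ) : Fin d → ℝ :=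
  (R.sigTilde h)⁻¹ *ᵥ R.bTilde h

section Estimation

variable {S A : Type*} [Fintype S] [Fintype A] {d : ℕ}

/-- The optimistic `Q`-estimate at step `h` of episode `k` for the signal `ℓ`, given the value
estimate `V` for step `h + 1`. -/
noncomputable def qStep (M : KnownModel S A d) (p : Params) (k : ℕ) (R : Ridge d)
    (ℓ : ℕ → S → A → ℝ) (h : ℕ) (V : S → ℝ) (s : S) (a : A) : ℝ :=
  clip 0 ((M.H : ℝ) - h + 1)
    (ℓ h s a + R.thetaHat h ⬝ᵥ phiV M.φ V s a
      + betaHat d M.H M.B p k * wnorm (R.sigHat h)⁻¹ (phiV M.φ V s a))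

/-- The value estimate with `n` steps to go, that is, at step `H + 1 - n`; `π` is the policy of
the episode `k`. -/
noncomputable def vRem (M : KnownModel S A d) (p : Params) (k : ℕ) (R : Ridge d)
    (ℓ : ℕ → S → A → ℝ) (π : ℕ → S → A → ℝ) : ℕ → S → ℝ
  | 0 => fun _ => 0
  | n + 1 => fun s => ∑ a, π (M.H - n) s a *
      qStep M p k R ℓ (M.H - n) (vRem M p k R ℓ π n) s a

/-- `V_{k,h}(s)`, with `V_{k,H+1} = 0`. -/
noncomputable def vEst (M : KnownModel S A d) (p : Params) (k : ℕ) (R : Ridge d)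
    (ℓ : ℕ → S → A → ℝ) (π : ℕ → S → A → ℝ) (h : ℕ) : S → ℝ :=
  vRem M p k R ℓ π (M.H + 1 - h)

/-- `Q_{k,h}(s,a)` -/
noncomputable def qEst (M : KnownModel S A d) (p : Params) (k : ℕ) (R : Ridge d)
    (ℓ : ℕ → S → A → ℝ) (π : ℕ → S → A → ℝ) (h : ℕ) : S → A → ℝ :=
  qStep M p k R ℓ h (vEst M p k R ℓ π (h + 1))

/-- The variance estimate at step `h`, for the value estimate `V` of step `h + 1`. -/
noncomputable def varEst (M : KnownModel S A d) (R : Ridge d) (h : ℕ) (V : S → ℝ)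
    (s : S) (a : A) : ℝ :=
  clip 0 ((M.H : ℝ) ^ 2) (phiV M.φ (fun x => V x ^ 2) s a ⬝ᵥ R.thetaTilde h)
    - clip 0 (M.H : ℝ) (phiV M.φ V s a ⬝ᵥ R.thetaHat h) ^ 2

/-- The offset term `E_{k,h}`. -/
noncomputable def offset (M : KnownModel S A d) (p : Params) (k : ℕ) (R : Ridge d) (h : ℕ)
    (V : S → ℝ) (s : S) (a : A) : ℝ :=
  min ((M.H : ℝ) ^ 2) (betaTilde d M.H M.B p k *
      wnorm (R.sigTilde h)⁻¹ (phiV M.φ (fun x => V x ^ 2) s a))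
    + min ((M.H : ℝ) ^ 2) (2 * M.H * betaCheck d M.H M.B p k *
      wnorm (R.sigHat h)⁻¹ (phiV M.φ V s a))

/-- `σ̄_{k,h}²` -/
noncomputable def sigmaSq (M : KnownModel S A d) (p : Params) (k : ℕ) (R : Ridge d) (h : ℕ)
    (V : S → ℝ) (s : S) (a : A) : ℝ :=
  max ((M.H : ℝ) ^ 2 / d) (varEst M R h V s a + offset M p k R h V s a)

/-- The regression statistics after the trajectory `s_1, a_1, …, s_H, a_H, s_{H+1}` of episode `k`;
`V h` is the value estimate `V_{k,h}`. -/
noncomputable def Ridge.next (M : KnownModel S A d) (p : Params) (k : ℕ) (R : Ridge d)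
    (V : ℕ → S → ℝ) (s : ℕ → S) (a : ℕ → A) : Ridge d where
  sigHat h := R.sigHat h + (sigmaSq M p k R h (V (h + 1)) (s h) (a h))⁻¹ •
    Matrix.vecMulVec (phiV M.φ (V (h + 1)) (s h) (a h)) (phiV M.φ (V (h + 1)) (s h) (a h))
  bHat h := R.bHat h + ((sigmaSq M p k R h (V (h + 1)) (s h) (a h))⁻¹ * V (h + 1) (s (h + 1))) •
    phiV M.φ (V (h + 1)) (s h) (a h)
  sigTilde h := R.sigTilde h +
    Matrix.vecMulVec (phiV M.φ (fun x => V (h + 1) x ^ 2) (s h) (a h))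
      (phiV M.φ (fun x => V (h + 1) x ^ 2) (s h) (a h))
  bTilde h := R.bTilde h + (V (h + 1) (s (h + 1)) ^ 2) •
    phiV M.φ (fun x => V (h + 1) x ^ 2) (s h) (a h)

/-- What the agent has computed before episode `k` is played: the policy `π^k`, the dual variable
`Y_k`, and the regression statistics for the signals `r` and `g`. -/
structure AgentState (S A : Type*) (d : ℕ) where
  pol : ℕ → S → A → ℝ
  Y : ℝ
  ridgeR : Ridge d
  ridgeG : Ridge d

/-- Initialization: uniform policy, zero dual variable, `Σ = λ I`, `b = 0`. -/
noncomputable def initState (S A : Type*) [Fintype A] (d : ℕ) (p : Params) :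
    AgentState S A d where
  pol _ _ _ := 1 / Fintype.card A
  Y := 0
  ridgeR := ⟨fun _ => p.lam • 1, fun _ => 0, fun _ => p.lam • 1, fun _ => 0⟩
  ridgeG := ⟨fun _ => p.lam • 1, fun _ => 0, fun _ => p.lam • 1, fun _ => 0⟩

/-- The weight `π̃_h^k(a|s) exp(α (Q_{k,h}^r(s,a) + Y_k Q_{k,h}^g(s,a)))`, where
`π̃ = (1 - θ) π + θ π_unif`. -/
noncomputable def polWeight (p : Params) (Y : ℝ) (π qr qg : S → A → ℝ) (s : S) (a : A) : ℝ :=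
  ((1 - p.theta) * π s a + p.theta * (1 / Fintype.card A)) *
    Real.exp (p.alpha * (qr s a + Y * qg s a))

/-- One episode: from the state before episode `k`, the trajectory of episode `k` and the revealed
reward `r^k`, to the state before episode `k + 1`. -/
noncomputable def AgentState.next (M : KnownModel S A d) (p : Params) (k : ℕ)
    (σ : AgentState S A d) (s : ℕ → S) (a : ℕ → A) (r : ℕ → S → A → ℝ) : AgentState S A d where
  pol h x c :=
    polWeight p σ.Y (σ.pol h) (qEst M p k σ.ridgeR r σ.pol h) (qEst M p k σ.ridgeG M.g σ.pol h) x c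
      / ∑ c', polWeight p σ.Y (σ.pol h) (qEst M p k σ.ridgeR r σ.pol h)
          (qEst M p k σ.ridgeG M.g σ.pol h) x c'
  Y := max ((1 - p.alpha * p.eta * M.H ^ 3) * σ.Y
    + p.eta * (M.b - vEst M p k σ.ridgeG M.g σ.pol 1 M.s₁ - p.alpha * M.H ^ 3
        - 2 * p.theta * M.H ^ 2)) 0
  ridgeR := σ.ridgeR.next M p k (vEst M p k σ.ridgeR r σ.pol) s a
  ridgeG := σ.ridgeG.next M p k (vEst M p k σ.ridgeG M.g σ.pol) s a

/-- The state of the agent before episode `k ≥ 1`, as a function of the observed states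
`s k h = s_h^k`, actions `a k h = a_h^k` and rewards `r k h = r_h^k` of the earlier episodes. -/
noncomputable def agent (M : KnownModel S A d) (p : Params) (s : ℕ → ℕ → S) (a : ℕ → ℕ → A)
    (r : ℕ → ℕ → S → A → ℝ) : ℕ → AgentState S A d
  | 0 => initState S A d p
  | 1 => initState S A d p
  | k + 2 => (agent M p s a r (k + 1)).next M p (k + 1) (s (k + 1)) (a (k + 1)) (r (k + 1))

end Estimation

/-! ### The interaction of the agent, the environment and the adversary -/

/-- The random states `s_h^k`, actions `a_h^k` and rewards `r_h^k`. -/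
structure Interaction (Ω S A : Type*) where
  state : ℕ → ℕ → Ω → S
  act : ℕ → ℕ → Ω → A
  rew : ℕ → ℕ → Ω → S → A → ℝ

/-- The information before the first step of episode `k`: the trajectories of the earlier episodes
and the rewards of the episodes up to `k`. -/
@[reducible] def Interaction.episodeSigma {Ω S A : Type*} (X : Interaction Ω S A) (H k : ℕ) : MeasurableSpace Ω :=
  (⨆ i ∈ Set.Ico 1 k, ⨆ j ∈ Set.Icc 1 (H + 1), MeasurableSpace.comap (X.state i j) ⊤) ⊔
  (⨆ i ∈ Set.Ico 1 k, ⨆ j ∈ Set.Icc 1 H, MeasurableSpace.comap (X.act i j) ⊤) ⊔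
  (⨆ i ∈ Set.Icc 1 k, ⨆ j ∈ Set.Icc 1 H, ⨆ s : S, ⨆ a : A,
    MeasurableSpace.comap (fun ω => X.rew i j ω s a) (borel ℝ))

/-- The information before the action `a_h^k` is drawn: in addition `s_1^k, a_1^k, …, s_h^k`. -/
@[reducible] def Interaction.preActSigma {Ω S A : Type*} (X : Interaction Ω S A) (H k h : ℕ) : MeasurableSpace Ω :=
  X.episodeSigma H k ⊔ (⨆ j ∈ Set.Icc 1 h, MeasurableSpace.comap (X.state k j) ⊤) ⊔
    (⨆ j ∈ Set.Ico 1 h, MeasurableSpace.comap (X.act k j) ⊤)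

/-- The information before the state `s_{h+1}^k` is drawn: in addition `a_h^k`. -/
@[reducible] def Interaction.postActSigma {Ω S A : Type*} (X : Interaction Ω S A) (H k h : ℕ) : MeasurableSpace Ω :=
  X.preActSigma H k h ⊔ MeasurableSpace.comap (X.act k h) ⊤

/-- The policy `π^k` that PD-POWERS plays in episode `k`. -/
noncomputable def Interaction.policy {Ω S A : Type*} [Fintype S] [Fintype A] {d : ℕ}
    (X : Interaction Ω S A) (M : KnownModel S A d) (p : Params) (ω : Ω) (k : ℕ) : ℕ → S → A → ℝ :=
  (agent M p (fun i j => X.state i j ω) (fun i j => X.act i j ω) (fun i j => X.rew i j ω) k).pol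

/-- `X` is a run of PD-POWERS for `K` episodes in the CMDP `M`, against an adversary whose reward
`r^k`, fixed before episode `k` is played, may depend in any way on the past:
`a_h^k ∼ π_h^k(·|s_h^k)` and `s_{h+1}^k ∼ P_h(·|s_h^k,a_h^k)` given the past. -/
structure IsRun {Ω S A : Type*} [MeasurableSpace Ω] [Fintype S] [Fintype A] {d : ℕ}
    (μ : Measure Ω) (M : LinearMixtureCMDP S A d) (p : Params) (K : ℕ) (X : Interaction Ω S A) :
    Prop where
  meas_state : ∀ k ∈ Set.Icc 1 K, ∀ h ∈ Set.Icc 1 (M.H + 1), ∀ s,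
    MeasurableSet {ω | X.state k h ω = s}
  meas_act : ∀ k ∈ Set.Icc 1 K, ∀ h ∈ Set.Icc 1 M.H, ∀ a, MeasurableSet {ω | X.act k h ω = a}
  meas_rew : ∀ k ∈ Set.Icc 1 K, ∀ h ∈ Set.Icc 1 M.H, ∀ s a, Measurable fun ω => X.rew k h ω s a
  rew_mem : ∀ k ∈ Set.Icc 1 K, ∀ h ∈ Set.Icc 1 M.H, ∀ ω s a, X.rew k h ω s a ∈ Set.Icc (0 : ℝ) 1
  state_one : ∀ k ∈ Set.Icc 1 K, ∀ ω, X.state k 1 ω = M.s₁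
  act_law : ∀ k ∈ Set.Icc 1 K, ∀ h ∈ Set.Icc 1 M.H, ∀ a,
    μ[Set.indicator {ω | X.act k h ω = a} (fun _ => (1 : ℝ)) | X.preActSigma M.H k h]
      =ᵐ[μ] fun ω => X.policy M.toKnownModel p ω k h (X.state k h ω) a
  state_law : ∀ k ∈ Set.Icc 1 K, ∀ h ∈ Set.Icc 1 M.H, ∀ s,
    μ[Set.indicator {ω | X.state k (h + 1) ω = s} (fun _ => (1 : ℝ)) | X.postActSigma M.H k h]
      =ᵐ[μ] fun ω => M.P h (X.state k h ω) (X.act k h ω) s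

/-! ### The rates -/

/-- `√(dH⁴K) + √(d²H³K) + H⁵√K/γ²` -/
noncomputable def regretRate (d H K : ℕ) (γ : ℝ) : ℝ :=
  Real.sqrt (d * H ^ 4 * K) + Real.sqrt (d ^ 2 * H ^ 3 * K) + H ^ 5 * Real.sqrt K / γ ^ 2

/-- `√(dH⁴K) + √(d²H³K) + H³√K/γ` -/
noncomputable def violationRate (d H K : ℕ) (γ : ℝ) : ℝ :=
  Real.sqrt (d * H ^ 4 * K) + Real.sqrt (d ^ 2 * H ^ 3 * K) + H ^ 3 * Real.sqrt K / γ

/-- The logarithmic factor whose powers are hidden by `Õ`. -/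
noncomputable def logFactor (d H K nA : ℕ) (B δ : ℝ) : ℝ :=
  Real.log (2 + d * H * K * nA * B / δ)

end PDPowers

/-!
The proof separates two questions. How well does the algorithm do if its estimates of the values are
taken at face value? And how far are these estimates from the true values?

*Drift.* On the event that the estimates are optimistic, `Q_h ≥ ℓ_h + P_h V_{h+1}` for both signals,
the exponential-weights update is a step of mirror descent for the reward plus `Y_k` times the
constraint. Together with `Y_k²/2` for the dual variable, the relative entropy of a comparator policy
with respect to the (mixed) policy `π^k` gives a potential whose drift bounds
`η (V^{r,π} - V^r_k) + η Y_k (V^{g,π} - b)`. Applied to the optimal policy this bounds the regret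
with respect to the estimates (`drift_sum`). Applied to the Slater policy it shows that the potential
decreases whenever `Y_k` is large, so `Y_k` stays of order `H²/γ` (`dual_variable_le`), and since the
dual variable accumulates the violation with respect to the estimates, the latter is of order
`H³√K/γ` (`violation_est_le`).

*Accuracy.* The estimates `θ̂`, `θ̃` are ridge regressions whose noise is a martingale difference. A
Bernstein inequality for self-normalized sums (`CondLaw.selfNormalized`), derived from Freedman's
inequality for finite-valued variables, puts `θ*` into the confidence ellipsoids. For the weighted
regression it is used twice: with the trivial variance bound `d`, which makes the variance estimates
valid, and with the variance bound `1`, which holds as soon as these are. Optimism follows.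

*Estimation error.* Along the trajectory the error of the value estimate is at most the sum of the
bonuses plus martingale differences. By Cauchy–Schwarz and the elliptical potential lemma
(`sum_min_one_wnorm_le`) the bonuses are controlled by the sum of the weights `σ̄²`; these in turn are
controlled by the variances of the true values, whose sum along an episode telescopes to `O(H²)`
instead of `H³`, and by the bonuses themselves. Solving the resulting quadratic inequality
(`sum_estimation_le`) gives `√(dH⁴K) + √(d²H³K)`, where `K ≥ d³H³` absorbs the terms of lower order.

For fixed `h` all martingales are indexed by the episode `k` alone, with the information available
in episode `k` just before the action or the state is drawn; a union bound over `h` costs a factor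
`H` in the confidence level only.
-/

namespace PDPowers

/-! ### Quadratic forms and rank-one updates -/

section LinearAlgebra

variable {d : ℕ} {Z : Matrix (Fin d) (Fin d) ℝ}

lemma dotProduct_mulVec_comm (hZ : Z.IsHermitian) (x y : Fin d → ℝ) :
    x ⬝ᵥ (Z *ᵥ y) = y ⬝ᵥ (Z *ᵥ x) := by
  have h : Zᵀ = Z := by rw [← Matrix.conjTranspose_eq_transpose_of_trivial]; exact hZ
  rw [Matrix.dotProduct_mulVec, ← Matrix.mulVec_transpose, h, dotProduct_comm]

lemma quadForm_nonneg (hZ : Z.PosSemidef) (x : Fin d → ℝ) : 0 ≤ x ⬝ᵥ (Z *ᵥ x) := by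
  simpa using hZ.dotProduct_mulVec_nonneg x

lemma wnorm_sq (hZ : Z.PosSemidef) (x : Fin d → ℝ) : wnorm Z x ^ 2 = x ⬝ᵥ (Z *ᵥ x) :=
  Real.sq_sqrt (quadForm_nonneg hZ x)

lemma wnorm_nonneg (Z : Matrix (Fin d) (Fin d) ℝ) (x : Fin d → ℝ) : 0 ≤ wnorm Z x :=
  Real.sqrt_nonneg _

lemma abs_dotProduct_mulVec_le (hZ : Z.PosSemidef) (x y : Fin d → ℝ) :
    |x ⬝ᵥ (Z *ᵥ y)| ≤ wnorm Z x * wnorm Z y := by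
  have hd : discrim (y ⬝ᵥ (Z *ᵥ y)) (2 * (x ⬝ᵥ (Z *ᵥ y))) (x ⬝ᵥ (Z *ᵥ x)) ≤ 0 := by
    refine discrim_le_zero fun t => ?_
    have h := quadForm_nonneg hZ (x + t • y)
    simp only [Matrix.mulVec_add, Matrix.mulVec_smul, dotProduct_add, add_dotProduct,
      dotProduct_smul, smul_dotProduct, smul_eq_mul, dotProduct_mulVec_comm hZ.1 y x] at h
    linarith
  refine abs_le_of_sq_le_sq ?_ (mul_nonneg (wnorm_nonneg _ _) (wnorm_nonneg _ _))
  rw [mul_pow, wnorm_sq hZ, wnorm_sq hZ]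
  unfold discrim at hd
  linarith

lemma wnorm_sub_le (hZ : Z.PosSemidef) (x y : Fin d → ℝ) :
    wnorm Z (x - y) ≤ wnorm Z x + wnorm Z y := by
  refine le_of_sq_le_sq ?_ (add_nonneg (wnorm_nonneg _ _) (wnorm_nonneg _ _))
  have h := neg_abs_le (x ⬝ᵥ (Z *ᵥ y))
  have h' := abs_dotProduct_mulVec_le hZ x y
  have : wnorm Z (x - y) ^ 2 = wnorm Z x ^ 2 + wnorm Z y ^ 2 - 2 * (x ⬝ᵥ (Z *ᵥ y)) := by
    simp only [wnorm_sq hZ, Matrix.mulVec_sub, dotProduct_sub, sub_dotProduct,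
      dotProduct_mulVec_comm hZ.1 y x]
    ring
  nlinarith

lemma wnorm_smul (Z : Matrix (Fin d) (Fin d) ℝ) (c : ℝ) (x : Fin d → ℝ) :
    wnorm Z (c • x) = |c| * wnorm Z x := by
  unfold wnorm
  rw [Matrix.mulVec_smul, dotProduct_smul, smul_dotProduct, smul_eq_mul, smul_eq_mul, ← mul_assoc,
    Real.sqrt_mul (mul_self_nonneg c), Real.sqrt_mul_self_eq_abs]

lemma mulVec_inv_mulVec (hZ : Z.PosDef) (x : Fin d → ℝ) : Z *ᵥ (Z⁻¹ *ᵥ x) = x := by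
  rw [Matrix.mulVec_mulVec, Matrix.mul_nonsing_inv _ ((Matrix.isUnit_iff_isUnit_det _).1 hZ.isUnit),
    Matrix.one_mulVec]

lemma inv_mulVec_mulVec (hZ : Z.PosDef) (x : Fin d → ℝ) : Z⁻¹ *ᵥ (Z *ᵥ x) = x := by
  rw [Matrix.mulVec_mulVec, Matrix.nonsing_inv_mul _ ((Matrix.isUnit_iff_isUnit_det _).1 hZ.isUnit),
    Matrix.one_mulVec]

lemma wnorm_inv_mulVec (hZ : Z.PosDef) (x : Fin d → ℝ) : wnorm Z (Z⁻¹ *ᵥ x) = wnorm Z⁻¹ x := by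
  unfold wnorm
  rw [mulVec_inv_mulVec hZ, dotProduct_comm]

lemma abs_dotProduct_le_wnorm_mul (hZ : Z.PosDef) (u x : Fin d → ℝ) :
    |u ⬝ᵥ x| ≤ wnorm Z u * wnorm Z⁻¹ x := by
  have h := abs_dotProduct_mulVec_le hZ.posSemidef u (Z⁻¹ *ᵥ x)
  rwa [mulVec_inv_mulVec hZ, wnorm_inv_mulVec hZ] at h

lemma posSemidef_vecMulVec_self (x : Fin d → ℝ) : (Matrix.vecMulVec x x).PosSemidef := by
  simpa using Matrix.posSemidef_vecMulVec_self_star x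

lemma rankOne_mulVec (x y : Fin d → ℝ) :
    Matrix.vecMulVec x x *ᵥ y = (x ⬝ᵥ y) • x := by
  rw [Matrix.vecMulVec_mulVec]; ext i; simp [mul_comm]

/-- The Sherman–Morrison formula, applied to a vector. -/
lemma inv_rankOne_update_mulVec (hZ : Z.PosDef) (x y : Fin d → ℝ) :
    (Z + Matrix.vecMulVec x x)⁻¹ *ᵥ y =
      Z⁻¹ *ᵥ y - ((x ⬝ᵥ (Z⁻¹ *ᵥ y)) / (1 + x ⬝ᵥ (Z⁻¹ *ᵥ x))) • (Z⁻¹ *ᵥ x) := by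
  have hZ' : (Z + Matrix.vecMulVec x x).PosDef := hZ.add_posSemidef (posSemidef_vecMulVec_self x)
  have hw : 0 ≤ x ⬝ᵥ (Z⁻¹ *ᵥ x) := quadForm_nonneg hZ.inv.posSemidef x
  have key : (Z + Matrix.vecMulVec x x) *ᵥ
      (Z⁻¹ *ᵥ y - ((x ⬝ᵥ (Z⁻¹ *ᵥ y)) / (1 + x ⬝ᵥ (Z⁻¹ *ᵥ x))) • (Z⁻¹ *ᵥ x)) = y := by
    rw [Matrix.add_mulVec, rankOne_mulVec, Matrix.mulVec_sub, Matrix.mulVec_smul,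
      mulVec_inv_mulVec hZ, mulVec_inv_mulVec hZ, dotProduct_sub, dotProduct_smul, smul_eq_mul,
      sub_add, ← sub_smul, sub_eq_self]
    have : (x ⬝ᵥ (Z⁻¹ *ᵥ y)) / (1 + x ⬝ᵥ (Z⁻¹ *ᵥ x)) - (x ⬝ᵥ (Z⁻¹ *ᵥ y) -
        (x ⬝ᵥ (Z⁻¹ *ᵥ y)) / (1 + x ⬝ᵥ (Z⁻¹ *ᵥ x)) * (x ⬝ᵥ (Z⁻¹ *ᵥ x))) = 0 := by
      field_simp
      ring
    rw [this, zero_smul]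
  conv_lhs => rw [← key]
  rw [inv_mulVec_mulVec hZ']

lemma wnorm_inv_rankOne_update_sq_le (hZ : Z.PosDef) (x y : Fin d → ℝ) (c : ℝ) :
    wnorm (Z + Matrix.vecMulVec x x)⁻¹ (y + c • x) ^ 2 ≤
      wnorm Z⁻¹ y ^ 2 + 2 * c * (x ⬝ᵥ (Z⁻¹ *ᵥ y)) / (1 + wnorm Z⁻¹ x ^ 2)
        + c ^ 2 * (wnorm Z⁻¹ x ^ 2 / (1 + wnorm Z⁻¹ x ^ 2)) := by
  have hZ' : (Z + Matrix.vecMulVec x x).PosDef := hZ.add_posSemidef (posSemidef_vecMulVec_self x)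
  have hw : 0 ≤ x ⬝ᵥ (Z⁻¹ *ᵥ x) := quadForm_nonneg hZ.inv.posSemidef x
  rw [wnorm_sq hZ'.inv.posSemidef, wnorm_sq hZ.inv.posSemidef, wnorm_sq hZ.inv.posSemidef,
    inv_rankOne_update_mulVec hZ]
  simp only [Matrix.mulVec_add, Matrix.mulVec_smul, dotProduct_add, add_dotProduct,
    dotProduct_smul, smul_dotProduct, smul_eq_mul, dotProduct_sub,
    dotProduct_mulVec_comm hZ.inv.1 y x]
  set w := x ⬝ᵥ (Z⁻¹ *ᵥ x)
  set e := x ⬝ᵥ (Z⁻¹ *ᵥ y)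
  have : y ⬝ᵥ Z⁻¹ *ᵥ y + c * e - (e + c * w) / (1 + w) * e +
      (c * (e + c * w - (e + c * w) / (1 + w) * w)) =
      y ⬝ᵥ Z⁻¹ *ᵥ y + 2 * c * e / (1 + w) + c ^ 2 * (w / (1 + w)) - e ^ 2 / (1 + w) := by
    field_simp
    ring
  have h2 : 0 ≤ e ^ 2 / (1 + w) := by positivity
  linarith

lemma det_rankOne_update (hZ : Z.PosDef) (x : Fin d → ℝ) :
    (Z + Matrix.vecMulVec x x).det = Z.det * (1 + wnorm Z⁻¹ x ^ 2) := by
  rw [Matrix.vecMulVec_eq Unit,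
    Matrix.det_add_replicateCol_mul_replicateRow ((Matrix.isUnit_iff_isUnit_det _).1 hZ.isUnit),
    wnorm_sq hZ.inv.posSemidef, Matrix.dotProduct_mulVec]
  congr 1
  rw [Matrix.det_unique, Matrix.add_apply, Matrix.one_apply_eq, ← Matrix.replicateRow_vecMul,
    Matrix.replicateRow_mul_replicateCol_apply]

/-- The arithmetic-geometric mean inequality for the eigenvalues. -/
lemma log_det_le (hd : 0 < d) (hZ : Z.PosDef) :
    Real.log Z.det ≤ d * Real.log (Z.trace / d) := by
  have hd' : (0 : ℝ) < d := by exact_mod_cast hd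
  have he := fun i => hZ.eigenvalues_pos i
  have hdet : Z.det = ∏ i, hZ.isHermitian.eigenvalues i := by
    simpa using hZ.isHermitian.det_eq_prod_eigenvalues
  have htr : Z.trace = ∑ i, hZ.isHermitian.eigenvalues i := by
    simpa using hZ.isHermitian.trace_eq_sum_eigenvalues
  have hne : Nonempty (Fin d) := ⟨⟨0, hd⟩⟩
  have hm := Real.geom_mean_le_arith_mean_weighted Finset.univ (fun _ : Fin d => (d : ℝ)⁻¹)
    hZ.isHermitian.eigenvalues (fun _ _ => by positivity) (by simp [hd'.ne'])
    (fun i _ => (he i).le)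
  rw [← Finset.mul_sum, Real.finsetProd_rpow _ _ (fun i _ => (he i).le), ← hdet, ← htr,
    inv_mul_eq_div] at hm
  have h := Real.log_le_log (Real.rpow_pos_of_pos hZ.det_pos _) hm
  rw [Real.log_rpow hZ.det_pos] at h
  rwa [inv_mul_le_iff₀ hd'] at h

end LinearAlgebra

/-! ### Gram matrices and the elliptical potential -/

section Gram

variable {d : ℕ}

/-- The regularized Gram matrix `lam I + ∑ x_i x_iᵀ` of the vectors with index `1 ≤ i < k`. -/
noncomputable def gram (lam : ℝ) (x : ℕ → Fin d → ℝ) (k : ℕ) : Matrix (Fin d) (Fin d) ℝ :=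
  lam • 1 + ∑ i ∈ Finset.Ico 1 k, Matrix.vecMulVec (x i) (x i)

lemma gram_succ (lam : ℝ) (x : ℕ → Fin d → ℝ) {k : ℕ} (hk : 1 ≤ k) :
    gram lam x (k + 1) = gram lam x k + Matrix.vecMulVec (x k) (x k) := by
  unfold gram
  rw [Finset.sum_Ico_succ_top hk, add_assoc]

lemma gram_posDef {lam : ℝ} (hlam : 0 < lam) (x : ℕ → Fin d → ℝ) (k : ℕ) :
    (gram lam x k).PosDef :=
  (Matrix.PosDef.one.smul hlam).add_posSemidef
    (Matrix.posSemidef_sum _ fun i _ => posSemidef_vecMulVec_self (x i))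

lemma trace_gram_le {lam c : ℝ} {x : ℕ → Fin d → ℝ} {k : ℕ}
    (hx : ∀ i ∈ Finset.Ico 1 k, x i ⬝ᵥ x i ≤ c) (hc : 0 ≤ c) :
    (gram lam x k).trace ≤ lam * d + k * c := by
  unfold gram
  rw [Matrix.trace_add, Matrix.trace_smul, Matrix.trace_one, Matrix.trace_sum, Fintype.card_fin,
    smul_eq_mul]
  gcongr
  calc _ ≤ ∑ i ∈ Finset.Ico 1 k, c := Finset.sum_le_sum fun i hi => by
        rw [Matrix.trace_vecMulVec]; exact hx i hi
    _ = ((k - 1 : ℕ) : ℝ) * c := by simp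
    _ ≤ k * c := by gcongr; omega

/-- The elliptical potential identity: the logarithms of the relative increments of the
determinant of the Gram matrix telescope. -/
lemma sum_log_one_add_wnorm_le (hd : 0 < d) {lam c : ℝ} (hlam : 0 < lam) (hc : 0 ≤ c)
    {x : ℕ → Fin d → ℝ} {k : ℕ} (hk : 1 ≤ k) (hx : ∀ i ∈ Finset.Ico 1 k, x i ⬝ᵥ x i ≤ c) :
    ∑ i ∈ Finset.Ico 1 k, Real.log (1 + wnorm (gram lam x i)⁻¹ (x i) ^ 2) ≤
      d * Real.log (1 + k * c / (d * lam)) := by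
  have hd' : (0 : ℝ) < d := by exact_mod_cast hd
  have tele : ∀ n, 1 ≤ n → ∑ i ∈ Finset.Ico 1 n, Real.log (1 + wnorm (gram lam x i)⁻¹ (x i) ^ 2) =
      Real.log (gram lam x n).det - d * Real.log lam := by
    intro n hn
    induction n, hn using Nat.le_induction with
    | base => simp [gram, Real.log_pow]
    | succ n hn ih =>
      rw [Finset.sum_Ico_succ_top hn, ih, gram_succ _ _ hn,
        det_rankOne_update (gram_posDef hlam x n),
        Real.log_mul (gram_posDef hlam x n).det_pos.ne' (by positivity)]
      ring
  rw [tele k hk]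
  have htr : 0 < (gram lam x k).trace :=
    haveI : Nonempty (Fin d) := ⟨⟨0, hd⟩⟩
    (gram_posDef hlam x k).trace_pos
  have h1 := log_det_le hd (gram_posDef hlam x k)
  have h2 : Real.log ((gram lam x k).trace / d) ≤
      Real.log (1 + k * c / (d * lam)) + Real.log lam := by
    rw [← Real.log_mul (by positivity) hlam.ne']
    refine Real.log_le_log (by positivity) ?_
    rw [div_le_iff₀ hd']
    refine (trace_gram_le hx hc).trans_eq ?_
    field_simp
  nlinarith

lemma div_one_add_le_log {y : ℝ} (hy : 0 ≤ y) : y / (1 + y) ≤ Real.log (1 + y) := by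
  have h := Real.one_sub_inv_le_log_of_pos (x := 1 + y) (by linarith)
  refine le_trans (le_of_eq ?_) h
  field_simp
  ring

lemma min_one_le_two_mul_log {y : ℝ} (hy : 0 ≤ y) : min 1 y ≤ 2 * Real.log (1 + y) := by
  have h := div_one_add_le_log hy
  have h2 : min 1 y ≤ 2 * (y / (1 + y)) := by
    rw [← mul_div_assoc, le_div_iff₀ (by linarith)]
    rcases le_total 1 y with h1 | h1
    · rw [min_eq_left h1]; linarith
    · rw [min_eq_right h1]; nlinarith
  linarith

lemma sum_div_one_add_wnorm_le (hd : 0 < d) {lam c : ℝ} (hlam : 0 < lam) (hc : 0 ≤ c)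
    {x : ℕ → Fin d → ℝ} {k : ℕ} (hk : 1 ≤ k) (hx : ∀ i ∈ Finset.Ico 1 k, x i ⬝ᵥ x i ≤ c) :
    ∑ i ∈ Finset.Ico 1 k, wnorm (gram lam x i)⁻¹ (x i) ^ 2 /
        (1 + wnorm (gram lam x i)⁻¹ (x i) ^ 2) ≤ d * Real.log (1 + k * c / (d * lam)) :=
  (Finset.sum_le_sum fun _ _ => div_one_add_le_log (sq_nonneg _)).trans
    (sum_log_one_add_wnorm_le hd hlam hc hk hx)

lemma sum_min_one_wnorm_le (hd : 0 < d) {lam c : ℝ} (hlam : 0 < lam) (hc : 0 ≤ c)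
    {x : ℕ → Fin d → ℝ} {k : ℕ} (hk : 1 ≤ k) (hx : ∀ i ∈ Finset.Ico 1 k, x i ⬝ᵥ x i ≤ c) :
    ∑ i ∈ Finset.Ico 1 k, min 1 (wnorm (gram lam x i)⁻¹ (x i)) ^ 2 ≤
      2 * d * Real.log (1 + k * c / (d * lam)) := by
  have h := sum_log_one_add_wnorm_le hd hlam hc hk hx
  calc _ ≤ ∑ i ∈ Finset.Ico 1 k, 2 * Real.log (1 + wnorm (gram lam x i)⁻¹ (x i) ^ 2) := by
        refine Finset.sum_le_sum fun i _ => ?_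
        refine le_trans (le_min ?_ ?_) (min_one_le_two_mul_log (sq_nonneg _))
        · exact pow_le_one₀ (le_min zero_le_one (wnorm_nonneg _ _)) (min_le_left _ _)
        · exact pow_le_pow_left₀ (le_min zero_le_one (wnorm_nonneg _ _)) (min_le_right _ _) 2
    _ ≤ _ := by rw [← Finset.mul_sum]; linarith

lemma mul_dotProduct_le_gram (lam : ℝ) (x : ℕ → Fin d → ℝ) (k : ℕ) (u : Fin d → ℝ) :
    lam * (u ⬝ᵥ u) ≤ u ⬝ᵥ (gram lam x k *ᵥ u) := by
  unfold gram
  rw [Matrix.add_mulVec, dotProduct_add, Matrix.smul_mulVec, Matrix.one_mulVec, dotProduct_smul,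
    smul_eq_mul]
  linarith [quadForm_nonneg (Matrix.posSemidef_sum (Finset.Ico 1 k)
    fun i _ => posSemidef_vecMulVec_self (x i)) u]

lemma norm_toLp_sq (u : Fin d → ℝ) : ‖WithLp.toLp 2 u‖ ^ 2 = u ⬝ᵥ u := by
  rw [EuclideanSpace.real_norm_sq_eq]
  simp [dotProduct, pow_two]

lemma abs_dotProduct_le_norm (u v : Fin d → ℝ) :
    |u ⬝ᵥ v| ≤ ‖WithLp.toLp 2 u‖ * ‖WithLp.toLp 2 v‖ := by
  have h := abs_dotProduct_mulVec_le (Z := 1) Matrix.PosSemidef.one u v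
  have e : ∀ w : Fin d → ℝ, wnorm 1 w = ‖WithLp.toLp 2 w‖ := fun w => by
    unfold wnorm
    rw [Matrix.one_mulVec, ← norm_toLp_sq, Real.sqrt_sq (norm_nonneg _)]
  rwa [Matrix.one_mulVec, e, e] at h

lemma wnorm_inv_gram_sq_le {lam : ℝ} (hlam : 0 < lam) (x : ℕ → Fin d → ℝ) (k : ℕ)
    (v : Fin d → ℝ) : wnorm (gram lam x k)⁻¹ v ^ 2 ≤ (v ⬝ᵥ v) / lam := by
  have hp := gram_posDef hlam x k
  rw [wnorm_sq hp.inv.posSemidef]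
  set u := (gram lam x k)⁻¹ *ᵥ v with hu
  have h1 := mul_dotProduct_le_gram lam x k u
  rw [hu, mulVec_inv_mulVec hp, ← hu, dotProduct_comm u v] at h1
  have h2 := abs_dotProduct_le_norm v u
  have h3 : (v ⬝ᵥ u) ^ 2 ≤ (v ⬝ᵥ v) * (u ⬝ᵥ u) := by
    rw [← norm_toLp_sq, ← norm_toLp_sq, ← mul_pow, ← sq_abs]
    exact pow_le_pow_left₀ (abs_nonneg _) h2 2
  have h0 : 0 ≤ v ⬝ᵥ u := quadForm_nonneg hp.inv.posSemidef v
  have hv : 0 ≤ v ⬝ᵥ v := by rw [← norm_toLp_sq]; positivity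
  rw [le_div_iff₀ hlam]
  rcases h0.eq_or_lt with h | h
  · rw [← h]; simpa using hv
  · refine le_of_mul_le_mul_right ?_ h
    have hv' := mul_le_mul_of_nonneg_left h1 hv
    have h3' := mul_le_mul_of_nonneg_left h3 hlam.le
    linarith

/-- The ridge estimator deviates from the true parameter by the self-normalized noise plus the
bias of the regularization. -/
lemma wnorm_ridge_sub_le {lam : ℝ} (hlam : 0 < lam) (x : ℕ → Fin d → ℝ) (η : ℕ → ℝ) (k : ℕ)
    (ϑ : Fin d → ℝ) {B : ℝ} (hB : ‖WithLp.toLp 2 ϑ‖ ≤ B) :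
    wnorm (gram lam x k) ((gram lam x k)⁻¹ *ᵥ
        (∑ i ∈ Finset.Ico 1 k, (x i ⬝ᵥ ϑ + η i) • x i) - ϑ) ≤
      wnorm (gram lam x k)⁻¹ (∑ i ∈ Finset.Ico 1 k, η i • x i) + Real.sqrt lam * B := by
  have hp := gram_posDef hlam x k
  have e1 : ∑ i ∈ Finset.Ico 1 k, (x i ⬝ᵥ ϑ + η i) • x i =
      gram lam x k *ᵥ ϑ + (∑ i ∈ Finset.Ico 1 k, η i • x i - lam • ϑ) := by
    unfold gram
    simp only [add_smul, Finset.sum_add_distrib, Matrix.add_mulVec, Matrix.smul_mulVec,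
      Matrix.one_mulVec, Matrix.sum_mulVec, rankOne_mulVec]
    abel
  rw [e1, Matrix.mulVec_add, inv_mulVec_mulVec hp, add_sub_cancel_left, wnorm_inv_mulVec hp]
  refine (wnorm_sub_le hp.inv.posSemidef _ _).trans ?_
  gcongr
  rw [wnorm_smul, abs_of_pos hlam]
  have h := wnorm_inv_gram_sq_le hlam x k ϑ
  have h2 : wnorm (gram lam x k)⁻¹ ϑ ≤ B / Real.sqrt lam := by
    refine le_of_sq_le_sq ?_ (div_nonneg ((norm_nonneg _).trans hB) (Real.sqrt_nonneg _))
    rw [div_pow, Real.sq_sqrt hlam.le]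
    refine h.trans ?_
    rw [← norm_toLp_sq]
    gcongr
  calc lam * wnorm (gram lam x k)⁻¹ ϑ ≤ lam * (B / Real.sqrt lam) := by gcongr
    _ = Real.sqrt lam * B := by
      rw [← mul_div_assoc, div_eq_iff (Real.sqrt_pos.2 hlam).ne', mul_right_comm,
        Real.mul_self_sqrt hlam.le]

end Gram

/-! ### Concentration for sequences with finite conditional laws -/

/-- Evaluating a family of measurable functions at a measurable finite-valued index. -/
lemma measurable_eval_finite {Ω T : Type*} [Fintype T] {m : MeasurableSpace Ω}
    {E : Type*} [MeasurableSpace E] {z : Ω → T}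
    (hz : ∀ t, MeasurableSet[m] {ω | z ω = t}) {f : Ω → T → E}
    (hf : ∀ t, Measurable[m] fun ω => f ω t) : Measurable[m] fun ω => f ω (z ω) := by
  classical
  intro s hs
  have : (fun ω => f ω (z ω)) ⁻¹' s = ⋃ t, {ω | z ω = t} ∩ (fun ω => f ω t) ⁻¹' s := by
    ext ω; simp
  rw [this]
  exact MeasurableSet.iUnion fun t => (hz t).inter (hf t hs)

section Concentration

variable {Ω T : Type*} [mΩ : MeasurableSpace Ω] [Fintype T] {μ : Measure Ω} {K : ℕ}
  {ℱ : ℕ → MeasurableSpace Ω} {y : ℕ → Ω → T}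
  {q : ℕ → Ω → T → ℝ}

/-- The variables `y_1, …, y_K` take values in a finite set and `y_k` has the conditional law `q_k`
given `ℱ_k`, where `ℱ_1 ≤ … ≤ ℱ_K` and `y_k` is `ℱ_{k+1}`-measurable. The law `q_k ω` is a
probability vector for all `ω`, not only almost all. -/
structure CondLaw (μ : Measure Ω) (K : ℕ) (ℱ : ℕ → MeasurableSpace Ω) (y : ℕ → Ω → T)
    (q : ℕ → Ω → T → ℝ) : Prop where
  le : ∀ k ∈ Set.Icc 1 K, ℱ k ≤ mΩ
  mono : ∀ k ∈ Set.Ico 1 K, ℱ k ≤ ℱ (k + 1)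
  meas_y : ∀ k ∈ Set.Icc 1 K, ∀ t, MeasurableSet {ω | y k ω = t}
  adapted : ∀ k ∈ Set.Ico 1 K, ∀ t, MeasurableSet[ℱ (k + 1)] {ω | y k ω = t}
  meas_q : ∀ k ∈ Set.Icc 1 K, ∀ t, Measurable[ℱ k] fun ω => q k ω t
  simplex : ∀ k ∈ Set.Icc 1 K, ∀ ω, q k ω ∈ stdSimplex ℝ T
  law : ∀ k ∈ Set.Icc 1 K, ∀ t,
    μ[Set.indicator {ω | y k ω = t} (fun _ => (1 : ℝ)) | ℱ k] =ᵐ[μ] fun ω => q k ω t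

lemma CondLaw.mono_le (h : CondLaw μ K ℱ y q) {i k : ℕ} (hi : 1 ≤ i) (hik : i ≤ k) (hk : k ≤ K) :
    ℱ i ≤ ℱ k := by
  induction k, hik using Nat.le_induction with
  | base => exact le_rfl
  | succ k hik ih => exact (ih (by omega)).trans (h.mono k ⟨by omega, by omega⟩)

/-- Past noise `∑_{i < k} f_i(y_i)` is measurable with respect to `ℱ_k`. -/
lemma CondLaw.measurable_past (h : CondLaw μ K ℱ y q) {i k : ℕ} (hi : 1 ≤ i) (hik : i < k)
    (hk : k ≤ K) {E : Type*} [MeasurableSpace E] {f : Ω → T → E}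
    (hf : ∀ t, Measurable[ℱ i] fun ω => f ω t) : Measurable[ℱ k] fun ω => f ω (y i ω) :=
  measurable_eval_finite
    (fun t => h.mono_le (by omega) hik hk _ (h.adapted i ⟨hi, by omega⟩ t))
    (fun t => (hf t).mono (h.mono_le hi hik.le hk) le_rfl)

lemma CondLaw.restrict (h : CondLaw μ K ℱ y q) {n : ℕ} (hn : n ≤ K) : CondLaw μ n ℱ y q :=
  ⟨fun k hk => h.le k ⟨hk.1, hk.2.trans hn⟩, fun k hk => h.mono k ⟨hk.1, hk.2.trans_le hn⟩,
    fun k hk => h.meas_y k ⟨hk.1, hk.2.trans hn⟩,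
    fun k hk => h.adapted k ⟨hk.1, hk.2.trans_le hn⟩,
    fun k hk => h.meas_q k ⟨hk.1, hk.2.trans hn⟩, fun k hk => h.simplex k ⟨hk.1, hk.2.trans hn⟩,
    fun k hk => h.law k ⟨hk.1, hk.2.trans hn⟩⟩

variable [IsProbabilityMeasure μ]

lemma CondLaw.integral_mul_indicator (h : CondLaw μ K ℱ y q) {k : ℕ} (hk : k ∈ Set.Icc 1 K)
    {g : Ω → ℝ} (hg : Measurable[ℱ k] g) {C : ℝ} (hC : ∀ ω, |g ω| ≤ C) (t : T) :
    ∫ ω, g ω * Set.indicator {ω | y k ω = t} (fun _ => (1 : ℝ)) ω ∂μ = ∫ ω, g ω * q k ω t ∂μ := by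
  have hm := h.le k hk
  have hi : Integrable (Set.indicator {ω | y k ω = t} (fun _ => (1 : ℝ))) μ :=
    (integrable_const _).indicator (h.meas_y k hk t)
  have hgi : Integrable (g * Set.indicator {ω | y k ω = t} (fun _ => (1 : ℝ))) μ := by
    refine Integrable.bdd_mul (c := C) hi (hg.mono hm le_rfl).aestronglyMeasurable ?_
    exact Filter.Eventually.of_forall fun ω => by simpa using hC ω
  have h1 := condExp_mul_of_stronglyMeasurable_left (hg.stronglyMeasurable) hgi hi
  calc _ = ∫ ω, (μ[g * Set.indicator {ω | y k ω = t} (fun _ => (1 : ℝ)) | ℱ k]) ω ∂μ :=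
        (integral_condExp hm).symm
    _ = _ := by
      refine integral_congr_ae ?_
      filter_upwards [h1, h.law k hk t] with ω h1 h2
      rw [h1, Pi.mul_apply, h2]

/-- The supermartingale method: if the conditional exponential moment of each term is at most one,
then so is the exponential moment of the sum. -/
lemma CondLaw.integral_exp_sum_le_one (h : CondLaw μ K ℱ y q) {f : ℕ → Ω → T → ℝ} {C : ℝ}
    (hf : ∀ k ∈ Set.Icc 1 K, ∀ t, Measurable[ℱ k] fun ω => f k ω t)
    (hC : ∀ k ∈ Set.Icc 1 K, ∀ ω t, |f k ω t| ≤ C)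
    (hexp : ∀ k ∈ Set.Icc 1 K, ∀ ω, ∑ t, q k ω t * Real.exp (f k ω t) ≤ 1) {n : ℕ} (hn : n ≤ K) :
    Integrable (fun ω => Real.exp (∑ k ∈ Finset.Icc 1 n, f k ω (y k ω))) μ ∧
      ∫ ω, Real.exp (∑ k ∈ Finset.Icc 1 n, f k ω (y k ω)) ∂μ ≤ 1 := by
  have hmeas : ∀ n ≤ K, Measurable fun ω => Real.exp (∑ k ∈ Finset.Icc 1 n, f k ω (y k ω)) := by
    intro n hn
    refine Real.measurable_exp.comp (Finset.measurable_sum _ fun k hk => ?_)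
    have hk' : k ∈ Set.Icc 1 K := by rw [Finset.mem_Icc] at hk; exact ⟨hk.1, hk.2.trans hn⟩
    exact measurable_eval_finite (h.meas_y k hk') fun t => (hf k hk' t).mono (h.le k hk') le_rfl
  have hbd : ∀ n ≤ K, ∀ ω, ∑ k ∈ Finset.Icc 1 n, f k ω (y k ω) ≤ n * C := by
    intro n hn ω
    calc _ ≤ ∑ k ∈ Finset.Icc 1 n, C := Finset.sum_le_sum fun k hk => by
          rw [Finset.mem_Icc] at hk
          exact (le_abs_self _).trans (hC k ⟨hk.1, hk.2.trans hn⟩ ω _)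
      _ = n * C := by simp
  have hint : ∀ n ≤ K, Integrable (fun ω => Real.exp (∑ k ∈ Finset.Icc 1 n, f k ω (y k ω))) μ := by
    intro n hn
    refine Integrable.of_bound (hmeas n hn).aestronglyMeasurable (Real.exp (n * C)) ?_
    refine Filter.Eventually.of_forall fun ω => ?_
    rw [Real.norm_of_nonneg (Real.exp_nonneg _)]
    exact Real.exp_le_exp.2 (hbd n hn ω)
  refine ⟨hint n hn, ?_⟩
  induction n with
  | zero => simp
  | succ n ih =>
    have hk : n + 1 ∈ Set.Icc 1 K := ⟨by omega, hn⟩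
    set G : Ω → ℝ := fun ω => Real.exp (∑ k ∈ Finset.Icc 1 n, f k ω (y k ω)) with hG
    have hGm : Measurable[ℱ (n + 1)] G := by
      refine Real.measurable_exp.comp (Finset.measurable_sum _ fun k hk => ?_)
      rw [Finset.mem_Icc] at hk
      exact h.measurable_past hk.1 (by omega) hn (hf k ⟨hk.1, by omega⟩)
    have hgm : ∀ t, Measurable[ℱ (n + 1)] fun ω => G ω * Real.exp (f (n + 1) ω t) := fun t =>
      hGm.mul (Real.measurable_exp.comp (hf _ hk t))
    have hgb : ∀ t ω, |G ω * Real.exp (f (n + 1) ω t)| ≤ Real.exp (n * C) * Real.exp C := by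
      intro t ω
      rw [abs_of_nonneg (by positivity)]
      gcongr
      · exact Real.exp_le_exp.2 (hbd n (by omega) ω)
      · exact (le_abs_self _).trans (hC _ hk ω t)
    have hq1 : ∀ t ω, |q (n + 1) ω t| ≤ 1 := fun t ω => by
      rw [abs_of_nonneg ((h.simplex _ hk ω).1 t)]
      exact (Finset.single_le_sum (fun i _ => (h.simplex _ hk ω).1 i) (Finset.mem_univ t)).trans_eq
        (h.simplex _ hk ω).2
    have hqi : ∀ t, Integrable (fun ω => G ω * Real.exp (f (n + 1) ω t) * q (n + 1) ω t) μ := by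
      intro t
      refine Integrable.of_bound (((hgm t).mul (h.meas_q _ hk t)).mono
        (h.le _ hk) le_rfl).aestronglyMeasurable (Real.exp (n * C) * Real.exp C * 1) ?_
      refine Filter.Eventually.of_forall fun ω => ?_
      rw [Real.norm_eq_abs, abs_mul]
      gcongr
      · exact hgb t ω
      · exact hq1 t ω
    have hdec : ∀ ω, Real.exp (∑ k ∈ Finset.Icc 1 (n + 1), f k ω (y k ω)) =
        ∑ t, G ω * Real.exp (f (n + 1) ω t) *
          Set.indicator {ω | y (n + 1) ω = t} (fun _ => (1 : ℝ)) ω := by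
      intro ω
      classical
      rw [Finset.sum_Icc_succ_top (by omega), Real.exp_add]
      simp [Set.indicator_apply, hG]
    calc _ = ∑ t, ∫ ω, G ω * Real.exp (f (n + 1) ω t) *
          Set.indicator {ω | y (n + 1) ω = t} (fun _ => (1 : ℝ)) ω ∂μ := by
          rw [← integral_finsetSum]
          · exact integral_congr_ae (Filter.Eventually.of_forall hdec)
          · intro t _
            refine Integrable.bdd_mul (c := Real.exp (n * C) * Real.exp C)
              ((integrable_const _).indicator (h.meas_y _ hk t))
              ((hgm t).mono (h.le _ hk) le_rfl).aestronglyMeasurable ?_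
            exact Filter.Eventually.of_forall fun ω => by simpa using hgb t ω
      _ = ∑ t, ∫ ω, G ω * Real.exp (f (n + 1) ω t) * q (n + 1) ω t ∂μ :=
          Finset.sum_congr rfl fun t _ => h.integral_mul_indicator hk (hgm t) (hgb t) t
      _ = ∫ ω, ∑ t, G ω * Real.exp (f (n + 1) ω t) * q (n + 1) ω t ∂μ :=
          (integral_finsetSum _ fun t _ => hqi t).symm
      _ ≤ ∫ ω, G ω ∂μ := by
          refine integral_mono (integrable_finsetSum _ fun t _ => hqi t) (hint n (by omega)) ?_
          intro ω
          have := hexp _ hk ω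
          calc _ = G ω * ∑ t, q (n + 1) ω t * Real.exp (f (n + 1) ω t) := by
                rw [Finset.mul_sum]
                exact Finset.sum_congr rfl fun t _ => by ring
            _ ≤ G ω * 1 := by gcongr
            _ = G ω := mul_one _
      _ ≤ 1 := ih (by omega)

lemma CondLaw.measure_sum_gt_le (h : CondLaw μ K ℱ y q) {f : ℕ → Ω → T → ℝ} {C : ℝ}
    (hf : ∀ k ∈ Set.Icc 1 K, ∀ t, Measurable[ℱ k] fun ω => f k ω t)
    (hC : ∀ k ∈ Set.Icc 1 K, ∀ ω t, |f k ω t| ≤ C)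
    (hexp : ∀ k ∈ Set.Icc 1 K, ∀ ω, ∑ t, q k ω t * Real.exp (f k ω t) ≤ 1) {n : ℕ} (hn : n ≤ K)
    (a : ℝ) :
    μ.real {ω | a < ∑ k ∈ Finset.Icc 1 n, f k ω (y k ω)} ≤ Real.exp (-a) := by
  obtain ⟨h1, h2⟩ := h.integral_exp_sum_le_one hf hC hexp hn
  have h3 := mul_meas_ge_le_integral_of_nonneg
    (Filter.Eventually.of_forall fun ω => Real.exp_nonneg _) h1 (Real.exp a)
  rw [Real.exp_neg, ← one_div, le_div_iff₀ (Real.exp_pos a), mul_comm]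
  refine le_trans ?_ (h3.trans h2)
  exact mul_le_mul_of_nonneg_left (measureReal_mono
    (fun ω hω => Real.exp_le_exp.2 (le_of_lt hω)) (measure_ne_top _ _)) (Real.exp_nonneg a)

lemma exp_le_one_add_add_sq {x : ℝ} (hx : |x| ≤ 1) : Real.exp x ≤ 1 + x + x ^ 2 := by
  have := (abs_le.1 (Real.abs_exp_sub_one_sub_id_le hx)).2
  linarith

/-- Freedman's inequality with a deterministic bound `V` on the sum of the conditional variances. -/
lemma CondLaw.freedman (h : CondLaw μ K ℱ y q) {X : ℕ → Ω → T → ℝ} {M V ln : ℝ}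
    (hM : 0 < M) (hV : 0 < V) (hln : 0 ≤ ln)
    (hX : ∀ k ∈ Set.Icc 1 K, ∀ t, Measurable[ℱ k] fun ω => X k ω t)
    {n : ℕ} (hn : n ≤ K)
    (hb : ∀ k ∈ Set.Icc 1 n, ∀ ω t, |X k ω t| ≤ M)
    (hc : ∀ k ∈ Set.Icc 1 n, ∀ ω, ∑ t, q k ω t * X k ω t = 0)
    (hv : ∀ ω, ∑ k ∈ Finset.Icc 1 n, ∑ t, q k ω t * X k ω t ^ 2 ≤ V) :
    μ.real {ω | 2 * Real.sqrt (V * ln) + M * ln < ∑ k ∈ Finset.Icc 1 n, X k ω (y k ω)} ≤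
      Real.exp (-ln) := by
  have h' := h.restrict hn
  have hX' : ∀ k ∈ Set.Icc 1 n, ∀ t, Measurable[ℱ k] fun ω => X k ω t :=
    fun k hk => hX k ⟨hk.1, hk.2.trans hn⟩
  rcases hln.eq_or_lt with h0 | hln
  · rw [← h0]; simp
  -- the optimal exponent, truncated so that it stays in the range of the quadratic bound on `exp`
  set c : ℝ := min (1 / M) (Real.sqrt (ln / V)) with hcdef
  have hc0 : 0 < c := lt_min (by positivity) (Real.sqrt_pos.2 (by positivity))
  have hc1 : c * M ≤ 1 := by
    have : c ≤ 1 / M := min_le_left _ _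
    rwa [le_div_iff₀ hM] at this
  set v : ℕ → Ω → ℝ := fun k ω => ∑ t, q k ω t * X k ω t ^ 2 with hvdef
  have hv0 : ∀ k ∈ Set.Icc 1 n, ∀ ω, 0 ≤ v k ω := fun k hk ω =>
    Finset.sum_nonneg fun t _ => mul_nonneg ((h'.simplex k hk ω).1 t) (sq_nonneg _)
  have hvV : ∀ k ∈ Set.Icc 1 n, ∀ ω, v k ω ≤ V := fun k hk ω =>
    (Finset.single_le_sum (f := fun k => v k ω)
      (fun i hi => hv0 i (Finset.mem_Icc.1 hi) ω) (Finset.mem_Icc.2 hk)).trans (hv ω)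
  have hcX : ∀ k ∈ Set.Icc 1 n, ∀ ω t, |c * X k ω t| ≤ 1 := fun k hk ω t => by
    rw [abs_mul, abs_of_pos hc0]
    exact (mul_le_mul_of_nonneg_left (hb k hk ω t) hc0.le).trans hc1
  have key := h'.measure_sum_gt_le (f := fun k ω t => c * X k ω t - c ^ 2 * v k ω)
    (C := 1 + c ^ 2 * V) ?_ ?_ ?_ le_rfl ln
  · refine le_trans ?_ key
    refine measureReal_mono ?_ (measure_ne_top _ _)
    intro ω hω
    simp only [Set.mem_ofPred_eq] at hω ⊢
    rw [Finset.sum_sub_distrib, ← Finset.mul_sum, ← Finset.mul_sum]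
    have h1 : c ^ 2 * ∑ k ∈ Finset.Icc 1 n, v k ω ≤ c ^ 2 * V := by gcongr; exact hv ω
    have hs : Real.sqrt (V * ln) = V * Real.sqrt (ln / V) := by
      rw [← Real.sqrt_sq hV.le, ← Real.sqrt_mul (sq_nonneg _), Real.sqrt_sq hV.le]
      congr 1; field_simp
    have h2 : ln + c ^ 2 * V ≤ c * (2 * Real.sqrt (V * ln) + M * ln) := by
      have e1 : c * V ≤ Real.sqrt (V * ln) := by
        rw [hs, mul_comm]; exact mul_le_mul_of_nonneg_left (min_le_right _ _) hV.le
      have e2 : ln ≤ c * (Real.sqrt (V * ln) + M * ln) := by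
        rcases min_choice (1 / M) (Real.sqrt (ln / V)) with h3 | h3
        · rw [← hcdef] at h3
          have : c * (M * ln) = ln := by rw [h3]; field_simp
          have := mul_nonneg hc0.le (Real.sqrt_nonneg (V * ln))
          linarith
        · rw [← hcdef] at h3
          have : c * Real.sqrt (V * ln) = ln := by
            rw [h3, hs, mul_left_comm, Real.mul_self_sqrt (by positivity)]; field_simp
          have := mul_nonneg hc0.le (mul_nonneg hM.le hln.le)
          linarith
      nlinarith
    have h3 := mul_lt_mul_of_pos_left hω hc0
    linarith
  · intro k hk t
    refine ((hX' k hk t).const_mul c).sub (Measurable.const_mul ?_ _)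
    exact Finset.measurable_sum _ fun t _ => (h'.meas_q k hk t).mul ((hX' k hk t).pow_const 2)
  · intro k hk ω t
    refine (abs_sub _ _).trans ?_
    rw [abs_of_nonneg (mul_nonneg (sq_nonneg c) (hv0 k hk ω))]
    gcongr
    · exact hcX k hk ω t
    · exact hvV k hk ω
  · intro k hk ω
    have : ∑ t, q k ω t * Real.exp (c * X k ω t) ≤ 1 + c ^ 2 * v k ω := by
      calc _ ≤ ∑ t, q k ω t * (1 + c * X k ω t + (c * X k ω t) ^ 2) :=
            Finset.sum_le_sum fun t _ => mul_le_mul_of_nonneg_left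
              (exp_le_one_add_add_sq (hcX k hk ω t)) ((h'.simplex k hk ω).1 t)
        _ = ∑ t, q k ω t + c * ∑ t, q k ω t * X k ω t + c ^ 2 * v k ω := by
            rw [hvdef, Finset.mul_sum, Finset.mul_sum, ← Finset.sum_add_distrib,
              ← Finset.sum_add_distrib]
            exact Finset.sum_congr rfl fun t _ => by ring
        _ = _ := by rw [(h'.simplex k hk ω).2, hc k hk ω]; ring
    simp only [Real.exp_sub, ← mul_div_assoc]
    rw [← Finset.sum_div, div_le_one (Real.exp_pos _)]
    linarith [Real.add_one_le_exp (c ^ 2 * v k ω)]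

/-- Sums of nonnegative bounded variables are controlled by the sums of their conditional means. -/
lemma CondLaw.sum_nonneg_le (h : CondLaw μ K ℱ y q) {X : ℕ → Ω → T → ℝ} {M V ln : ℝ}
    (hM : 0 < M)
    (hX : ∀ k ∈ Set.Icc 1 K, ∀ t, Measurable[ℱ k] fun ω => X k ω t)
    {n : ℕ} (hn : n ≤ K)
    (hb : ∀ k ∈ Set.Icc 1 n, ∀ ω t, X k ω t ∈ Set.Icc 0 M)
    (hv : ∀ ω, ∑ k ∈ Finset.Icc 1 n, ∑ t, q k ω t * X k ω t ≤ V) :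
    μ.real {ω | 2 * V + M * ln < ∑ k ∈ Finset.Icc 1 n, X k ω (y k ω)} ≤ Real.exp (-ln) := by
  have h' := h.restrict hn
  have hX' : ∀ k ∈ Set.Icc 1 n, ∀ t, Measurable[ℱ k] fun ω => X k ω t :=
    fun k hk => hX k ⟨hk.1, hk.2.trans hn⟩
  set v : ℕ → Ω → ℝ := fun k ω => ∑ t, q k ω t * X k ω t with hvdef
  have hv0 : ∀ k ∈ Set.Icc 1 n, ∀ ω, 0 ≤ v k ω := fun k hk ω =>
    Finset.sum_nonneg fun t _ => mul_nonneg ((h'.simplex k hk ω).1 t) (hb k hk ω t).1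
  have hvM : ∀ k ∈ Set.Icc 1 n, ∀ ω, v k ω ≤ M := fun k hk ω => by
    calc v k ω ≤ ∑ t, q k ω t * M := Finset.sum_le_sum fun t _ =>
          mul_le_mul_of_nonneg_left (hb k hk ω t).2 ((h'.simplex k hk ω).1 t)
      _ = M := by rw [← Finset.sum_mul, (h'.simplex k hk ω).2, one_mul]
  have key := h'.measure_sum_gt_le (f := fun k ω t => (X k ω t - 2 * v k ω) / M)
    (C := 3) ?_ ?_ ?_ le_rfl ln
  · refine le_trans ?_ key
    refine measureReal_mono ?_ (measure_ne_top _ _)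
    intro ω hω
    simp only [Set.mem_ofPred_eq] at hω ⊢
    rw [← Finset.sum_div, Finset.sum_sub_distrib, ← Finset.mul_sum, lt_div_iff₀ hM]
    have := hv ω
    linarith
  · intro k hk t
    refine ((hX' k hk t).sub (Measurable.const_mul ?_ _)).div_const _
    exact Finset.measurable_sum _ fun t _ => (h'.meas_q k hk t).mul (hX' k hk t)
  · intro k hk ω t
    rw [abs_div, abs_of_pos hM, div_le_iff₀ hM, abs_le]
    have h1 := hb k hk ω t
    have h2 := hv0 k hk ω
    have h3 := hvM k hk ω
    constructor <;> linarith [h1.1, h1.2]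
  · intro k hk ω
    have h01 : ∀ t, X k ω t / M ∈ Set.Icc (0 : ℝ) 1 := fun t =>
      ⟨div_nonneg (hb k hk ω t).1 hM.le, (div_le_one hM).2 (hb k hk ω t).2⟩
    have : ∑ t, q k ω t * Real.exp (X k ω t / M) ≤ 1 + 2 * v k ω / M := by
      calc _ ≤ ∑ t, q k ω t * (1 + 2 * (X k ω t / M)) :=
            Finset.sum_le_sum fun t _ => mul_le_mul_of_nonneg_left (by
              have h1 := h01 t
              have := exp_le_one_add_add_sq (x := X k ω t / M) (abs_le.2 ⟨by linarith [h1.1], h1.2⟩)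
              nlinarith [h1.1, h1.2]) ((h'.simplex k hk ω).1 t)
        _ = ∑ t, q k ω t + 2 * v k ω / M := by
            rw [hvdef, Finset.mul_sum, Finset.sum_div, ← Finset.sum_add_distrib]
            exact Finset.sum_congr rfl fun t _ => by ring
        _ = _ := by rw [(h'.simplex k hk ω).2]
    simp only [sub_div, Real.exp_sub, ← mul_div_assoc]
    rw [← Finset.sum_div, div_le_one (Real.exp_pos _)]
    linarith [Real.add_one_le_exp (2 * v k ω / M)]

/-- Concentration of the martingale with differences `E[g_k(y_k) | ℱ_k] - g_k(y_k)`, where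
`|g_k| ≤ c`. -/
lemma CondLaw.azuma (h : CondLaw μ K ℱ y q) {g : ℕ → Ω → T → ℝ} {c ln : ℝ} (hK : 1 ≤ K)
    (hc : 0 < c) (hln : 1 ≤ ln)
    (hg : ∀ k ∈ Set.Icc 1 K, ∀ t, Measurable[ℱ k] fun ω => g k ω t)
    (hb : ∀ k ∈ Set.Icc 1 K, ∀ ω t, |g k ω t| ≤ c) :
    μ.real {ω | 6 * c * Real.sqrt K * ln <
      ∑ k ∈ Finset.Icc 1 K, (∑ t, q k ω t * g k ω t - g k ω (y k ω))} ≤ Real.exp (-ln) := by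
  have hmean : ∀ k ∈ Set.Icc 1 K, ∀ ω, |∑ t, q k ω t * g k ω t| ≤ c := fun k hk ω => by
    calc _ ≤ ∑ t, |q k ω t * g k ω t| := Finset.abs_sum_le_sum_abs _ _
      _ ≤ ∑ t, q k ω t * c := Finset.sum_le_sum fun t _ => by
          rw [abs_mul, abs_of_nonneg ((h.simplex k hk ω).1 t)]
          exact mul_le_mul_of_nonneg_left (hb k hk ω t) ((h.simplex k hk ω).1 t)
      _ = c := by rw [← Finset.sum_mul, (h.simplex k hk ω).2, one_mul]
  have hK' : (1 : ℝ) ≤ K := by exact_mod_cast hK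
  have hX2 : ∀ k ∈ Set.Icc 1 K, ∀ ω t, |∑ t, q k ω t * g k ω t - g k ω t| ≤ 2 * c :=
    fun k hk ω t => (abs_sub _ _).trans (by linarith [hmean k hk ω, hb k hk ω t])
  have key := h.freedman (X := fun k ω t => ∑ t, q k ω t * g k ω t - g k ω t) (M := 2 * c)
    (V := K * (2 * c) ^ 2) (ln := ln) (by positivity) (by positivity) (by linarith) ?_ le_rfl
    hX2 ?_ ?_
  · refine le_trans ?_ key
    refine measureReal_mono ?_ (measure_ne_top _ _)
    intro ω hω
    simp only [Set.mem_ofPred_eq] at hω ⊢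
    refine lt_of_le_of_lt ?_ hω
    have h1 : Real.sqrt (K * (2 * c) ^ 2 * ln) = 2 * c * (Real.sqrt K * Real.sqrt ln) := by
      rw [mul_right_comm, Real.sqrt_mul (by positivity), Real.sqrt_sq (by positivity),
        Real.sqrt_mul (by positivity)]
      ring
    have h2 : Real.sqrt ln ≤ ln := (Real.sqrt_le_left (by linarith)).2 (by nlinarith)
    have h3 : 1 ≤ Real.sqrt K := Real.one_le_sqrt.2 hK'
    rw [h1]
    have h4 : Real.sqrt K * Real.sqrt ln ≤ Real.sqrt K * ln := by gcongr
    have h5 : ln ≤ Real.sqrt K * ln := by nlinarith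
    nlinarith
  · intro k hk t
    exact (Finset.measurable_sum _ fun t _ => (h.meas_q k hk t).mul (hg k hk t)).sub (hg k hk t)
  · intro k hk ω
    simp only [mul_sub, Finset.sum_sub_distrib]
    rw [← Finset.sum_mul, (h.simplex k hk ω).2]
    ring
  · intro ω
    calc _ ≤ ∑ k ∈ Finset.Icc 1 K, (2 * c) ^ 2 := Finset.sum_le_sum fun k hk => by
          have hk' := Finset.mem_Icc.1 hk
          calc _ ≤ ∑ t, q k ω t * (2 * c) ^ 2 := Finset.sum_le_sum fun t _ => by
                refine mul_le_mul_of_nonneg_left ?_ ((h.simplex k hk' ω).1 t)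
                exact sq_le_sq' (abs_le.1 (hX2 k hk' ω t)).1 (abs_le.1 (hX2 k hk' ω t)).2
            _ = _ := by rw [← Finset.sum_mul, (h.simplex k hk' ω).2, one_mul]
      _ = _ := by simp

end Concentration

/-! ### Measurability of matrix expressions -/

section MatrixMeasurability

variable {Ω : Type*} {m : MeasurableSpace Ω} {d : ℕ}

lemma measurable_matrix_comp {f : Matrix (Fin d) (Fin d) ℝ → ℝ} (hf : Continuous f)
    {A : Ω → Matrix (Fin d) (Fin d) ℝ} (hA : ∀ i j, Measurable[m] fun ω => A ω i j) :
    Measurable[m] fun ω => f (A ω) := by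
  have h1 : Measurable (fun a : Fin d → Fin d → ℝ => f (Matrix.of a) : (Fin d → Fin d → ℝ) → ℝ) :=
    (show Continuous fun a : Fin d → Fin d → ℝ => f (Matrix.of a) from hf).measurable
  exact h1.comp (measurable_pi_lambda _ fun i => measurable_pi_lambda _ fun j => hA i j)

lemma measurable_matrix_inv {A : Ω → Matrix (Fin d) (Fin d) ℝ}
    (hA : ∀ i j, Measurable[m] fun ω => A ω i j) (i j : Fin d) :
    Measurable[m] fun ω => (A ω)⁻¹ i j := by
  simp only [Matrix.inv_def, Matrix.smul_apply, Ring.inverse_eq_inv', smul_eq_mul]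
  refine Measurable.mul (Measurable.inv ?_) ?_
  · exact measurable_matrix_comp (f := Matrix.det) (by fun_prop) hA
  · exact measurable_matrix_comp (f := fun B => B.adjugate i j) (by fun_prop) hA

lemma measurable_mulVec {A : Ω → Matrix (Fin d) (Fin d) ℝ} {x : Ω → Fin d → ℝ}
    (hA : ∀ i j, Measurable[m] fun ω => A ω i j) (hx : ∀ j, Measurable[m] fun ω => x ω j)
    (i : Fin d) : Measurable[m] fun ω => (A ω *ᵥ x ω) i := by
  simp only [Matrix.mulVec, dotProduct]
  exact Finset.measurable_sum _ fun j _ => (hA i j).mul (hx j)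

lemma measurable_dotProduct {x y : Ω → Fin d → ℝ} (hx : ∀ j, Measurable[m] fun ω => x ω j)
    (hy : ∀ j, Measurable[m] fun ω => y ω j) : Measurable[m] fun ω => x ω ⬝ᵥ y ω := by
  simp only [dotProduct]
  exact Finset.measurable_sum _ fun j _ => (hx j).mul (hy j)

lemma measurable_wnorm {A : Ω → Matrix (Fin d) (Fin d) ℝ} {x : Ω → Fin d → ℝ}
    (hA : ∀ i j, Measurable[m] fun ω => A ω i j) (hx : ∀ j, Measurable[m] fun ω => x ω j) :
    Measurable[m] fun ω => wnorm (A ω) (x ω) :=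
  (measurable_dotProduct hx (measurable_mulVec hA hx)).sqrt

end MatrixMeasurability

/-! ### The self-normalized Bernstein inequality -/

section SelfNormalized

/-- The radius of the self-normalized Bernstein inequality before the `k`-th observation, for noise
with conditional variance at most `σ²` and absolute value at most `R`, and for vectors of squared
length at most `c`. -/
noncomputable def bernsteinRadius (d : ℕ) (lam c σ R δ : ℝ) (k : ℕ) : ℝ :=
  8 * σ * Real.sqrt (d * Real.log (1 + k * c / (d * lam)) * Real.log (4 * k ^ 2 / δ))
    + 4 * R * Real.log (4 * k ^ 2 / δ)

lemma sum_inv_sq_le (K : ℕ) : ∑ k ∈ Finset.Icc 1 K, 1 / (k : ℝ) ^ 2 ≤ 2 := by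
  rcases Nat.eq_zero_or_pos K with rfl | hK
  · simp
  have : ∑ k ∈ Finset.Icc 1 K, 1 / (k : ℝ) ^ 2 ≤ 2 - 1 / (K : ℝ) := by
    induction K, hK using Nat.le_induction with
    | base => norm_num
    | succ n hn ih =>
      rw [Finset.sum_Icc_succ_top (by omega)]
      have hn' : (0 : ℝ) < n := by exact_mod_cast hn
      have : 1 / ((n + 1 : ℕ) : ℝ) ^ 2 ≤ 1 / (n : ℝ) - 1 / ((n + 1 : ℕ) : ℝ) := by
        push_cast
        rw [div_sub_div _ _ hn'.ne' (by positivity),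
          div_le_div_iff₀ (by positivity) (by positivity)]
        nlinarith
      linarith
  have h2 : (0 : ℝ) ≤ 1 / (K : ℝ) := by positivity
  linarith

variable {Ω T : Type*} [mΩ : MeasurableSpace Ω] [Fintype T] {μ : Measure Ω}
  [IsProbabilityMeasure μ] {K : ℕ} {ℱ : ℕ → MeasurableSpace Ω} {y : ℕ → Ω → T}
  {q : ℕ → Ω → T → ℝ} {d : ℕ}

lemma bernsteinRadius_mono {lam c σ R δ : ℝ} (hlam : 0 < lam) (hc : 0 ≤ c) (hσ : 0 ≤ σ)
    (hR : 0 ≤ R) (hδ : 0 < δ) (hδ1 : δ ≤ 1) {i k : ℕ} (hi : 1 ≤ i) (hik : i ≤ k) :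
    bernsteinRadius d lam c σ R δ i ≤ bernsteinRadius d lam c σ R δ k := by
  have hi' : (1 : ℝ) ≤ i := by exact_mod_cast hi
  have h0 : 0 ≤ Real.log (4 * i ^ 2 / δ) := Real.log_nonneg (by
    rw [le_div_iff₀ hδ]; nlinarith)
  have h1 : 0 ≤ Real.log (1 + i * c / (d * lam)) := Real.log_nonneg (by
    have : 0 ≤ i * c / (d * lam) := by positivity
    linarith)
  have h2 : Real.log (4 * i ^ 2 / δ) ≤ Real.log (4 * k ^ 2 / δ) :=
    Real.log_le_log (by positivity) (by gcongr)
  have h3 : Real.log (1 + i * c / (d * lam)) ≤ Real.log (1 + k * c / (d * lam)) :=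
    Real.log_le_log (by positivity) (by gcongr)
  unfold bernsteinRadius
  have h4 := h1.trans h3
  gcongr

/-- The self-normalized noise `‖∑ η_i x_i‖` in the inverse Gram norm stays below the Bernstein
radius as long as the conditional variances stay below `σ²`. Its square is at most a martingale plus
a sum of squares (by a rank-one update of the inverse Gram matrix); Freedman's inequality applies to
the martingale stopped when the claimed bound first fails. -/
theorem CondLaw.selfNormalized (h : CondLaw μ K ℱ y q) (hd : 0 < d) {lam c σ R δ : ℝ}
    (hlam : 0 < lam) (hc : 0 < c) (hσ : 0 < σ) (hR : 0 < R) (hδ : 0 < δ) (hδ1 : δ ≤ 1)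
    {x : ℕ → Ω → Fin d → ℝ} {η : ℕ → Ω → T → ℝ}
    (hx : ∀ k ∈ Set.Icc 1 K, ∀ j, Measurable[ℱ k] fun ω => x k ω j)
    (hxc : ∀ k ∈ Set.Icc 1 K, ∀ ω, x k ω ⬝ᵥ x k ω ≤ c)
    (hη : ∀ k ∈ Set.Icc 1 K, ∀ t, Measurable[ℱ k] fun ω => η k ω t)
    (hηR : ∀ k ∈ Set.Icc 1 K, ∀ ω t, |η k ω t| ≤ R)
    (hη0 : ∀ k ∈ Set.Icc 1 K, ∀ ω, ∑ t, q k ω t * η k ω t = 0) :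
    μ.real {ω | ∃ k ∈ Set.Icc 1 K, (∀ i ∈ Finset.Ico 1 k, ∑ t, q i ω t * η i ω t ^ 2 ≤ σ ^ 2) ∧
      bernsteinRadius d lam c σ R δ k < wnorm (gram lam (fun i => x i ω) k)⁻¹
        (∑ i ∈ Finset.Ico 1 k, η i ω (y i ω) • x i ω)} ≤ δ := by
  classical
  set β := bernsteinRadius d lam c σ R δ with hβ
  set Z : ℕ → Ω → Matrix (Fin d) (Fin d) ℝ := fun k ω => gram lam (fun i => x i ω) k with hZ
  set D : ℕ → Ω → Fin d → ℝ := fun k ω => ∑ i ∈ Finset.Ico 1 k, η i ω (y i ω) • x i ω with hD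
  set w : ℕ → Ω → ℝ := fun k ω => wnorm (Z k ω)⁻¹ (x k ω) with hw
  set v : ℕ → Ω → ℝ := fun k ω => ∑ t, q k ω t * η k ω t ^ 2 with hv
  set ln : ℕ → ℝ := fun k => Real.log (4 * k ^ 2 / δ) with hln
  set ι : ℕ → ℝ := fun k => Real.log (1 + k * c / (d * lam)) with hι
  have hd' : (0 : ℝ) < d := by exact_mod_cast hd
  -- logarithms
  have hln1 : ∀ k, 1 ≤ k → 1 ≤ ln k := by
    intro k hk
    have hk' : (1 : ℝ) ≤ k := by exact_mod_cast hk
    rw [hln, Real.le_log_iff_exp_le (by positivity)]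
    refine (Real.exp_one_lt_d9.le.trans (by norm_num : _ ≤ (4 : ℝ))).trans ?_
    rw [le_div_iff₀ hδ]; nlinarith
  have hι0 : ∀ k, 1 ≤ k → 0 < ι k := by
    intro k hk
    have hk' : (0 : ℝ) < k := by exact_mod_cast hk
    refine Real.log_pos ?_
    have : 0 < k * c / (d * lam) := by positivity
    linarith
  have hexpln : ∀ k, 1 ≤ k → Real.exp (-ln k) = δ / (4 * k ^ 2) := by
    intro k hk
    have hk' : (0 : ℝ) < k := by exact_mod_cast hk
    rw [Real.exp_neg, hln, Real.exp_log (by positivity), inv_div]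
  have hβpos : ∀ k, 1 ≤ k → 0 < β k := by
    intro k hk
    have := hln1 k hk
    have h1 : 0 < 4 * R * ln k := by positivity
    have h2 : 0 ≤ 8 * σ * Real.sqrt (d * ι k * ln k) := by positivity
    exact add_pos_of_nonneg_of_pos h2 h1
  have hβmono : ∀ i k, 1 ≤ i → i ≤ k → β i ≤ β k := fun i k hi hik =>
    bernsteinRadius_mono hlam hc.le hσ.le hR.le hδ hδ1 hi hik
  have hZp : ∀ k ω, (Z k ω).PosDef := fun k ω => gram_posDef hlam _ k
  -- measurability of the predictable quantities
  have hZm : ∀ k ∈ Set.Icc 1 K, ∀ i j, Measurable[ℱ k] fun ω => Z k ω i j := by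
    intro k hk i j
    simp only [hZ, gram, Matrix.add_apply, Matrix.sum_apply, Matrix.vecMulVec_apply]
    refine measurable_const.add (Finset.measurable_sum _ fun l hl => ?_)
    rw [Finset.mem_Ico] at hl
    have hle := h.mono_le hl.1 hl.2.le hk.2
    have hlK : l ∈ Set.Icc 1 K := ⟨hl.1, hl.2.le.trans hk.2⟩
    exact ((hx l hlK i).mono hle le_rfl).mul ((hx l hlK j).mono hle le_rfl)
  have hDm : ∀ k ∈ Set.Icc 1 K, ∀ j, Measurable[ℱ k] fun ω => D k ω j := by
    intro k hk j
    simp only [hD, Finset.sum_apply, Pi.smul_apply, smul_eq_mul]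
    refine Finset.measurable_sum _ fun l hl => ?_
    rw [Finset.mem_Ico] at hl
    have hlK : l ∈ Set.Icc 1 K := ⟨hl.1, hl.2.le.trans hk.2⟩
    exact h.measurable_past hl.1 hl.2 hk.2 (f := fun ω t => η l ω t * x l ω j)
      fun t => (hη l hlK t).mul (hx l hlK j)
  have hZim := fun k hk => measurable_matrix_inv (hZm k hk)
  have hwm : ∀ k ∈ Set.Icc 1 K, Measurable[ℱ k] (w k) := fun k hk =>
    measurable_wnorm (hZim k hk) (hx k hk)
  have hvm : ∀ k ∈ Set.Icc 1 K, Measurable[ℱ k] (v k) := fun k hk =>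
    Finset.measurable_sum _ fun t _ => (h.meas_q k hk t).mul ((hη k hk t).pow_const 2)
  -- the truncated summands
  set E : ℕ → Ω → Prop := fun i ω => wnorm (Z i ω)⁻¹ (D i ω) ≤ β i ∧ v i ω ≤ σ ^ 2 with hE
  set e : ℕ → Ω → ℝ := fun i ω => x i ω ⬝ᵥ ((Z i ω)⁻¹ *ᵥ D i ω) with he
  set X : ℕ → Ω → T → ℝ := fun i ω t =>
    if E i ω then 2 * η i ω t * e i ω / (1 + w i ω ^ 2) else 0 with hX
  set U : ℕ → Ω → T → ℝ := fun i ω t =>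
    if v i ω ≤ σ ^ 2 then η i ω t ^ 2 * (w i ω ^ 2 / (1 + w i ω ^ 2)) else 0 with hU
  have hVm : ∀ i ∈ Set.Icc 1 K, MeasurableSet[ℱ i] {ω | v i ω ≤ σ ^ 2} := fun i hi =>
    measurableSet_le (hvm i hi) measurable_const
  have hEm : ∀ i ∈ Set.Icc 1 K, MeasurableSet[ℱ i] {ω | E i ω} := fun i hi =>
    (measurableSet_le (measurable_wnorm (hZim i hi) (hDm i hi))
      measurable_const).inter (hVm i hi)
  have hXm : ∀ i ∈ Set.Icc 1 K, ∀ t, Measurable[ℱ i] fun ω => X i ω t := fun i hi t =>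
    Measurable.ite (hEm i hi) ((((hη i hi t).const_mul 2).mul (measurable_dotProduct (hx i hi)
      (measurable_mulVec (hZim i hi) (hDm i hi)))).div
      (((hwm i hi).pow_const 2).const_add 1)) measurable_const
  have hUm : ∀ i ∈ Set.Icc 1 K, ∀ t, Measurable[ℱ i] fun ω => U i ω t := fun i hi t =>
    Measurable.ite (hVm i hi) (((hη i hi t).pow_const 2).mul (((hwm i hi).pow_const 2).div
      (((hwm i hi).pow_const 2).const_add 1))) measurable_const
  have hw0 : ∀ i ω, 0 ≤ w i ω := fun i ω => wnorm_nonneg _ _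
  have heb : ∀ i ω, |e i ω| ≤ w i ω * wnorm (Z i ω)⁻¹ (D i ω) := fun i ω =>
    abs_dotProduct_mulVec_le (hZp i ω).inv.posSemidef _ _
  have hpot : ∀ k ∈ Set.Icc 1 K, ∀ ω,
      ∑ i ∈ Finset.Icc 1 (k - 1), w i ω ^ 2 / (1 + w i ω ^ 2) ≤ d * ι k := by
    intro k hk ω
    have hIcc : Finset.Icc 1 (k - 1) = Finset.Ico 1 k := by
      ext i; simp only [Finset.mem_Icc, Finset.mem_Ico]; have := hk.1; omega
    rw [hIcc]
    exact sum_div_one_add_wnorm_le hd hlam hc.le hk.1 fun i hi => by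
      rw [Finset.mem_Ico] at hi; exact hxc i ⟨hi.1, hi.2.le.trans hk.2⟩ ω
  -- the two concentration bounds before observation `k`
  have hA : ∀ k ∈ Finset.Icc 1 K, μ.real {ω | 2 * Real.sqrt (4 * σ ^ 2 * β k ^ 2 * (d * ι k) * ln k)
      + R * β k * ln k < ∑ i ∈ Finset.Icc 1 (k - 1), X i ω (y i ω)} ≤ δ / (4 * k ^ 2) := by
    intro k hk
    rw [Finset.mem_Icc] at hk
    have hβk := hβpos k hk.1
    have hιk := hι0 k hk.1
    have hmem : ∀ i ∈ Set.Icc 1 (k - 1), i ∈ Set.Icc 1 K ∧ i ≤ k := fun i hi =>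
      ⟨⟨hi.1, by have := hi.2; omega⟩, by have := hi.2; omega⟩
    rw [← hexpln k hk.1]
    refine h.freedman (by positivity) (by positivity) (by linarith [hln1 k hk.1]) hXm (by omega)
      ?_ ?_ ?_
    · intro i hi ω t
      obtain ⟨hiK, hik⟩ := hmem i hi
      simp only [hX]
      split_ifs with hEi
      · have h1 := heb i ω
        have h2 : |e i ω| ≤ w i ω * β k := h1.trans (mul_le_mul_of_nonneg_left
          (hEi.1.trans (hβmono i k hi.1 hik)) (hw0 i ω))
        rw [abs_div, abs_mul, abs_mul, abs_two, abs_of_pos (by positivity : 0 < 1 + w i ω ^ 2),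
          div_le_iff₀ (by positivity)]
        calc 2 * |η i ω t| * |e i ω| ≤ 2 * R * (w i ω * β k) := by
              gcongr; exact hηR i hiK ω t
          _ = R * β k * (2 * w i ω) := by ring
          _ ≤ R * β k * (1 + w i ω ^ 2) := by
              gcongr; nlinarith [sq_nonneg (w i ω - 1)]
      · rw [abs_zero]; positivity
    · intro i hi ω
      obtain ⟨hiK, hik⟩ := hmem i hi
      simp only [hX]
      split_ifs with hEi
      · have := hη0 i hiK ω
        calc _ = (∑ t, q i ω t * η i ω t) * (2 * e i ω / (1 + w i ω ^ 2)) := by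
              rw [Finset.sum_mul]; exact Finset.sum_congr rfl fun t _ => by ring
          _ = 0 := by rw [this, zero_mul]
      · simp
    · intro ω
      calc _ ≤ ∑ i ∈ Finset.Icc 1 (k - 1),
            4 * σ ^ 2 * β k ^ 2 * (w i ω ^ 2 / (1 + w i ω ^ 2)) := by
            refine Finset.sum_le_sum fun i hi => ?_
            obtain ⟨hiK, hik⟩ := hmem i (Finset.mem_Icc.1 hi)
            simp only [hX]
            split_ifs with hEi
            · have h2 : |e i ω| ≤ w i ω * β k := (heb i ω).trans (mul_le_mul_of_nonneg_left
                (hEi.1.trans (hβmono i k hiK.1 hik)) (hw0 i ω))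
              have h3 : e i ω ^ 2 ≤ w i ω ^ 2 * β k ^ 2 := by
                rw [← mul_pow]; exact sq_le_sq' (abs_le.1 h2).1 (abs_le.1 h2).2
              calc _ = v i ω * (4 * e i ω ^ 2 / (1 + w i ω ^ 2) ^ 2) := by
                    rw [hv, Finset.sum_mul]
                    exact Finset.sum_congr rfl fun t _ => by rw [div_pow]; ring
                _ ≤ σ ^ 2 * (4 * (w i ω ^ 2 * β k ^ 2) / (1 + w i ω ^ 2)) := by
                    gcongr
                    · exact hEi.2
                    · exact le_self_pow₀ (by nlinarith [sq_nonneg (w i ω)]) two_ne_zero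
                _ = _ := by ring
            · simp only [ne_eq, OfNat.ofNat_ne_zero, not_false_eq_true, zero_pow, mul_zero,
                Finset.sum_const_zero]
              positivity
        _ = 4 * σ ^ 2 * β k ^ 2 * ∑ i ∈ Finset.Icc 1 (k - 1), w i ω ^ 2 / (1 + w i ω ^ 2) := by
            rw [Finset.mul_sum]
        _ ≤ _ := by
            gcongr
            exact hpot k hk ω
  have hB : ∀ k ∈ Finset.Icc 1 K, μ.real {ω | 2 * (σ ^ 2 * (d * ι k)) + R ^ 2 * ln k <
      ∑ i ∈ Finset.Icc 1 (k - 1), U i ω (y i ω)} ≤ δ / (4 * k ^ 2) := by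
    intro k hk
    rw [Finset.mem_Icc] at hk
    have hmem : ∀ i ∈ Set.Icc 1 (k - 1), i ∈ Set.Icc 1 K := fun i hi =>
      ⟨hi.1, by have := hi.2; omega⟩
    rw [← hexpln k hk.1]
    refine h.sum_nonneg_le (by positivity) hUm (by omega) ?_ ?_
    · intro i hi ω t
      have h1 : w i ω ^ 2 / (1 + w i ω ^ 2) ≤ 1 := (div_le_one (by positivity)).2 (by linarith)
      have h2 : η i ω t ^ 2 ≤ R ^ 2 := sq_le_sq' (abs_le.1 (hηR i (hmem i hi) ω t)).1
        (abs_le.1 (hηR i (hmem i hi) ω t)).2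
      simp only [hU]
      split_ifs with hEi
      · refine ⟨by positivity, ?_⟩
        calc _ ≤ R ^ 2 * 1 := by gcongr
          _ = R ^ 2 := mul_one _
      · exact ⟨le_rfl, by positivity⟩
    · intro ω
      calc _ ≤ ∑ i ∈ Finset.Icc 1 (k - 1), σ ^ 2 * (w i ω ^ 2 / (1 + w i ω ^ 2)) := by
            refine Finset.sum_le_sum fun i hi => ?_
            simp only [hU]
            split_ifs with hEi
            · calc _ = v i ω * (w i ω ^ 2 / (1 + w i ω ^ 2)) := by
                    rw [hv, Finset.sum_mul]; exact Finset.sum_congr rfl fun t _ => by ring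
                _ ≤ _ := by gcongr
            · simp only [mul_zero, Finset.sum_const_zero]
              positivity
        _ = σ ^ 2 * ∑ i ∈ Finset.Icc 1 (k - 1), w i ω ^ 2 / (1 + w i ω ^ 2) := by
            rw [Finset.mul_sum]
        _ ≤ _ := by
            gcongr
            exact hpot k hk ω
  -- the deterministic induction
  have hdet : ∀ ω, (∀ k ∈ Finset.Icc 1 K,
      (∑ i ∈ Finset.Icc 1 (k - 1), X i ω (y i ω) ≤
        2 * Real.sqrt (4 * σ ^ 2 * β k ^ 2 * (d * ι k) * ln k) + R * β k * ln k) ∧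
      (∑ i ∈ Finset.Icc 1 (k - 1), U i ω (y i ω) ≤ 2 * (σ ^ 2 * (d * ι k)) + R ^ 2 * ln k)) →
      ∀ k ∈ Set.Icc 1 K, (∀ i ∈ Finset.Ico 1 k, v i ω ≤ σ ^ 2) →
        wnorm (Z k ω)⁻¹ (D k ω) ≤ β k := by
    intro ω hω k
    induction k using Nat.strong_induction_on with
    | _ k ih =>
    intro hk hvk
    have hprev : ∀ i ∈ Finset.Icc 1 (k - 1), E i ω := by
      intro i hi
      rw [Finset.mem_Icc] at hi
      have hik : i < k := by omega
      refine ⟨ih i hik ⟨hi.1, hik.le.trans hk.2⟩ fun j hj => hvk j ?_,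
        hvk i (Finset.mem_Ico.2 ⟨hi.1, hik⟩)⟩
      rw [Finset.mem_Ico] at hj ⊢
      omega
    have hrec : ∀ n, n + 1 ≤ k → wnorm (Z (n + 1) ω)⁻¹ (D (n + 1) ω) ^ 2 ≤
        ∑ i ∈ Finset.Icc 1 n, X i ω (y i ω) + ∑ i ∈ Finset.Icc 1 n, U i ω (y i ω) := by
      intro n
      induction n with
      | zero => intro _; simp [hD, wnorm]
      | succ n ihn =>
        intro hn
        have hEn : E (n + 1) ω := hprev (n + 1) (Finset.mem_Icc.2 ⟨by omega, by omega⟩)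
        have hZs : Z (n + 1 + 1) ω = Z (n + 1) ω + Matrix.vecMulVec (x (n + 1) ω) (x (n + 1) ω) :=
          gram_succ _ _ (by omega)
        have hDs : D (n + 1 + 1) ω = D (n + 1) ω +
            η (n + 1) ω (y (n + 1) ω) • x (n + 1) ω := by
          simp only [hD]
          rw [Finset.sum_Ico_succ_top (by omega : 1 ≤ n + 1)]
        rw [hZs, hDs, Finset.sum_Icc_succ_top (by omega), Finset.sum_Icc_succ_top (by omega)]
        refine (wnorm_inv_rankOne_update_sq_le (hZp (n + 1) ω) _ _ _).trans ?_
        have h1 := ihn (by omega)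
        have h2 : X (n + 1) ω (y (n + 1) ω) =
            2 * η (n + 1) ω (y (n + 1) ω) * e (n + 1) ω / (1 + w (n + 1) ω ^ 2) := if_pos hEn
        have h3 : U (n + 1) ω (y (n + 1) ω) = η (n + 1) ω (y (n + 1) ω) ^ 2 *
            (w (n + 1) ω ^ 2 / (1 + w (n + 1) ω ^ 2)) := if_pos hEn.2
        rw [h2, h3]
        linarith
    have h1 := hrec (k - 1) (by have := hk.1; omega)
    rw [Nat.sub_add_cancel hk.1] at h1
    obtain ⟨h2, h3⟩ := hω k (Finset.mem_Icc.2 hk)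
    have hβk := hβpos k hk.1
    have hlk := hln1 k hk.1
    have hιk := hι0 k hk.1
    set r := Real.sqrt (d * ι k * ln k) with hr
    have hr2 : r ^ 2 = d * ι k * ln k := Real.sq_sqrt (by positivity)
    have hr0 : 0 ≤ r := Real.sqrt_nonneg _
    have hβe : β k = 8 * σ * r + 4 * R * ln k := rfl
    have hs : Real.sqrt (4 * σ ^ 2 * β k ^ 2 * (d * ι k) * ln k) = 2 * σ * β k * r := by
      rw [show 4 * σ ^ 2 * β k ^ 2 * (d * ι k) * ln k =
          (2 * σ * β k) ^ 2 * (d * ι k * ln k) by ring,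
        Real.sqrt_mul (sq_nonneg _), Real.sqrt_sq (by positivity)]
    rw [hs] at h2
    have h4 : 2 * (2 * σ * β k * r) + R * β k * ln k ≤ β k ^ 2 / 2 := by
      have : 0 ≤ R * β k * ln k := by positivity
      have e1 : β k ^ 2 / 2 = β k * (8 * σ * r + 4 * R * ln k) / 2 := by rw [← hβe]; ring
      rw [e1]; nlinarith
    have h5 : 2 * (σ ^ 2 * (d * ι k)) + R ^ 2 * ln k ≤ β k ^ 2 / 2 := by
      have e1 : β k ^ 2 = 64 * (σ ^ 2 * (d * ι k)) * ln k + 64 * (σ * r * R * ln k)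
          + 16 * R ^ 2 * ln k * ln k := by
        rw [hβe]; linear_combination 64 * σ ^ 2 * hr2
      have e2 : σ ^ 2 * (d * ι k) ≤ σ ^ 2 * (d * ι k) * ln k :=
        le_mul_of_one_le_right (by positivity) hlk
      have e3 : R ^ 2 * ln k ≤ R ^ 2 * ln k * ln k :=
        le_mul_of_one_le_right (by positivity) hlk
      have e4 : 0 ≤ σ * r * R * ln k := by positivity
      have e5 : 0 ≤ σ ^ 2 * (d * ι k) * ln k := by positivity
      have e6 : 0 ≤ R ^ 2 * ln k * ln k := by positivity
      linarith
    exact le_of_sq_le_sq (by linarith) hβk.le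
  -- union bound
  have hsub : {ω | ∃ k ∈ Set.Icc 1 K, (∀ i ∈ Finset.Ico 1 k, v i ω ≤ σ ^ 2) ∧
      β k < wnorm (Z k ω)⁻¹ (D k ω)} ⊆ ⋃ k ∈ Finset.Icc 1 K,
      ({ω | 2 * Real.sqrt (4 * σ ^ 2 * β k ^ 2 * (d * ι k) * ln k)
      + R * β k * ln k < ∑ i ∈ Finset.Icc 1 (k - 1), X i ω (y i ω)} ∪
      {ω | 2 * (σ ^ 2 * (d * ι k)) + R ^ 2 * ln k <
      ∑ i ∈ Finset.Icc 1 (k - 1), U i ω (y i ω)}) := by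
    rintro ω ⟨k, hk, hvk, hlt⟩
    by_contra hcon
    refine absurd (hdet ω ?_ k hk hvk) (not_le.2 hlt)
    intro j hj
    simp only [Set.mem_iUnion, not_exists, Set.mem_union, not_or, Set.mem_ofPred_eq, not_lt] at hcon
    exact hcon j hj
  refine (measureReal_mono hsub (measure_ne_top _ _)).trans ?_
  refine (measureReal_biUnion_finset_le _ _).trans ?_
  calc _ ≤ ∑ k ∈ Finset.Icc 1 K, δ / 2 * (1 / (k : ℝ) ^ 2) := by
        refine Finset.sum_le_sum fun k hk => (measureReal_union_le _ _).trans ?_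
        refine (add_le_add (hA k hk) (hB k hk)).trans_eq ?_
        have hk' : (0 : ℝ) < k := by exact_mod_cast (Finset.mem_Icc.1 hk).1
        field_simp; norm_num
    _ ≤ δ / 2 * 2 := by rw [← Finset.mul_sum]; gcongr; exact sum_inv_sq_le K
    _ = δ := by ring

end SelfNormalized

/-! ### Bellman equations -/

/-- Backward induction over the steps `H + 1, H, …, 1`. -/
lemma backward_induction {H : ℕ} {p : ℕ → Prop} (h0 : p (H + 1))
    (step : ∀ h ∈ Set.Icc 1 H, p (h + 1) → p h) : ∀ h ∈ Set.Icc 1 (H + 1), p h := by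
  rintro h ⟨h1, h2⟩
  revert h1
  induction h2 using Nat.decreasingInduction with
  | self => exact fun _ => h0
  | of_succ k hk ih => exact fun h1 => step k ⟨h1, by omega⟩ (ih (by omega))

lemma sum_simplex_le {T : Type*} [Fintype T] {p : T → ℝ} (hp : p ∈ stdSimplex ℝ T) {f : T → ℝ}
    {c : ℝ} (hf : ∀ t, f t ≤ c) : ∑ t, p t * f t ≤ c := by
  calc _ ≤ ∑ t, p t * c := Finset.sum_le_sum fun t _ => mul_le_mul_of_nonneg_left (hf t) (hp.1 t)
    _ = c := by rw [← Finset.sum_mul, hp.2, one_mul]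

lemma le_sum_simplex {T : Type*} [Fintype T] {p : T → ℝ} (hp : p ∈ stdSimplex ℝ T) {f : T → ℝ}
    {c : ℝ} (hf : ∀ t, c ≤ f t) : c ≤ ∑ t, p t * f t := by
  calc c = ∑ t, p t * c := by rw [← Finset.sum_mul, hp.2, one_mul]
    _ ≤ _ := Finset.sum_le_sum fun t _ => mul_le_mul_of_nonneg_left (hf t) (hp.1 t)

lemma sum_simplex_mem_Icc {T : Type*} [Fintype T] {p : T → ℝ} (hp : p ∈ stdSimplex ℝ T)
    {f : T → ℝ} {c c' : ℝ} (hf : ∀ t, f t ∈ Set.Icc c c') : ∑ t, p t * f t ∈ Set.Icc c c' :=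
  ⟨le_sum_simplex hp fun t => (hf t).1, sum_simplex_le hp fun t => (hf t).2⟩

lemma sq_sum_simplex_le {T : Type*} [Fintype T] {p : T → ℝ} (hp : p ∈ stdSimplex ℝ T)
    (f : T → ℝ) : (∑ t, p t * f t) ^ 2 ≤ ∑ t, p t * f t ^ 2 := by
  have h : 0 ≤ ∑ t, p t * (f t - ∑ u, p u * f u) ^ 2 :=
    Finset.sum_nonneg fun t _ => mul_nonneg (hp.1 t) (sq_nonneg _)
  have e : ∑ t, p t * (f t - ∑ u, p u * f u) ^ 2 =
      ∑ t, p t * f t ^ 2 - 2 * (∑ u, p u * f u) * ∑ t, p t * f t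
        + (∑ t, p t) * (∑ u, p u * f u) ^ 2 := by
    rw [Finset.mul_sum, Finset.sum_mul, ← Finset.sum_sub_distrib, ← Finset.sum_add_distrib]
    exact Finset.sum_congr rfl fun t _ => by ring
  rw [e, hp.2] at h
  nlinarith

section Bellman

/-- `π` is a policy as far as the steps `1, …, H` are concerned. -/
def IsPolicyUpTo {S A : Type*} [Fintype A] (H : ℕ) (π : ℕ → S → A → ℝ) : Prop :=
  ∀ h ∈ Set.Icc 1 H, ∀ s, π h s ∈ stdSimplex ℝ A

lemma IsPolicy.upTo {S A : Type*} [Fintype A] {π : ℕ → S → A → ℝ} (hπ : IsPolicy π) (H : ℕ) :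
    IsPolicyUpTo H π :=
  fun h _ s => hπ h s

variable {S A : Type*} [Fintype S] {d : ℕ}

/-- `(P_h V)(s,a)` -/
noncomputable def LinearMixtureCMDP.next (M : LinearMixtureCMDP S A d) (h : ℕ) (V : S → ℝ) (s : S)
    (a : A) : ℝ :=
  ∑ s', M.P h s a s' * V s'

variable {M : LinearMixtureCMDP S A d}

lemma LinearMixtureCMDP.P_mem {h : ℕ} (hh : h ∈ Set.Icc 1 M.H) (s : S) (a : A) :
    M.P h s a ∈ stdSimplex ℝ S := ⟨M.P_nonneg h hh s a, M.P_sum h hh s a⟩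

lemma LinearMixtureCMDP.next_eq_dotProduct {h : ℕ} (hh : h ∈ Set.Icc 1 M.H) (V : S → ℝ) (s : S)
    (a : A) : M.next h V s a = phiV M.φ V s a ⬝ᵥ M.θstar h := by
  unfold LinearMixtureCMDP.next phiV
  rw [sum_dotProduct]
  refine Finset.sum_congr rfl fun s' _ => ?_
  rw [smul_dotProduct, M.P_linear h hh, smul_eq_mul, mul_comm]

lemma LinearMixtureCMDP.next_mono {h : ℕ} (hh : h ∈ Set.Icc 1 M.H) {V V' : S → ℝ}
    (hV : ∀ s, V s ≤ V' s) (s : S) (a : A) : M.next h V s a ≤ M.next h V' s a :=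
  Finset.sum_le_sum fun s' _ => mul_le_mul_of_nonneg_left (hV s') (M.P_nonneg h hh s a s')

lemma LinearMixtureCMDP.next_add_mul (h : ℕ) (V V' : S → ℝ) (c : ℝ) (s : S) (a : A) :
    M.next h (fun x => V x + c * V' x) s a = M.next h V s a + c * M.next h V' s a := by
  unfold LinearMixtureCMDP.next
  rw [Finset.mul_sum, ← Finset.sum_add_distrib]
  exact Finset.sum_congr rfl fun _ _ => by ring

lemma LinearMixtureCMDP.next_sub (h : ℕ) (V V' : S → ℝ) (s : S) (a : A) :
    M.next h (fun x => V x - V' x) s a = M.next h V s a - M.next h V' s a := by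
  unfold LinearMixtureCMDP.next
  rw [← Finset.sum_sub_distrib]
  exact Finset.sum_congr rfl fun _ _ => by ring

variable [Fintype A]

lemma trajExp_const_add {π : ℕ → S → A → ℝ} (hπ : IsPolicyUpTo M.H π) (c : ℝ) (n : ℕ) :
    ∀ (h : ℕ) (s : S) (F : List (S × A) → ℝ), 1 ≤ h → h + n ≤ M.H + 1 →
      trajExp M.P π n h s (fun τ => c + F τ) = c + trajExp M.P π n h s F := by
  induction n with
  | zero => intros; rfl
  | succ n ih =>
    intro h s F h1 h2
    have hh : h ∈ Set.Icc 1 M.H := ⟨h1, by omega⟩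
    simp only [trajExp]
    calc _ = ∑ a, π h s a * (c + ∑ s', M.P h s a s' *
          trajExp M.P π n (h + 1) s' fun τ => F ((s, a) :: τ)) := by
          refine Finset.sum_congr rfl fun a _ => ?_
          congr 1
          calc _ = ∑ s', (M.P h s a s' * c + M.P h s a s' *
                trajExp M.P π n (h + 1) s' fun τ => F ((s, a) :: τ)) :=
                Finset.sum_congr rfl fun s' _ => by
                  rw [ih (h + 1) s' _ (by omega) (by omega), mul_add]
            _ = _ := by rw [Finset.sum_add_distrib, ← Finset.sum_mul, M.P_sum h hh, one_mul]
      _ = _ := by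
          simp only [mul_add, Finset.sum_add_distrib]
          rw [← Finset.sum_mul, (hπ h hh s).2, one_mul]

lemma value_last (ℓ : ℕ → S → A → ℝ) (π : ℕ → S → A → ℝ) (s : S) :
    value M ℓ π (M.H + 1) s = 0 := by
  simp [value, trajExp, payoff]

lemma value_bellman {π : ℕ → S → A → ℝ} (hπ : IsPolicyUpTo M.H π) (ℓ : ℕ → S → A → ℝ) {h : ℕ}
    (hh : h ∈ Set.Icc 1 M.H) (s : S) :
    value M ℓ π h s = ∑ a, π h s a * (ℓ h s a + M.next h (value M ℓ π (h + 1)) s a) := by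
  unfold value LinearMixtureCMDP.next
  have e : M.H + 1 - h = (M.H + 1 - (h + 1)) + 1 := by have := hh.2; omega
  rw [e, trajExp]
  refine Finset.sum_congr rfl fun a _ => ?_
  congr 1
  simp only [payoff]
  calc _ = ∑ s', (M.P h s a s' * ℓ h s a + M.P h s a s' *
        trajExp M.P π (M.H + 1 - (h + 1)) (h + 1) s' (payoff ℓ (h + 1))) :=
        Finset.sum_congr rfl fun s' _ => by
          rw [trajExp_const_add hπ _ _ _ _ _ (by omega) (by have := hh.2; omega), mul_add]
    _ = _ := by rw [Finset.sum_add_distrib, ← Finset.sum_mul, M.P_sum h hh, one_mul]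

lemma value_mono {π : ℕ → S → A → ℝ} (hπ : IsPolicyUpTo M.H π) {ℓ ℓ' : ℕ → S → A → ℝ}
    (hℓ : ∀ h ∈ Set.Icc 1 M.H, ∀ s a, ℓ h s a ≤ ℓ' h s a) :
    ∀ h ∈ Set.Icc 1 (M.H + 1), ∀ s, value M ℓ π h s ≤ value M ℓ' π h s := by
  refine backward_induction (fun s => by rw [value_last, value_last]) fun h hh ih s => ?_
  rw [value_bellman hπ ℓ hh, value_bellman hπ ℓ' hh]
  exact Finset.sum_le_sum fun a _ => mul_le_mul_of_nonneg_left
    (add_le_add (hℓ h hh s a) (M.next_mono hh ih s a)) ((hπ h hh s).1 a)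

lemma value_add_mul {π : ℕ → S → A → ℝ} (hπ : IsPolicyUpTo M.H π) (ℓ ℓ' : ℕ → S → A → ℝ) (c : ℝ) :
    ∀ h ∈ Set.Icc 1 (M.H + 1), ∀ s, value M (fun h s a => ℓ h s a + c * ℓ' h s a) π h s =
      value M ℓ π h s + c * value M ℓ' π h s := by
  refine backward_induction (fun s => by simp only [value_last]; ring) fun h hh ih s => ?_
  rw [value_bellman hπ _ hh, value_bellman hπ ℓ hh, value_bellman hπ ℓ' hh, funext ih,
    Finset.mul_sum,
    ← Finset.sum_add_distrib]
  refine Finset.sum_congr rfl fun a _ => ?_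
  rw [M.next_add_mul]; ring

lemma value_const {π : ℕ → S → A → ℝ} (hπ : IsPolicyUpTo M.H π) (c : ℝ) :
    ∀ h ∈ Set.Icc 1 (M.H + 1), ∀ s, value M (fun _ _ _ => c) π h s = c * ((M.H : ℝ) + 1 - h) := by
  refine backward_induction (fun s => by rw [value_last]; push_cast; ring) fun h hh ih s => ?_
  rw [value_bellman hπ _ hh, funext ih]
  unfold LinearMixtureCMDP.next
  calc _ = ∑ a, π h s a * (c * ((M.H : ℝ) + 1 - h)) := by
        refine Finset.sum_congr rfl fun a _ => ?_
        rw [← Finset.sum_mul, M.P_sum h hh]; push_cast; ring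
    _ = _ := by rw [← Finset.sum_mul, (hπ h hh s).2, one_mul]

lemma value_mem {π : ℕ → S → A → ℝ} (hπ : IsPolicyUpTo M.H π) {ℓ : ℕ → S → A → ℝ}
    (hℓ : ∀ h ∈ Set.Icc 1 M.H, ∀ s a, ℓ h s a ∈ Set.Icc (0 : ℝ) 1) :
    ∀ h ∈ Set.Icc 1 (M.H + 1), ∀ s, value M ℓ π h s ∈ Set.Icc (0 : ℝ) ((M.H : ℝ) + 1 - h) := by
  intro h hh s
  have h0 := value_const (M := M) hπ 0 h hh s
  have h1 := value_const (M := M) hπ 1 h hh s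
  rw [zero_mul] at h0
  rw [one_mul] at h1
  rw [← h0, ← h1]
  exact ⟨value_mono hπ (fun h hh s a => (hℓ h hh s a).1) h hh s,
    value_mono hπ (fun h hh s a => (hℓ h hh s a).2) h hh s⟩

/-- The performance difference lemma for an optimistic estimate `Q` with `V = ⟨π', Q⟩`. -/
lemma value_sub_le {π π' : ℕ → S → A → ℝ} (hπ : IsPolicyUpTo M.H π) {ℓ : ℕ → S → A → ℝ}
    {Q : ℕ → S → A → ℝ} {V : ℕ → S → ℝ} (hlast : ∀ s, V (M.H + 1) s = 0)
    (hV : ∀ h ∈ Set.Icc 1 M.H, ∀ s, V h s = ∑ a, π' h s a * Q h s a)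
    (hQ : ∀ h ∈ Set.Icc 1 M.H, ∀ s a, ℓ h s a + M.next h (V (h + 1)) s a ≤ Q h s a) :
    ∀ h ∈ Set.Icc 1 (M.H + 1), ∀ s, value M ℓ π h s - V h s ≤
      value M (fun h s _ => ∑ a, π h s a * Q h s a - ∑ a, π' h s a * Q h s a) π h s := by
  refine backward_induction (fun s => by rw [value_last, value_last, hlast, sub_zero])
    fun h hh ih s => ?_
  rw [value_bellman hπ ℓ hh, value_bellman hπ _ hh, hV h hh]
  have h1 : ∑ a, π h s a * (ℓ h s a + M.next h (value M ℓ π (h + 1)) s a) ≤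
      ∑ a, π h s a * (Q h s a + M.next h (value M
        (fun h s _ => ∑ a, π h s a * Q h s a - ∑ a, π' h s a * Q h s a) π (h + 1)) s a) := by
    refine Finset.sum_le_sum fun a _ => mul_le_mul_of_nonneg_left ?_ ((hπ h hh s).1 a)
    have h2 := M.next_mono hh ih s a
    rw [M.next_sub] at h2
    linarith [hQ h hh s a]
  simp only [mul_add, Finset.sum_add_distrib] at h1 ⊢
  rw [← Finset.sum_mul, (hπ h hh s).2, one_mul]
  linarith

end Bellman

/-! ### The value estimates -/

section Estimates

variable {S A : Type*} [Fintype S] [Fintype A] {d : ℕ} {M : KnownModel S A d} {p : Params} {k : ℕ}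
  {R : Ridge d} {ℓ π : ℕ → S → A → ℝ}

lemma clip_mem {lo hi : ℝ} (h : lo ≤ hi) (x : ℝ) : clip lo hi x ∈ Set.Icc lo hi :=
  ⟨le_max_right _ _, max_le (min_le_right _ _) h⟩

lemma abs_clip_sub_le {lo hi x y : ℝ} (hy : y ∈ Set.Icc lo hi) : |clip lo hi x - y| ≤ |x - y| := by
  unfold clip
  rcases le_total x hi with h | h
  · rw [min_eq_left h]
    rcases le_total x lo with h' | h'
    · rw [max_eq_right h', abs_of_nonpos (by linarith [hy.1]), abs_of_nonpos (by linarith [hy.1])]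
      linarith
    · rw [max_eq_left h']
  · rw [min_eq_right h, max_eq_left (hy.1.trans hy.2), abs_of_nonneg (by linarith [hy.2]),
      abs_of_nonneg (by linarith [hy.2])]
    linarith

lemma vEst_last (s : S) : vEst M p k R ℓ π (M.H + 1) s = 0 := by
  simp [vEst, vRem]

lemma vEst_eq {h : ℕ} (hh : h ∈ Set.Icc 1 M.H) (s : S) :
    vEst M p k R ℓ π h s = ∑ a, π h s a * qEst M p k R ℓ π h s a := by
  have e1 : M.H + 1 - h = (M.H - h) + 1 := by have := hh.2; omega
  have e2 : M.H - (M.H - h) = h := by have := hh.2; omega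
  have e3 : M.H + 1 - (h + 1) = M.H - h := by omega
  simp only [vEst, qEst, e1, e3, vRem, e2]

lemma qEst_mem {h : ℕ} (hh : h ∈ Set.Icc 1 M.H) (s : S) (a : A) :
    qEst M p k R ℓ π h s a ∈ Set.Icc (0 : ℝ) ((M.H : ℝ) - h + 1) := by
  have : (h : ℝ) ≤ M.H := by exact_mod_cast hh.2
  exact clip_mem (by linarith) _

lemma qEst_le_H {h : ℕ} (hh : h ∈ Set.Icc 1 M.H) (s : S) (a : A) :
    qEst M p k R ℓ π h s a ∈ Set.Icc (0 : ℝ) (M.H : ℝ) := by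
  have h1 : (1 : ℝ) ≤ h := by exact_mod_cast hh.1
  have h2 := qEst_mem (p := p) (k := k) (R := R) (ℓ := ℓ) (π := π) hh s a
  exact ⟨h2.1, by linarith [h2.2]⟩

lemma vEst_mem (hπ : IsPolicyUpTo M.H π) {h : ℕ} (hh : h ∈ Set.Icc 1 (M.H + 1)) (s : S) :
    vEst M p k R ℓ π h s ∈ Set.Icc (0 : ℝ) ((M.H : ℝ) + 1 - h) := by
  rcases hh.2.eq_or_lt with h1 | h1
  · rw [h1, vEst_last]; simp
  · have hh' : h ∈ Set.Icc 1 M.H := ⟨hh.1, by omega⟩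
    rw [vEst_eq hh']
    have := sum_simplex_mem_Icc (hπ h hh' s) (fun a => qEst_mem (p := p) (k := k) (R := R) (ℓ := ℓ)
      (π := π) hh' s a)
    rwa [show (M.H : ℝ) + 1 - h = M.H - h + 1 by ring]

lemma vEst_le_H (hπ : IsPolicyUpTo M.H π) {h : ℕ} (hh : h ∈ Set.Icc 1 (M.H + 1)) (s : S) :
    vEst M p k R ℓ π h s ∈ Set.Icc (0 : ℝ) (M.H : ℝ) := by
  have h1 : (1 : ℝ) ≤ h := by exact_mod_cast hh.1
  have h2 := vEst_mem (p := p) (k := k) (R := R) (ℓ := ℓ) hπ hh s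
  exact ⟨h2.1, by linarith [h2.2]⟩

end Estimates

/-! ### Exponential weights -/

section ExpWeights

variable {T : Type*} [Fintype T]

/-- `-∑ p log u` -/
noncomputable def crossEntropy (p u : T → ℝ) : ℝ := ∑ t, p t * (-Real.log (u t))

lemma exp_le_quadratic_of_nonpos {x : ℝ} (hx : x ≤ 0) : Real.exp x ≤ 1 + x + x ^ 2 / 2 := by
  have h1 := Real.quadratic_le_exp_of_nonneg (neg_nonneg.2 hx)
  have h2 : Real.exp x * Real.exp (-x) = 1 := by rw [← Real.exp_add]; simp
  have h3 : 0 < 1 + x + x ^ 2 / 2 := by nlinarith [sq_nonneg (x + 1)]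
  have h4 : 1 ≤ (1 + x + x ^ 2 / 2) * (1 + -x + (-x) ^ 2 / 2) := by nlinarith [sq_nonneg (x ^ 2)]
  have h5 : Real.exp x * (1 + -x + (-x) ^ 2 / 2) ≤ 1 :=
    (mul_le_mul_of_nonneg_left h1 (Real.exp_nonneg x)).trans_eq h2
  have h6 : 0 < 1 + -x + (-x) ^ 2 / 2 := by nlinarith [sq_nonneg x]
  exact le_of_mul_le_mul_right (h5.trans h4) h6

/-- The bound on the log-moment generating function behind the regret of exponential weights.
Shifting the exponents by their upper bound `c` makes them nonpositive, so that no smallness of `c`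
is needed. -/
lemma log_sum_exp_le {p x : T → ℝ} {c : ℝ} (hp : p ∈ stdSimplex ℝ T)
    (hx : ∀ t, x t ∈ Set.Icc 0 c) :
    Real.log (∑ t, p t * Real.exp (x t)) ≤ ∑ t, p t * x t + c ^ 2 / 2 := by
  have hpos : 0 < ∑ t, p t * Real.exp (x t) :=
    lt_of_lt_of_le one_pos (le_sum_simplex hp fun t => Real.one_le_exp (hx t).1)
  rw [Real.log_le_iff_le_exp hpos]
  have h1 : ∑ t, p t * Real.exp (x t - c) ≤ Real.exp (∑ t, p t * x t - c + c ^ 2 / 2) := by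
    calc _ ≤ ∑ t, p t * (1 + (x t - c) + c ^ 2 / 2) :=
          Finset.sum_le_sum fun t _ => mul_le_mul_of_nonneg_left (by
            have h1 := exp_le_quadratic_of_nonpos (sub_nonpos.2 (hx t).2)
            nlinarith [(hx t).1, (hx t).2]) (hp.1 t)
      _ = ∑ t, p t * x t + (∑ t, p t) * (1 - c + c ^ 2 / 2) := by
          rw [Finset.sum_mul, ← Finset.sum_add_distrib]
          exact Finset.sum_congr rfl fun t _ => by ring
      _ ≤ _ := by
          rw [hp.2]
          linarith [Real.add_one_le_exp (∑ t, p t * x t - c + c ^ 2 / 2)]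
  calc ∑ t, p t * Real.exp (x t) = Real.exp c * ∑ t, p t * Real.exp (x t - c) := by
        rw [Finset.mul_sum]
        refine Finset.sum_congr rfl fun t _ => ?_
        rw [mul_left_comm, ← Real.exp_add]
        congr 2; ring
    _ ≤ Real.exp c * Real.exp (∑ t, p t * x t - c + c ^ 2 / 2) := by gcongr
    _ = _ := by rw [← Real.exp_add]; congr 1; ring

lemma sum_mul_exp_pos [Nonempty T] {u : T → ℝ} (hu : ∀ t, 0 < u t) (x : T → ℝ) :
    0 < ∑ t, u t * Real.exp (x t) :=
  Finset.sum_pos (fun t _ => mul_pos (hu t) (Real.exp_pos _)) Finset.univ_nonempty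

/-- One step of exponential weights: the advantage of the comparator `p` over `u` is paid for by the
decrease of the cross entropy. -/
lemma exp_weights_step [Nonempty T] {p u x : T → ℝ} {c : ℝ} (hp : p ∈ stdSimplex ℝ T)
    (hu : u ∈ stdSimplex ℝ T) (hu0 : ∀ t, 0 < u t) (hx : ∀ t, x t ∈ Set.Icc 0 c) :
    ∑ t, p t * x t - ∑ t, u t * x t ≤ crossEntropy p u -
      crossEntropy p (fun t => u t * Real.exp (x t) / ∑ t', u t' * Real.exp (x t')) +
        c ^ 2 / 2 := by
  have hpos := sum_mul_exp_pos hu0 x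
  have h1 := log_sum_exp_le hu hx
  have h2 : crossEntropy p (fun t => u t * Real.exp (x t) / ∑ t', u t' * Real.exp (x t')) =
      crossEntropy p u - ∑ t, p t * x t +
        (∑ t, p t) * Real.log (∑ t', u t' * Real.exp (x t')) := by
    unfold crossEntropy
    rw [Finset.sum_mul, ← Finset.sum_sub_distrib, ← Finset.sum_add_distrib]
    refine Finset.sum_congr rfl fun t _ => ?_
    rw [Real.log_div (mul_pos (hu0 t) (Real.exp_pos _)).ne' hpos.ne',
      Real.log_mul (hu0 t).ne' (Real.exp_pos _).ne', Real.log_exp]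
    ring
  rw [h2, hp.2]
  linarith

lemma simplex_le_one {u : T → ℝ} (hu : u ∈ stdSimplex ℝ T) (t : T) : u t ≤ 1 :=
  (Finset.single_le_sum (fun i _ => hu.1 i) (Finset.mem_univ t)).trans_eq hu.2

lemma crossEntropy_nonneg {p u : T → ℝ} (hp : p ∈ stdSimplex ℝ T) (hu : u ∈ stdSimplex ℝ T) :
    0 ≤ crossEntropy p u :=
  Finset.sum_nonneg fun t _ => mul_nonneg (hp.1 t)
    (neg_nonneg.2 (Real.log_nonpos (hu.1 t) (simplex_le_one hu t)))

/-- The mixture of a distribution with the uniform one. -/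
noncomputable def mixUniform (θ : ℝ) (u : T → ℝ) (t : T) : ℝ :=
  (1 - θ) * u t + θ * (1 / Fintype.card T)

lemma mixUniform_mem [Nonempty T] {θ : ℝ} (hθ : θ ∈ Set.Icc (0 : ℝ) 1) {u : T → ℝ}
    (hu : u ∈ stdSimplex ℝ T) : mixUniform θ u ∈ stdSimplex ℝ T := by
  refine ⟨fun t => add_nonneg (mul_nonneg (by linarith [hθ.2]) (hu.1 t))
    (mul_nonneg hθ.1 (by positivity)), ?_⟩
  have : (Fintype.card T : ℝ) ≠ 0 := by exact_mod_cast Fintype.card_ne_zero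
  simp only [mixUniform]
  rw [Finset.sum_add_distrib, ← Finset.mul_sum, hu.2, Finset.sum_const, Finset.card_univ,
    nsmul_eq_mul]
  field_simp
  ring

lemma le_mixUniform {θ : ℝ} (hθ : θ ∈ Set.Icc (0 : ℝ) 1) {u : T → ℝ}
    (hu : u ∈ stdSimplex ℝ T) (t : T) : θ * (1 / Fintype.card T) ≤ mixUniform θ u t :=
  le_add_of_nonneg_left (mul_nonneg (by linarith [hθ.2]) (hu.1 t))

lemma mixUniform_pos [Nonempty T] {θ : ℝ} (h0 : 0 < θ) (h1 : θ ≤ 1) {u : T → ℝ}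
    (hu : u ∈ stdSimplex ℝ T) (t : T) : 0 < mixUniform θ u t := by
  have : (0 : ℝ) < Fintype.card T := by exact_mod_cast Fintype.card_pos
  exact lt_of_lt_of_le (by positivity) (le_mixUniform ⟨h0.le, h1⟩ hu t)

lemma crossEntropy_mixUniform_le_log [Nonempty T] {θ : ℝ} (h0 : 0 < θ) (h1 : θ ≤ 1) {p u : T → ℝ}
    (hp : p ∈ stdSimplex ℝ T) (hu : u ∈ stdSimplex ℝ T) :
    crossEntropy p (mixUniform θ u) ≤ Real.log (Fintype.card T / θ) := by
  have hc : (0 : ℝ) < Fintype.card T := by exact_mod_cast Fintype.card_pos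
  refine sum_simplex_le hp fun t => ?_
  rw [← Real.log_inv]
  refine Real.log_le_log (inv_pos.2 (mixUniform_pos h0 h1 hu t)) ?_
  calc _ ≤ (θ * (1 / Fintype.card T))⁻¹ :=
        inv_anti₀ (by positivity) (le_mixUniform ⟨h0.le, h1⟩ hu t)
    _ = _ := by field_simp

lemma crossEntropy_mixUniform_le [Nonempty T] {θ : ℝ} (hθ : θ ∈ Set.Icc (0 : ℝ) 1) {p u : T → ℝ}
    (hp : p ∈ stdSimplex ℝ T) (hu : u ∈ stdSimplex ℝ T) (hu0 : ∀ t, 0 < u t) :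
    crossEntropy p (mixUniform θ u) ≤ crossEntropy p u + θ * Real.log (Fintype.card T) := by
  have hc : (0 : ℝ) < Fintype.card T := by exact_mod_cast Fintype.card_pos
  have h : ∀ t, -Real.log (mixUniform θ u t) ≤
      (1 - θ) * (-Real.log (u t)) + θ * Real.log (Fintype.card T) := by
    intro t
    have := strictConcaveOn_log_Ioi.concaveOn.2 (show u t ∈ Set.Ioi (0 : ℝ) from hu0 t)
      (show 1 / (Fintype.card T : ℝ) ∈ Set.Ioi (0 : ℝ) by simp [hc])
      (show 0 ≤ 1 - θ by linarith [hθ.2]) hθ.1 (by ring)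
    simp only [smul_eq_mul, one_div, Real.log_inv] at this
    simp only [mixUniform, one_div]
    linarith
  calc _ ≤ ∑ t, p t * ((1 - θ) * (-Real.log (u t)) + θ * Real.log (Fintype.card T)) :=
        Finset.sum_le_sum fun t _ => mul_le_mul_of_nonneg_left (h t) (hp.1 t)
    _ = (1 - θ) * crossEntropy p u + (∑ t, p t) * (θ * Real.log (Fintype.card T)) := by
        unfold crossEntropy
        rw [Finset.mul_sum, Finset.sum_mul, ← Finset.sum_add_distrib]
        exact Finset.sum_congr rfl fun t _ => by ring
    _ ≤ _ := by
        rw [hp.2]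
        nlinarith [crossEntropy_nonneg hp hu, hθ.1]

end ExpWeights

/-! ### One episode of the primal-dual update -/

section PrimalDual

variable {S A : Type*} [Fintype S] [Fintype A] {d : ℕ}

/-- A positive policy, as far as the steps `1, …, H` are concerned. -/
def IsPositivePolicy (H : ℕ) (π : ℕ → S → A → ℝ) : Prop :=
  IsPolicyUpTo H π ∧ ∀ h ∈ Set.Icc 1 H, ∀ s a, 0 < π h s a

lemma AgentState.next_pol_eq (M : KnownModel S A d) (p : Params) (k : ℕ) (σ : AgentState S A d)
    (s : ℕ → S) (a : ℕ → A) (r : ℕ → S → A → ℝ) (h : ℕ) (x : S) (c : A) :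
    (σ.next M p k s a r).pol h x c = mixUniform p.theta (σ.pol h x) c *
      Real.exp (p.alpha * (qEst M p k σ.ridgeR r σ.pol h x c
        + σ.Y * qEst M p k σ.ridgeG M.g σ.pol h x c)) /
      ∑ c', mixUniform p.theta (σ.pol h x) c' *
      Real.exp (p.alpha * (qEst M p k σ.ridgeR r σ.pol h x c'
        + σ.Y * qEst M p k σ.ridgeG M.g σ.pol h x c')) := rfl

lemma AgentState.next_isPositivePolicy [Nonempty A] (M : KnownModel S A d) {p : Params}
    (h0 : 0 < p.theta) (h1 : p.theta ≤ 1) (k : ℕ) {σ : AgentState S A d}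
    (hσ : IsPositivePolicy M.H σ.pol) (s : ℕ → S) (a : ℕ → A) (r : ℕ → S → A → ℝ) :
    IsPositivePolicy M.H (σ.next M p k s a r).pol := by
  have hpos : ∀ h ∈ Set.Icc 1 M.H, ∀ x c, 0 < (σ.next M p k s a r).pol h x c := fun h hh x c => by
    rw [AgentState.next_pol_eq]
    exact div_pos (mul_pos (mixUniform_pos h0 h1 (hσ.1 h hh x) c) (Real.exp_pos _))
      (sum_mul_exp_pos (mixUniform_pos h0 h1 (hσ.1 h hh x)) _)
  refine ⟨fun h hh x => ⟨fun c => (hpos h hh x c).le, ?_⟩, hpos⟩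
  simp only [AgentState.next_pol_eq]
  rw [← Finset.sum_div, div_self]
  exact (sum_mul_exp_pos (mixUniform_pos h0 h1 (hσ.1 h hh x)) _).ne'

variable (M : LinearMixtureCMDP S A d)

/-- The expected sum over a trajectory of `π` of the cross entropies between `π` and `u`. -/
noncomputable def entropyPotential (π u : ℕ → S → A → ℝ) : ℝ :=
  value M (fun h s _ => crossEntropy (π h s) (u h s)) π 1 M.s₁

/-- The policy mixed with the uniform one, at each step and state. -/
noncomputable def mixPolicy (θ : ℝ) (u : ℕ → S → A → ℝ) : ℕ → S → A → ℝ :=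
  fun h s => mixUniform θ (u h s)

variable {M}

lemma one_mem_Icc_succ (H : ℕ) : 1 ∈ Set.Icc 1 (H + 1) := ⟨le_rfl, by omega⟩

lemma value_one_const {π : ℕ → S → A → ℝ} (hπ : IsPolicyUpTo M.H π) (c : ℝ) :
    value M (fun _ _ _ => c) π 1 M.s₁ = c * M.H := by
  rw [value_const hπ c 1 (one_mem_Icc_succ _)]; push_cast; ring

lemma entropyPotential_nonneg {π u : ℕ → S → A → ℝ} (hπ : IsPolicyUpTo M.H π)
    (hu : IsPolicyUpTo M.H u) : 0 ≤ entropyPotential M π u := by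
  have h := value_mono hπ (ℓ := fun _ _ _ => (0 : ℝ))
    (ℓ' := fun h s _ => crossEntropy (π h s) (u h s))
    (fun h hh s _ => crossEntropy_nonneg (hπ h hh s) (hu h hh s)) 1 (one_mem_Icc_succ _) M.s₁
  rwa [value_one_const hπ, zero_mul] at h

lemma entropyPotential_mix_nonneg [Nonempty A] {π u : ℕ → S → A → ℝ} (hπ : IsPolicyUpTo M.H π)
    (hu : IsPolicyUpTo M.H u) {θ : ℝ} (hθ : θ ∈ Set.Icc (0 : ℝ) 1) :
    0 ≤ entropyPotential M π (mixPolicy θ u) :=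
  entropyPotential_nonneg hπ fun h hh s => mixUniform_mem hθ (hu h hh s)

lemma entropyPotential_mix_le_log [Nonempty A] {π u : ℕ → S → A → ℝ} (hπ : IsPolicyUpTo M.H π)
    (hu : IsPolicyUpTo M.H u) {θ : ℝ} (h0 : 0 < θ) (h1 : θ ≤ 1) :
    entropyPotential M π (mixPolicy θ u) ≤ Real.log (Fintype.card A / θ) * M.H := by
  rw [← value_one_const hπ]
  exact value_mono hπ (fun h hh s _ =>
    crossEntropy_mixUniform_le_log h0 h1 (hπ h hh s) (hu h hh s)) 1 (one_mem_Icc_succ _) M.s₁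

lemma entropyPotential_mix_le [Nonempty A] {π u : ℕ → S → A → ℝ} (hπ : IsPolicyUpTo M.H π)
    (hu : IsPositivePolicy M.H u) {θ : ℝ} (hθ : θ ∈ Set.Icc (0 : ℝ) 1) :
    entropyPotential M π (mixPolicy θ u) ≤
      entropyPotential M π u + θ * Real.log (Fintype.card A) * M.H := by
  have h := value_mono hπ (ℓ := fun h s _ => crossEntropy (π h s) (mixPolicy θ u h s))
    (ℓ' := fun h s _ => crossEntropy (π h s) (u h s) + 1 * (θ * Real.log (Fintype.card A)))
    (fun h hh s _ => by
      rw [one_mul]; exact crossEntropy_mixUniform_le hθ (hπ h hh s) (hu.1 h hh s) (hu.2 h hh s))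
    1 (one_mem_Icc_succ _) M.s₁
  rw [value_add_mul hπ (fun h s _ => crossEntropy (π h s) (u h s)) _ 1 1 (one_mem_Icc_succ _),
    value_one_const hπ, one_mul] at h
  exact h

/-- The mirror descent inequality of one episode for the comparator `π`: the gain of `π` over the
optimistic value estimates, for the reward plus `Y` times the constraint, is paid for by the
decrease of the entropy potential. -/
lemma mirror_descent_step [Nonempty A] {p : Params} (h0 : 0 < p.theta) (h1 : p.theta ≤ 1)
    (hα : 0 ≤ p.alpha) {k : ℕ} {σ : AgentState S A d} (hY : 0 ≤ σ.Y)
    (hσ : IsPositivePolicy M.H σ.pol) (s : ℕ → S) (a : ℕ → A) (r : ℕ → S → A → ℝ)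
    {π : ℕ → S → A → ℝ} (hπ : IsPolicyUpTo M.H π)
    (hr : ∀ h ∈ Set.Icc 1 M.H, ∀ x c, r h x c +
      M.next h (vEst M.toKnownModel p k σ.ridgeR r σ.pol (h + 1)) x c ≤
        qEst M.toKnownModel p k σ.ridgeR r σ.pol h x c)
    (hg : ∀ h ∈ Set.Icc 1 M.H, ∀ x c, M.g h x c +
      M.next h (vEst M.toKnownModel p k σ.ridgeG M.g σ.pol (h + 1)) x c ≤
        qEst M.toKnownModel p k σ.ridgeG M.g σ.pol h x c) :
    p.alpha * ((value M r π 1 M.s₁ - vEst M.toKnownModel p k σ.ridgeR r σ.pol 1 M.s₁) +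
      σ.Y * (value M M.g π 1 M.s₁ - vEst M.toKnownModel p k σ.ridgeG M.g σ.pol 1 M.s₁)) ≤
    entropyPotential M π (mixPolicy p.theta σ.pol)
      - entropyPotential M π (σ.next M.toKnownModel p k s a r).pol
      + ((p.alpha * (1 + σ.Y) * M.H) ^ 2 / 2 + p.theta * (p.alpha * (1 + σ.Y) * M.H)) * M.H := by
  set Qr := qEst M.toKnownModel p k σ.ridgeR r σ.pol with hQr
  set Qg := qEst M.toKnownModel p k σ.ridgeG M.g σ.pol with hQg
  set c := p.alpha * (1 + σ.Y) * M.H with hc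
  have e1 := value_sub_le hπ (fun _ => vEst_last _) (fun h hh s => vEst_eq hh s) hr 1
    (one_mem_Icc_succ _) M.s₁
  have e2 := value_sub_le hπ (fun _ => vEst_last _) (fun h hh s => vEst_eq hh s) hg 1
    (one_mem_Icc_succ _) M.s₁
  rw [← hQr] at e1
  rw [← hQg] at e2
  set xr : ℕ → S → A → ℝ := fun h s _ => ∑ a, π h s a * Qr h s a - ∑ a, σ.pol h s a * Qr h s a
  set xg : ℕ → S → A → ℝ := fun h s _ => ∑ a, π h s a * Qg h s a - ∑ a, σ.pol h s a * Qg h s a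
  have e3 : (value M r π 1 M.s₁ - vEst M.toKnownModel p k σ.ridgeR r σ.pol 1 M.s₁) +
      σ.Y * (value M M.g π 1 M.s₁ - vEst M.toKnownModel p k σ.ridgeG M.g σ.pol 1 M.s₁) ≤
      value M (fun h s a => xr h s a + σ.Y * xg h s a) π 1 M.s₁ := by
    rw [value_add_mul hπ xr xg _ 1 (one_mem_Icc_succ _)]
    exact add_le_add e1 (mul_le_mul_of_nonneg_left e2 hY)
  set W0 : ℕ → S → A → ℝ := fun h s _ => crossEntropy (π h s) (mixPolicy p.theta σ.pol h s)
  set W1 : ℕ → S → A → ℝ := fun h x _ =>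
    crossEntropy (π h x) ((σ.next M.toKnownModel p k s a r).pol h x)
  have e4 : value M (fun h s a => 0 + p.alpha * (xr h s a + σ.Y * xg h s a)) π 1 M.s₁ ≤
      value M (fun h s a => (W0 h s a + (-1) * W1 h s a) + 1 * (c ^ 2 / 2 + p.theta * c))
        π 1 M.s₁ := by
    refine value_mono hπ ?_ 1 (one_mem_Icc_succ _) M.s₁
    intro h hh x _
    set X : A → ℝ := fun b => p.alpha * (Qr h x b + σ.Y * Qg h x b) with hX
    have hXc : ∀ b, X b ∈ Set.Icc 0 c := by
      intro b
      have hr1 : Qr h x b ∈ Set.Icc (0 : ℝ) M.H := qEst_le_H hh x b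
      have hg1 : Qg h x b ∈ Set.Icc (0 : ℝ) M.H := qEst_le_H hh x b
      refine ⟨mul_nonneg hα (add_nonneg hr1.1 (mul_nonneg hY hg1.1)), ?_⟩
      rw [hc, mul_assoc]
      refine mul_le_mul_of_nonneg_left ?_ hα
      have := mul_le_mul_of_nonneg_left hg1.2 hY
      linarith [hr1.2]
    have hmix : ∑ b, mixUniform p.theta (σ.pol h x) b * X b ≤
        ∑ b, σ.pol h x b * X b + p.theta * c := by
      have hcard : (0 : ℝ) < Fintype.card A := by exact_mod_cast Fintype.card_pos
      have hunif : ∑ b, (1 / Fintype.card A : ℝ) * X b ≤ c := by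
        refine sum_simplex_le ⟨fun _ => by positivity, ?_⟩ fun b => (hXc b).2
        rw [Finset.sum_const, Finset.card_univ, nsmul_eq_mul]; field_simp
      have hnn : 0 ≤ ∑ b, σ.pol h x b * X b := le_sum_simplex (hσ.1 h hh x) fun b => (hXc b).1
      have : ∑ b, mixUniform p.theta (σ.pol h x) b * X b =
          (1 - p.theta) * ∑ b, σ.pol h x b * X b
            + p.theta * ∑ b, (1 / Fintype.card A : ℝ) * X b := by
        rw [Finset.mul_sum, Finset.mul_sum, ← Finset.sum_add_distrib]
        exact Finset.sum_congr rfl fun b _ => by unfold mixUniform; ring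
      rw [this]
      have := mul_le_mul_of_nonneg_left hunif h0.le
      nlinarith
    have hstep := exp_weights_step (hπ h hh x) (mixUniform_mem ⟨h0.le, h1⟩ (hσ.1 h hh x))
      (mixUniform_pos h0 h1 (hσ.1 h hh x)) hXc
    have hx : p.alpha * (xr h x ‹A› + σ.Y * xg h x ‹A›) =
        ∑ b, π h x b * X b - ∑ b, σ.pol h x b * X b := by
      have : ∀ u : A → ℝ, ∑ b, u b * X b =
          p.alpha * (∑ b, u b * Qr h x b + σ.Y * ∑ b, u b * Qg h x b) := fun u => by
        rw [Finset.mul_sum, ← Finset.sum_add_distrib, Finset.mul_sum]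
        exact Finset.sum_congr rfl fun b _ => by rw [hX]; ring
      rw [this, this]
      simp only [xr, xg]
      ring
    have hW1 : W1 h x ‹A› = crossEntropy (π h x) (fun t => mixUniform p.theta (σ.pol h x) t *
        Real.exp (X t) / ∑ t', mixUniform p.theta (σ.pol h x) t' * Real.exp (X t')) := rfl
    have hW0 : W0 h x ‹A› = crossEntropy (π h x) (mixUniform p.theta (σ.pol h x)) := rfl
    rw [zero_add, hx, hW1, hW0]
    linarith
  rw [value_add_mul hπ (fun _ _ _ => (0 : ℝ)) _ _ 1 (one_mem_Icc_succ _),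
    value_add_mul hπ (fun h s a => W0 h s a + (-1) * W1 h s a)
      (fun _ _ _ => c ^ 2 / 2 + p.theta * c)
      1 1 (one_mem_Icc_succ _), value_add_mul hπ W0 W1 (-1) 1 (one_mem_Icc_succ _),
    value_one_const hπ, value_one_const hπ] at e4
  have e5 := mul_le_mul_of_nonneg_left e3 hα
  have e6 : entropyPotential M π (mixPolicy p.theta σ.pol) = value M W0 π 1 M.s₁ := rfl
  have e7 : entropyPotential M π (σ.next M.toKnownModel p k s a r).pol = value M W1 π 1 M.s₁ := rfl
  rw [e6, e7]
  linarith

end PrimalDual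

/-! ### The drift of the dual variable -/

/-- The step sizes of the algorithm, up to the confidence parameter: `α = 1/(H²√K)`,
`η = 1/(H√K)`, `θ = 1/K`, together with the lower bounds on `K` that the drift analysis uses. -/
structure Params.IsTuned (p : Params) (H K : ℕ) : Prop where
  alpha_eq : p.alpha = 1 / ((H : ℝ) ^ 2 * Real.sqrt K)
  eta_eq : p.eta = 1 / ((H : ℝ) * Real.sqrt K)
  theta_eq : p.theta = 1 / (K : ℝ)
  one_le_H : 1 ≤ H
  two_le_K : 2 ≤ K
  sq_le_K : H ^ 2 ≤ K

section Tuned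

variable {p : Params} {H K : ℕ} (hp : p.IsTuned H K)
include hp

lemma Params.IsTuned.H_pos : (1 : ℝ) ≤ H := by exact_mod_cast hp.one_le_H

lemma Params.IsTuned.K_pos : (2 : ℝ) ≤ K := by exact_mod_cast hp.two_le_K

lemma Params.IsTuned.H_le_sqrt : (H : ℝ) ≤ Real.sqrt K :=
  Real.le_sqrt_of_sq_le (by exact_mod_cast hp.sq_le_K)

lemma Params.IsTuned.sqrt_pos : 0 < Real.sqrt (K : ℝ) := by
  have := hp.H_le_sqrt; have := hp.H_pos; linarith

lemma Params.IsTuned.eta_pos : 0 < p.eta := by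
  have := hp.sqrt_pos; have := hp.H_pos
  rw [hp.eta_eq]; positivity

lemma Params.IsTuned.alpha_pos : 0 < p.alpha := by
  have := hp.sqrt_pos; have := hp.H_pos
  rw [hp.alpha_eq]; positivity

lemma Params.IsTuned.theta_pos : 0 < p.theta := by
  have := hp.K_pos
  rw [hp.theta_eq]; positivity

lemma Params.IsTuned.theta_le_one : p.theta ≤ 1 := by
  have := hp.K_pos
  rw [hp.theta_eq, div_le_one (by linarith)]; linarith

lemma Params.IsTuned.eta_eq_H_mul_alpha : p.eta = H * p.alpha := by
  have := hp.sqrt_pos; have := hp.H_pos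
  rw [hp.eta_eq, hp.alpha_eq]; field_simp

lemma Params.IsTuned.alpha_mul_H_pow : p.alpha * H ^ 3 = H / Real.sqrt K := by
  have := hp.sqrt_pos; have := hp.H_pos
  rw [hp.alpha_eq]; field_simp

lemma Params.IsTuned.ratio_le_one : (H : ℝ) / Real.sqrt K ≤ 1 :=
  (div_le_one hp.sqrt_pos).2 hp.H_le_sqrt

lemma Params.IsTuned.eta_mul_ratio : p.eta * (H / Real.sqrt K) = 1 / K := by
  have := hp.sqrt_pos; have := hp.H_pos
  rw [hp.eta_eq]
  conv_rhs => rw [← Real.sq_sqrt (Nat.cast_nonneg (α := ℝ) K)]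
  field_simp

lemma Params.IsTuned.eta_mul_H_sq : p.eta * H ^ 2 = H / Real.sqrt K := by
  have := hp.sqrt_pos; have := hp.H_pos
  rw [hp.eta_eq]; field_simp

lemma Params.IsTuned.eta_sq_mul_H_sq : p.eta ^ 2 * H ^ 2 = 1 / K := by
  have := hp.sqrt_pos; have := hp.H_pos
  rw [hp.eta_eq]
  conv_rhs => rw [← Real.sq_sqrt (Nat.cast_nonneg (α := ℝ) K)]
  field_simp

/-- The dual update against the regularized mirror descent inequality: the quadratic terms in `Y`
of the latter are absorbed by the shrinkage of the dual variable. -/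
lemma Params.IsTuned.dual_step {Y V b : ℝ} (hY : 0 ≤ Y) (hV : V ∈ Set.Icc (0 : ℝ) H)
    (hb : b ∈ Set.Icc (0 : ℝ) H) :
    max ((1 - p.alpha * p.eta * H ^ 3) * Y
        + p.eta * (b - V - p.alpha * H ^ 3 - 2 * p.theta * H ^ 2)) 0 ^ 2 / 2 +
      H * (((p.alpha * (1 + Y) * H) ^ 2 / 2 + p.theta * (p.alpha * (1 + Y) * H)) * H) ≤
    Y ^ 2 / 2 + p.eta * Y * (b - V) + 18 / K := by
  have hη := hp.eta_pos
  have hH := hp.H_pos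
  have hK := hp.K_pos
  have hρ := hp.ratio_le_one
  have e1 := hp.eta_mul_ratio
  have e2 := hp.eta_mul_H_sq
  have e3 := hp.eta_sq_mul_H_sq
  have e4 := hp.alpha_mul_H_pow
  have e5 := hp.eta_eq_H_mul_alpha
  have hρ0 : 0 ≤ (H : ℝ) / Real.sqrt K := div_nonneg (by positivity) (Real.sqrt_nonneg _)
  rw [hp.theta_eq]
  set ρ := (H : ℝ) / Real.sqrt K
  have hκ0 : 0 < 1 / (K : ℝ) := by positivity
  have hκ1 : 1 / (K : ℝ) ≤ 1 / 2 := one_div_le_one_div_of_le two_pos hK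
  have hκH : 1 / (K : ℝ) * H ^ 2 ≤ 1 := by
    rw [one_div_mul_eq_div, div_le_one (by linarith)]; exact_mod_cast hp.sq_le_K
  have h18 : 18 / (K : ℝ) = 18 * (1 / K) := by ring
  rw [h18]
  set κ := 1 / (K : ℝ)
  set c := b - V - ρ - 2 * κ * H ^ 2 with hc
  have hcabs : c ^ 2 ≤ 16 * H ^ 2 := by
    have h1 : -(4 * (H : ℝ)) ≤ c := by linarith [hV.2, hb.1]
    have h2 : c ≤ 4 * (H : ℝ) := by
      have : 0 ≤ κ * H ^ 2 := by positivity
      linarith [hV.1, hb.2]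
    calc c ^ 2 ≤ (4 * (H : ℝ)) ^ 2 := sq_le_sq' h1 h2
      _ = _ := by ring
  have hZ : (1 - p.alpha * p.eta * H ^ 3) * Y
        + p.eta * (b - V - p.alpha * H ^ 3 - 2 * κ * H ^ 2) = Y + p.eta * (c - ρ * Y) := by
    rw [hc, e4, show p.alpha * p.eta * (H : ℝ) ^ 3 = p.eta * (p.alpha * H ^ 3) by ring, e4]; ring
  rw [hZ]
  have hmax : max (Y + p.eta * (c - ρ * Y)) 0 ^ 2 ≤ (Y + p.eta * (c - ρ * Y)) ^ 2 := by
    rcases le_total (Y + p.eta * (c - ρ * Y)) 0 with h | h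
    · rw [max_eq_right h]; nlinarith [sq_nonneg (Y + p.eta * (c - ρ * Y))]
    · rw [max_eq_left h]
  have hsq : (Y + p.eta * (c - ρ * Y)) ^ 2 / 2 ≤
      Y ^ 2 / 2 + p.eta * Y * c - κ * Y ^ 2 + 16 * κ + κ ^ 2 * Y ^ 2 := by
    have h1 : (c - ρ * Y) ^ 2 ≤ 2 * c ^ 2 + 2 * (ρ * Y) ^ 2 := by nlinarith [sq_nonneg (c + ρ * Y)]
    have h2 : p.eta ^ 2 * (c - ρ * Y) ^ 2 / 2 ≤
        p.eta ^ 2 * (16 * H ^ 2) + p.eta ^ 2 * (ρ * Y) ^ 2 := by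
      have := mul_le_mul_of_nonneg_left h1 (sq_nonneg p.eta)
      have := mul_le_mul_of_nonneg_left hcabs (sq_nonneg p.eta)
      linarith
    have h3 : p.eta ^ 2 * (ρ * Y) ^ 2 = κ ^ 2 * Y ^ 2 := by rw [← e1]; ring
    have h4 : p.eta ^ 2 * (16 * H ^ 2) = 16 * κ := by rw [← e3]; ring
    have h5 : (Y + p.eta * (c - ρ * Y)) ^ 2 / 2 = Y ^ 2 / 2 + p.eta * Y * c
        - (p.eta * ρ) * Y ^ 2 + p.eta ^ 2 * (c - ρ * Y) ^ 2 / 2 := by ring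
    rw [h5, e1]
    linarith
  have hlin : p.eta * Y * c = p.eta * Y * (b - V) - κ * Y - 2 * κ * ρ * Y := by
    rw [hc]
    linear_combination (-Y) * e1 + (-2 * κ * Y) * e2
  have hm : H * (((p.alpha * (1 + Y) * H) ^ 2 / 2 + κ * (p.alpha * (1 + Y) * H)) * H) =
      (1 + Y) ^ 2 / 2 * κ + κ * ρ * (1 + Y) := by
    rw [← e4]
    have : κ = p.alpha ^ 2 * H ^ 4 := by rw [← e3, e5]; ring
    linear_combination (-(1 + Y) ^ 2 / 2) * this
  rw [hm]
  have h6 : κ * ρ ≤ κ := mul_le_of_le_one_right hκ0.le hρ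
  have h7 := mul_le_mul_of_nonneg_right hκ1 (mul_nonneg hκ0.le (sq_nonneg Y))
  have h8 : 0 ≤ κ * ρ * Y := by positivity
  linarith

end Tuned

section Drift

variable {S A : Type*} [Fintype S] [Fintype A] {d : ℕ} {M : LinearMixtureCMDP S A d} {p : Params}
  {K : ℕ} {st : ℕ → ℕ → S} {ac : ℕ → ℕ → A} {rw : ℕ → ℕ → S → A → ℝ}

/-- The value estimate at the initial state in episode `k`, for the reward. -/
noncomputable def rewardEst (M : KnownModel S A d) (p : Params) (st : ℕ → ℕ → S) (ac : ℕ → ℕ → A)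
    (rw : ℕ → ℕ → S → A → ℝ) (k : ℕ) : ℝ :=
  vEst M p k (agent M p st ac rw k).ridgeR (rw k) (agent M p st ac rw k).pol 1 M.s₁

/-- The value estimate at the initial state in episode `k`, for the constraint. -/
noncomputable def constraintEst (M : KnownModel S A d) (p : Params) (st : ℕ → ℕ → S)
    (ac : ℕ → ℕ → A) (rw : ℕ → ℕ → S → A → ℝ) (k : ℕ) : ℝ :=
  vEst M p k (agent M p st ac rw k).ridgeG M.g (agent M p st ac rw k).pol 1 M.s₁

/-- The estimates for the signal `ℓ` with the statistics `R` are optimistic in episode `k`. -/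
def IsOptimistic (M : LinearMixtureCMDP S A d) (p : Params) (k : ℕ) (R : Ridge d)
    (ℓ π : ℕ → S → A → ℝ) : Prop :=
  ∀ h ∈ Set.Icc 1 M.H, ∀ x c, ℓ h x c + M.next h (vEst M.toKnownModel p k R ℓ π (h + 1)) x c ≤
    qEst M.toKnownModel p k R ℓ π h x c

lemma agent_succ (M : KnownModel S A d) (p : Params) (st : ℕ → ℕ → S) (ac : ℕ → ℕ → A)
    (rw : ℕ → ℕ → S → A → ℝ) {k : ℕ} (hk : 1 ≤ k) :
    agent M p st ac rw (k + 1) =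
      (agent M p st ac rw k).next M p k (st k) (ac k) (rw k) := by
  obtain ⟨j, rfl⟩ : ∃ j, k = j + 1 := ⟨k - 1, by omega⟩
  rfl

lemma agent_isPositivePolicy [Nonempty A] (M : KnownModel S A d) (h0 : 0 < p.theta)
    (h1 : p.theta ≤ 1) (st : ℕ → ℕ → S) (ac : ℕ → ℕ → A) (rw : ℕ → ℕ → S → A → ℝ) {k : ℕ}
    (hk : 1 ≤ k) : IsPositivePolicy M.H (agent M p st ac rw k).pol := by
  induction k, hk using Nat.le_induction with
  | base =>
    have hc : (0 : ℝ) < Fintype.card A := by exact_mod_cast Fintype.card_pos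
    refine ⟨fun h _ s => ⟨fun a => ?_, ?_⟩, fun h _ s a => ?_⟩
    · change (0 : ℝ) ≤ 1 / Fintype.card A
      positivity
    · change ∑ _a : A, (1 / Fintype.card A : ℝ) = 1
      rw [Finset.sum_const, Finset.card_univ, nsmul_eq_mul]; field_simp
    · change (0 : ℝ) < 1 / Fintype.card A
      positivity
  | succ k hk ih =>
    rw [agent_succ M p st ac rw hk]
    exact AgentState.next_isPositivePolicy M h0 h1 k ih _ _ _

lemma agent_Y_nonneg (M : KnownModel S A d) (st : ℕ → ℕ → S) (ac : ℕ → ℕ → A)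
    (rw : ℕ → ℕ → S → A → ℝ) {k : ℕ} (hk : 1 ≤ k) : 0 ≤ (agent M p st ac rw k).Y := by
  rcases hk.eq_or_lt with rfl | hk
  · exact le_rfl
  · obtain ⟨j, rfl⟩ : ∃ j, k = j + 1 := ⟨k - 1, by omega⟩
    rw [agent_succ M p st ac rw (by omega)]
    exact le_max_right _ _

lemma agent_Y_succ (M : KnownModel S A d) (st : ℕ → ℕ → S) (ac : ℕ → ℕ → A)
    (rw : ℕ → ℕ → S → A → ℝ) {k : ℕ} (hk : 1 ≤ k) : (agent M p st ac rw (k + 1)).Y =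
      max ((1 - p.alpha * p.eta * M.H ^ 3) * (agent M p st ac rw k).Y
        + p.eta * (M.b - constraintEst M p st ac rw k - p.alpha * M.H ^ 3
          - 2 * p.theta * M.H ^ 2)) 0 := by
  rw [agent_succ M p st ac rw hk]
  rfl

/-- The drift inequality of episode `k` for a comparator policy `π`. -/
lemma drift_step [Nonempty A] (hp : p.IsTuned M.H K) {k : ℕ} (hk : 1 ≤ k)
    (hr : IsOptimistic M p k (agent M.toKnownModel p st ac rw k).ridgeR (rw k)
      (agent M.toKnownModel p st ac rw k).pol)
    (hg : IsOptimistic M p k (agent M.toKnownModel p st ac rw k).ridgeG M.g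
      (agent M.toKnownModel p st ac rw k).pol)
    {π : ℕ → S → A → ℝ} (hπ : IsPolicyUpTo M.H π) :
    (agent M.toKnownModel p st ac rw (k + 1)).Y ^ 2 / 2 + M.H * entropyPotential M π
        (mixPolicy p.theta (agent M.toKnownModel p st ac rw (k + 1)).pol)
      + p.eta * (value M (rw k) π 1 M.s₁ - rewardEst M.toKnownModel p st ac rw k)
      + p.eta * (agent M.toKnownModel p st ac rw k).Y * (value M M.g π 1 M.s₁ - M.b) ≤
    (agent M.toKnownModel p st ac rw k).Y ^ 2 / 2 + M.H * entropyPotential M π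
        (mixPolicy p.theta (agent M.toKnownModel p st ac rw k).pol)
      + ((M.H : ℝ) ^ 2 * Real.log (Fintype.card A) + 18) / K := by
  have hθ0 := hp.theta_pos
  have hθ1 := hp.theta_le_one
  have hpos := agent_isPositivePolicy (p := p) M.toKnownModel hθ0 hθ1 st ac rw hk
  have hpos' := agent_isPositivePolicy (p := p) M.toKnownModel hθ0 hθ1 st ac rw
    (by omega : 1 ≤ k + 1)
  have hY := agent_Y_nonneg (p := p) M.toKnownModel st ac rw hk
  have h1 := mirror_descent_step hθ0 hθ1 hp.alpha_pos.le hY hpos (st k) (ac k) (rw k) hπ hr hg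
  have h2 := entropyPotential_mix_le hπ hpos' ⟨hθ0.le, hθ1⟩
  have hV : constraintEst M.toKnownModel p st ac rw k ∈ Set.Icc (0 : ℝ) M.H :=
    vEst_le_H hpos.1 (one_mem_Icc_succ _) _
  have h3 := hp.dual_step hY hV M.b_mem
  rw [← agent_Y_succ (p := p) M.toKnownModel st ac rw hk] at h3
  rw [← agent_succ M.toKnownModel p st ac rw hk] at h1
  change p.alpha * ((value M (rw k) π 1 M.s₁ - rewardEst M.toKnownModel p st ac rw k) +
    (agent M.toKnownModel p st ac rw k).Y *
      (value M M.g π 1 M.s₁ - constraintEst M.toKnownModel p st ac rw k)) ≤ _ at h1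
  have hH := hp.H_pos
  have h4 := mul_le_mul_of_nonneg_left h1 (by linarith : (0 : ℝ) ≤ M.H)
  have h5 := mul_le_mul_of_nonneg_left h2 (by linarith : (0 : ℝ) ≤ M.H)
  rw [← mul_assoc, ← hp.eta_eq_H_mul_alpha] at h4
  have h6 : ((M.H : ℝ) ^ 2 * Real.log (Fintype.card A) + 18) / K =
      M.H * (p.theta * Real.log (Fintype.card A) * M.H) + 18 / K := by
    rw [hp.theta_eq]; ring
  rw [h6]
  linarith

lemma drift_sum [Nonempty A] (hp : p.IsTuned M.H K)
    (hr : ∀ k ∈ Set.Icc 1 K, IsOptimistic M p k (agent M.toKnownModel p st ac rw k).ridgeR (rw k)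
      (agent M.toKnownModel p st ac rw k).pol)
    (hg : ∀ k ∈ Set.Icc 1 K, IsOptimistic M p k (agent M.toKnownModel p st ac rw k).ridgeG M.g
      (agent M.toKnownModel p st ac rw k).pol)
    {π : ℕ → S → A → ℝ} (hπ : IsFeasible M π) {L : ℝ} (hL1 : 1 ≤ L)
    (hLA : Real.log (Fintype.card A * K) ≤ L) (hLA' : Real.log (Fintype.card A) ≤ L) :
    ∑ k ∈ Finset.Icc 1 K, (value M (rw k) π 1 M.s₁ - rewardEst M.toKnownModel p st ac rw k) ≤
      20 * M.H ^ 3 * Real.sqrt K * L := by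
  have hπ' := hπ.1.upTo M.H
  have hH := hp.H_pos
  have hK := hp.K_pos
  have hη := hp.eta_pos
  set E : ℝ := ((M.H : ℝ) ^ 2 * Real.log (Fintype.card A) + 18) / K with hE
  set Φ : ℕ → ℝ := fun k => (agent M.toKnownModel p st ac rw k).Y ^ 2 / 2 +
    M.H * entropyPotential M π (mixPolicy p.theta (agent M.toKnownModel p st ac rw k).pol) with hΦ
  have key : ∀ n ≤ K, Φ (n + 1) + p.eta * ∑ k ∈ Finset.Icc 1 n,
      (value M (rw k) π 1 M.s₁ - rewardEst M.toKnownModel p st ac rw k) ≤ Φ 1 + n * E := by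
    intro n hn
    induction n with
    | zero => simp
    | succ n ih =>
      have h1 := ih (by omega)
      have hmem : n + 1 ∈ Set.Icc 1 K := ⟨by omega, hn⟩
      have h2 := drift_step hp (by omega) (hr _ hmem) (hg _ hmem) hπ'
      have h3 : 0 ≤ p.eta * (agent M.toKnownModel p st ac rw (n + 1)).Y *
          (value M M.g π 1 M.s₁ - M.b) :=
        mul_nonneg (mul_nonneg hη.le (agent_Y_nonneg _ _ _ _ (by omega))) (by linarith [hπ.2])
      rw [Finset.sum_Icc_succ_top (by omega)]
      simp only [hΦ] at h1 ⊢
      push_cast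
      linarith
  have hKK := key K le_rfl
  have hΦK : 0 ≤ Φ (K + 1) := add_nonneg (by positivity) (mul_nonneg (by positivity)
    (entropyPotential_mix_nonneg hπ' (agent_isPositivePolicy _ hp.theta_pos hp.theta_le_one _ _ _
      (by omega)).1 ⟨hp.theta_pos.le, hp.theta_le_one⟩))
  have hΦ1 : Φ 1 ≤ M.H ^ 2 * L := by
    have h1 := entropyPotential_mix_le_log (M := M) hπ' (agent_isPositivePolicy (p := p)
      M.toKnownModel hp.theta_pos hp.theta_le_one st ac rw le_rfl).1 hp.theta_pos hp.theta_le_one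
    have h2 : (agent M.toKnownModel p st ac rw 1).Y = 0 := rfl
    simp only [hΦ, h2]
    rw [hp.theta_eq, div_div_eq_mul_div, div_one] at h1
    rw [hp.theta_eq]
    have h3 : Real.log (Fintype.card A * K) * M.H ≤ L * M.H := by gcongr
    have h4 := mul_le_mul_of_nonneg_left (h1.trans h3) (by linarith : (0 : ℝ) ≤ M.H)
    nlinarith
  have hKE : K * E ≤ 19 * (M.H ^ 2 * L) := by
    rw [hE, mul_div_cancel₀ _ (by linarith)]
    have h1 : (M.H : ℝ) ^ 2 * Real.log (Fintype.card A) ≤ M.H ^ 2 * L := by gcongr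
    have h2 : 1 ≤ (M.H : ℝ) ^ 2 * L := by nlinarith
    linarith
  have h7 : p.eta * ∑ k ∈ Finset.Icc 1 K,
      (value M (rw k) π 1 M.s₁ - rewardEst M.toKnownModel p st ac rw k) ≤ 20 * (M.H ^ 2 * L) := by
    linarith
  have hs := hp.sqrt_pos
  rw [hp.eta_eq, one_div_mul_eq_div, div_le_iff₀ (by positivity)] at h7
  linarith

/-- The dual variable stays of order `H²/γ`: when it is larger, the Slater condition makes the
potential `Y²/2 + H · entropy` decrease. -/
lemma dual_variable_le [Nonempty A] (hp : p.IsTuned M.H K)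
    (hr : ∀ k ∈ Set.Icc 1 K, IsOptimistic M p k (agent M.toKnownModel p st ac rw k).ridgeR (rw k)
      (agent M.toKnownModel p st ac rw k).pol)
    (hg : ∀ k ∈ Set.Icc 1 K, IsOptimistic M p k (agent M.toKnownModel p st ac rw k).ridgeG M.g
      (agent M.toKnownModel p st ac rw k).pol)
    (hrw : ∀ k ∈ Set.Icc 1 K, ∀ h ∈ Set.Icc 1 M.H, ∀ s a, rw k h s a ∈ Set.Icc (0 : ℝ) 1)
    {γ : ℝ} (hγ : Slater M γ) {L : ℝ} (hL1 : 1 ≤ L)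
    (hLA : Real.log (Fintype.card A * K) ≤ L) (hLA' : Real.log (Fintype.card A) ≤ L) :
    ∀ k ∈ Set.Icc 1 (K + 1), (agent M.toKnownModel p st ac rw k).Y ≤ 40 * M.H ^ 2 * L / γ := by
  obtain ⟨hγ0, π, hπ, hπγ⟩ := hγ
  have hπ' := hπ.upTo M.H
  have hH := hp.H_pos
  have hK := hp.K_pos
  have hη := hp.eta_pos
  have hs := hp.sqrt_pos
  have hHs := hp.H_le_sqrt
  have hγH : γ ≤ M.H := by
    have h1 := (value_mem hπ' M.g_mem 1 (one_mem_Icc_succ _) M.s₁).2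
    push_cast at h1
    linarith [M.b_mem.1]
  set E : ℝ := ((M.H : ℝ) ^ 2 * Real.log (Fintype.card A) + 18) / K with hE
  set Ψ : ℕ → ℝ := fun k =>
    entropyPotential M π (mixPolicy p.theta (agent M.toKnownModel p st ac rw k).pol) with hΨ
  set Y : ℕ → ℝ := fun k => (agent M.toKnownModel p st ac rw k).Y with hYdef
  have hY0 : ∀ k, 1 ≤ k → 0 ≤ Y k := fun k hk => agent_Y_nonneg _ _ _ _ hk
  have hΨ0 : ∀ k, 1 ≤ k → 0 ≤ M.H * Ψ k := fun k hk => mul_nonneg (by linarith)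
    (entropyPotential_mix_nonneg hπ' (agent_isPositivePolicy _ hp.theta_pos hp.theta_le_one _ _ _
      hk).1 ⟨hp.theta_pos.le, hp.theta_le_one⟩)
  have hΨ1 : ∀ k, 1 ≤ k → M.H * Ψ k ≤ M.H ^ 2 * L := fun k hk => by
    have h1 := entropyPotential_mix_le_log (M := M) hπ' (agent_isPositivePolicy (p := p)
      M.toKnownModel hp.theta_pos hp.theta_le_one st ac rw hk).1 hp.theta_pos hp.theta_le_one
    have h2 : Real.log (Fintype.card A / p.theta) * M.H ≤ L * M.H := by
      rw [hp.theta_eq, div_div_eq_mul_div, div_one]; gcongr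
    have h4 := mul_le_mul_of_nonneg_left (h1.trans h2) (by linarith : (0 : ℝ) ≤ M.H)
    calc _ ≤ _ := h4
      _ = _ := by ring
  -- the increment of the potential, apart from the Slater term
  have hinc : E + p.eta * M.H ≤ 20 * (M.H * L / Real.sqrt K) := by
    have h1 : E ≤ 19 * (M.H ^ 2 * L) / K := by
      rw [hE]
      have h1 : (M.H : ℝ) ^ 2 * Real.log (Fintype.card A) ≤ M.H ^ 2 * L := by gcongr
      have h2 : 1 ≤ (M.H : ℝ) ^ 2 * L := by nlinarith
      gcongr
      linarith
    have h2 : 19 * ((M.H : ℝ) ^ 2 * L) / K ≤ 19 * (M.H * L / Real.sqrt K) := by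
      rw [div_le_iff₀ (by linarith)]
      have e : M.H * L / Real.sqrt K * K = M.H * L * Real.sqrt K := by
        rw [div_mul_eq_mul_div, div_eq_iff hs.ne', mul_assoc _ (Real.sqrt _) (Real.sqrt _),
          Real.mul_self_sqrt (Nat.cast_nonneg _)]
      rw [mul_assoc, e]
      have : (M.H : ℝ) * L * M.H ≤ M.H * L * Real.sqrt K := by gcongr
      linarith
    have h3 : p.eta * M.H ≤ M.H * L / Real.sqrt K := by
      rw [hp.eta_eq, one_div_mul_eq_div, div_le_div_iff₀ (by positivity) hs]
      have : (M.H : ℝ) * Real.sqrt K * 1 ≤ M.H * Real.sqrt K * (M.H * L) := by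
        gcongr; nlinarith
      linarith
    linarith
  have hstep : ∀ k ∈ Set.Icc 1 K, Y (k + 1) ^ 2 / 2 + M.H * Ψ (k + 1) + p.eta * γ * Y k ≤
      Y k ^ 2 / 2 + M.H * Ψ k + 20 * (M.H * L / Real.sqrt K) := by
    intro k hk
    have h1 := drift_step hp hk.1 (hr k hk) (hg k hk) hπ'
    have h2 : p.eta * (rewardEst M.toKnownModel p st ac rw k - value M (rw k) π 1 M.s₁) ≤
        p.eta * M.H := by
      gcongr
      have h3 := (value_mem hπ' (hrw k hk) 1 (one_mem_Icc_succ _) M.s₁).1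
      have h4 : rewardEst M.toKnownModel p st ac rw k ≤ M.H :=
        (vEst_le_H (agent_isPositivePolicy _ hp.theta_pos hp.theta_le_one _ _ _
          hk.1).1 (one_mem_Icc_succ _) _).2
      linarith
    have h3 : p.eta * Y k * γ ≤ p.eta * Y k * (value M M.g π 1 M.s₁ - M.b) :=
      mul_le_mul_of_nonneg_left (by linarith) (mul_nonneg hη.le (hY0 k hk.1))
    simp only [hYdef, hΨ] at h3 ⊢
    linarith
  set y0 : ℝ := 20 * M.H ^ 2 * L / γ with hy0
  have hy0H : 20 * (M.H * L) ≤ y0 := by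
    rw [hy0, le_div_iff₀ hγ0]
    have : 20 * (M.H * L) * γ ≤ 20 * (M.H * L) * M.H := by gcongr
    linarith
  have hHL : 1 ≤ M.H * L := by nlinarith
  have hinv : ∀ k ∈ Set.Icc 1 (K + 1), Y k ^ 2 / 2 + M.H * Ψ k ≤ y0 ^ 2 := by
    rintro k ⟨hk, hkK⟩
    induction k, hk using Nat.le_induction with
    | base =>
      have h1 : Y 1 = 0 := rfl
      rw [h1]
      have h2 := hΨ1 1 le_rfl
      nlinarith
    | succ k hk ih =>
      have hk' : k ∈ Set.Icc 1 K := ⟨hk, by omega⟩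
      have h1 := hstep k hk'
      have h2 := ih (by omega)
      have hηγ : p.eta * γ * y0 = 20 * (M.H * L / Real.sqrt K) := by
        rw [hy0, hp.eta_eq]; field_simp
      rcases le_total y0 (Y k) with h | h
      · have : p.eta * γ * y0 ≤ p.eta * γ * Y k := by gcongr
        linarith
      · have h3 : 0 ≤ p.eta * γ * Y k := by have := hY0 k hk; positivity
        have h4 : Y k ^ 2 ≤ y0 ^ 2 := pow_le_pow_left₀ (hY0 k hk) h 2
        have h5 := hΨ1 k hk
        have h6 : M.H * L / Real.sqrt K ≤ L := by
          rw [div_le_iff₀ hs]; nlinarith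
        have h7 : (20 * (M.H * L)) ^ 2 ≤ y0 ^ 2 := by gcongr
        have h8 : (M.H : ℝ) ^ 2 * L * 1 ≤ M.H ^ 2 * L * L := by gcongr
        have h9 : 1 * L ≤ M.H ^ 2 * L := by
          gcongr; nlinarith
        linarith
  intro k hk
  have h1 := hinv k hk
  have h2 := hΨ0 k hk.1
  have hy0' : 0 ≤ y0 := by positivity
  have h3 : Y k ≤ 2 * y0 := by
    refine le_of_sq_le_sq ?_ (by positivity)
    nlinarith
  calc Y k ≤ 2 * y0 := h3
    _ = _ := by rw [hy0]; ring

lemma violation_est_le [Nonempty A] (hp : p.IsTuned M.H K) {c : ℝ}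
    (hY : ∀ k ∈ Set.Icc 1 (K + 1), (agent M.toKnownModel p st ac rw k).Y ≤ c) :
    ∑ k ∈ Finset.Icc 1 K, (M.b - constraintEst M.toKnownModel p st ac rw k) ≤
      (2 * c + 3) * (M.H * Real.sqrt K) := by
  have hH := hp.H_pos
  have hK := hp.K_pos
  have hη := hp.eta_pos
  have hs := hp.sqrt_pos
  have hHs := hp.H_le_sqrt
  set ρ := (M.H : ℝ) / Real.sqrt K with hρ
  have hρ0 : 0 ≤ ρ := by positivity
  set Y : ℕ → ℝ := fun k => (agent M.toKnownModel p st ac rw k).Y with hYdef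
  set G : ℝ := ρ * c + ρ + 2 * (1 / K) * M.H ^ 2
  have hstep : ∀ k ∈ Set.Icc 1 K, p.eta * (M.b - constraintEst M.toKnownModel p st ac rw k) ≤
      Y (k + 1) - Y k + p.eta * G := by
    intro k hk
    have h1 := agent_Y_succ (p := p) M.toKnownModel st ac rw hk.1
    have h2 := (le_max_left _ _).trans_eq h1.symm
    rw [mul_right_comm, hp.alpha_mul_H_pow, hp.theta_eq] at h2
    have h3 : p.eta * (ρ * Y k) ≤ p.eta * (ρ * c) := by
      gcongr; exact hY k ⟨hk.1, by have := hk.2; omega⟩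
    simp only [hYdef, G] at h3 ⊢
    linarith
  have hsum : p.eta * ∑ k ∈ Finset.Icc 1 K, (M.b - constraintEst M.toKnownModel p st ac rw k) ≤
      Y (K + 1) + K * (p.eta * G) := by
    have : ∀ n ≤ K, p.eta * ∑ k ∈ Finset.Icc 1 n,
        (M.b - constraintEst M.toKnownModel p st ac rw k) ≤ Y (n + 1) + n * (p.eta * G) := by
      intro n hn
      induction n with
      | zero => simp [hYdef, agent_Y_nonneg (p := p) M.toKnownModel st ac rw le_rfl]
      | succ n ih =>
        have h1 := ih (by omega)
        have h2 := hstep (n + 1) ⟨by omega, hn⟩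
        rw [Finset.sum_Icc_succ_top (by omega), mul_add]
        push_cast
        linarith
    exact this K le_rfl
  have hYK := hY (K + 1) ⟨by omega, le_rfl⟩
  have h4 : p.eta * ∑ k ∈ Finset.Icc 1 K, (M.b - constraintEst M.toKnownModel p st ac rw k) ≤
      p.eta * ((2 * c + 3) * (M.H * Real.sqrt K)) := by
    refine hsum.trans ?_
    have e1 : c = p.eta * (c * (M.H * Real.sqrt K)) := by rw [hp.eta_eq]; field_simp
    have e2 : K * (p.eta * G) ≤ p.eta * (c * (M.H * Real.sqrt K) + 3 * (M.H * Real.sqrt K)) := by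
      have : K * G ≤ c * (M.H * Real.sqrt K) + 3 * (M.H * Real.sqrt K) := by
        have e3 : K * ρ = M.H * Real.sqrt K := by
          rw [hρ, ← mul_div_assoc, div_eq_iff hs.ne', mul_assoc, ← pow_two,
            Real.sq_sqrt (Nat.cast_nonneg (α := ℝ) K), mul_comm]
        have e4 : K * G = (K * ρ) * c + K * ρ + 2 * M.H ^ 2 := by simp only [G]; field_simp
        rw [e4, e3]
        nlinarith
      calc _ = p.eta * (K * G) := by ring
        _ ≤ _ := by gcongr
    calc Y (K + 1) + K * (p.eta * G) ≤ c + K * (p.eta * G) := by gcongr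
      _ ≤ p.eta * (c * (M.H * Real.sqrt K)) +
          p.eta * (c * (M.H * Real.sqrt K) + 3 * (M.H * Real.sqrt K)) := by
          rw [← e1]; gcongr
      _ = _ := by ring
  exact le_of_mul_le_mul_left h4 hη

end Drift

/-! ### Measurability of the algorithm -/

section AlgorithmMeasurability

variable {Ω S A : Type*} [Fintype S] [Fintype A] {d : ℕ} {m : MeasurableSpace Ω}

lemma measurable_eval_pair {E : Type*} [MeasurableSpace E] {s : Ω → S} {a : Ω → A}
    (hs : ∀ x, MeasurableSet[m] {ω | s ω = x}) (ha : ∀ c, MeasurableSet[m] {ω | a ω = c})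
    {f : Ω → S → A → E} (hf : ∀ x c, Measurable[m] fun ω => f ω x c) :
    Measurable[m] fun ω => f ω (s ω) (a ω) :=
  measurable_eval_finite (f := fun ω x => f ω x (a ω)) hs fun x =>
    measurable_eval_finite (f := fun ω c => f ω x c) ha (hf x)

/-- The regression statistics for the steps `1, …, H` are `m`-measurable. -/
structure RidgeMeasurable (m : MeasurableSpace Ω) (H : ℕ) (R : Ω → Ridge d) : Prop where
  sigHat : ∀ h ∈ Set.Icc 1 H, ∀ i j, Measurable[m] fun ω => (R ω).sigHat h i j
  bHat : ∀ h ∈ Set.Icc 1 H, ∀ i, Measurable[m] fun ω => (R ω).bHat h i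
  sigTilde : ∀ h ∈ Set.Icc 1 H, ∀ i j, Measurable[m] fun ω => (R ω).sigTilde h i j
  bTilde : ∀ h ∈ Set.Icc 1 H, ∀ i, Measurable[m] fun ω => (R ω).bTilde h i

/-- A signal or a policy is `m`-measurable at the steps `1, …, H`. -/
def StepMeasurable (m : MeasurableSpace Ω) (H : ℕ) (ℓ : Ω → ℕ → S → A → ℝ) : Prop :=
  ∀ h ∈ Set.Icc 1 H, ∀ x c, Measurable[m] fun ω => ℓ ω h x c

omit [Fintype A] in
lemma measurable_phiV (φ : S → A → S → Fin d → ℝ) {V : Ω → S → ℝ}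
    (hV : ∀ x, Measurable[m] fun ω => V ω x) (x : S) (c : A) (j : Fin d) :
    Measurable[m] fun ω => phiV φ (V ω) x c j := by
  simp only [phiV, Finset.sum_apply, Pi.smul_apply, smul_eq_mul]
  exact Finset.measurable_sum _ fun x' _ => (hV x').mul_const _

lemma measurable_clip {f : Ω → ℝ} (lo hi : ℝ) (hf : Measurable[m] f) :
    Measurable[m] fun ω => clip lo hi (f ω) :=
  (hf.min measurable_const).max measurable_const

section

variable {H : ℕ} {R : Ω → Ridge d}

lemma RidgeMeasurable.thetaHat (hR : RidgeMeasurable m H R) {h : ℕ} (hh : h ∈ Set.Icc 1 H)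
    (i : Fin d) : Measurable[m] fun ω => (R ω).thetaHat h i :=
  measurable_mulVec (measurable_matrix_inv (hR.sigHat h hh)) (hR.bHat h hh) i

lemma RidgeMeasurable.thetaTilde (hR : RidgeMeasurable m H R) {h : ℕ} (hh : h ∈ Set.Icc 1 H)
    (i : Fin d) : Measurable[m] fun ω => (R ω).thetaTilde h i :=
  measurable_mulVec (measurable_matrix_inv (hR.sigTilde h hh)) (hR.bTilde h hh) i

end

variable {M : KnownModel S A d} {p : Params} {k : ℕ} {R : Ω → Ridge d}
  {ℓ π : Ω → ℕ → S → A → ℝ}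

omit [Fintype A] in
lemma measurable_qStep (hR : RidgeMeasurable m M.H R) (hℓ : StepMeasurable m M.H ℓ)
    {V : Ω → S → ℝ} (hV : ∀ x, Measurable[m] fun ω => V ω x) {h : ℕ} (hh : h ∈ Set.Icc 1 M.H)
    (x : S) (c : A) : Measurable[m] fun ω => qStep M p k (R ω) (ℓ ω) h (V ω) x c :=
  measurable_clip _ _ (((hℓ h hh x c).add (measurable_dotProduct (hR.thetaHat hh)
    (measurable_phiV M.φ hV x c))).add (measurable_const.mul
      (measurable_wnorm (measurable_matrix_inv (hR.sigHat h hh)) (measurable_phiV M.φ hV x c))))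

lemma measurable_vEst (hR : RidgeMeasurable m M.H R) (hℓ : StepMeasurable m M.H ℓ)
    (hπ : StepMeasurable m M.H π) :
    ∀ h ∈ Set.Icc 1 (M.H + 1), ∀ x, Measurable[m] fun ω => vEst M p k (R ω) (ℓ ω) (π ω) h x := by
  refine backward_induction (fun x => ?_) fun h hh ih x => ?_
  · simp only [vEst_last]; exact measurable_const
  · simp only [vEst_eq hh]
    exact Finset.measurable_sum _ fun c _ => (hπ h hh x c).mul (measurable_qStep hR hℓ ih hh x c)

lemma measurable_qEst (hR : RidgeMeasurable m M.H R) (hℓ : StepMeasurable m M.H ℓ)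
    (hπ : StepMeasurable m M.H π) : StepMeasurable m M.H
      fun ω => qEst M p k (R ω) (ℓ ω) (π ω) := fun h hh x c =>
  measurable_qStep hR hℓ
    (measurable_vEst hR hℓ hπ (h + 1) ⟨by omega, by have := hh.2; omega⟩) hh x c

omit [Fintype A] in
lemma measurable_sigmaSq (hR : RidgeMeasurable m M.H R) {V : Ω → S → ℝ}
    (hV : ∀ x, Measurable[m] fun ω => V ω x) {h : ℕ} (hh : h ∈ Set.Icc 1 M.H)
    (x : S) (c : A) : Measurable[m] fun ω => sigmaSq M p k (R ω) h (V ω) x c := by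
  have h1 := measurable_phiV M.φ hV x c
  have h2 := measurable_phiV M.φ (fun y => (hV y).pow_const 2) x c
  exact measurable_const.max (((measurable_clip _ _
    (measurable_dotProduct h2 (hR.thetaTilde hh))).sub
    ((measurable_clip _ _ (measurable_dotProduct h1 (hR.thetaHat hh))).pow_const 2)).add
    ((measurable_const.min (measurable_const.mul
      (measurable_wnorm (measurable_matrix_inv (hR.sigTilde h hh)) h2))).add
    (measurable_const.min (measurable_const.mul
      (measurable_wnorm (measurable_matrix_inv (hR.sigHat h hh)) h1)))))

lemma RidgeMeasurable.next (hR : RidgeMeasurable m M.H R) {V : Ω → ℕ → S → ℝ}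
    (hV : ∀ h ∈ Set.Icc 1 (M.H + 1), ∀ x, Measurable[m] fun ω => V ω h x)
    {s : Ω → ℕ → S} {a : Ω → ℕ → A}
    (hs : ∀ h ∈ Set.Icc 1 (M.H + 1), ∀ x, MeasurableSet[m] {ω | s ω h = x})
    (ha : ∀ h ∈ Set.Icc 1 M.H, ∀ c, MeasurableSet[m] {ω | a ω h = c}) :
    RidgeMeasurable m M.H fun ω => (R ω).next M p k (V ω) (s ω) (a ω) := by
  have hm1 : ∀ h ∈ Set.Icc 1 M.H, h ∈ Set.Icc 1 (M.H + 1) := fun h hh =>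
    ⟨hh.1, by have := hh.2; omega⟩
  have hm2 : ∀ h ∈ Set.Icc 1 M.H, h + 1 ∈ Set.Icc 1 (M.H + 1) := fun h hh =>
    ⟨by omega, by have := hh.2; omega⟩
  have hσ : ∀ h ∈ Set.Icc 1 M.H, Measurable[m] fun ω =>
      sigmaSq M p k (R ω) h (V ω (h + 1)) (s ω h) (a ω h) := fun h hh =>
    measurable_eval_pair (f := fun ω => sigmaSq M p k (R ω) h (V ω (h + 1)))
      (hs h (hm1 h hh)) (ha h hh) (measurable_sigmaSq hR (hV _ (hm2 h hh)) hh)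
  have hφ : ∀ h ∈ Set.Icc 1 M.H, ∀ j, Measurable[m] fun ω =>
      phiV M.φ (V ω (h + 1)) (s ω h) (a ω h) j := fun h hh j =>
    measurable_eval_pair (f := fun ω x c => phiV M.φ (V ω (h + 1)) x c j)
      (hs h (hm1 h hh)) (ha h hh) (fun x c => measurable_phiV M.φ (hV _ (hm2 h hh)) x c j)
  have hφ2 : ∀ h ∈ Set.Icc 1 M.H, ∀ j, Measurable[m] fun ω =>
      phiV M.φ (fun x => V ω (h + 1) x ^ 2) (s ω h) (a ω h) j := fun h hh j =>
    measurable_eval_pair (f := fun ω x c => phiV M.φ (fun x => V ω (h + 1) x ^ 2) x c j)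
      (hs h (hm1 h hh)) (ha h hh)
      (fun x c => measurable_phiV M.φ (fun y => (hV _ (hm2 h hh) y).pow_const 2) x c j)
  have hVs : ∀ h ∈ Set.Icc 1 M.H, Measurable[m] fun ω => V ω (h + 1) (s ω (h + 1)) := fun h hh =>
    measurable_eval_finite (f := fun ω => V ω (h + 1)) (hs _ (hm2 h hh)) (hV _ (hm2 h hh))
  refine ⟨fun h hh i j => ?_, fun h hh i => ?_, fun h hh i j => ?_, fun h hh i => ?_⟩
  · simp only [Ridge.next, Matrix.add_apply, Matrix.smul_apply, Matrix.vecMulVec_apply, smul_eq_mul]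
    exact (hR.sigHat h hh i j).add ((hσ h hh).inv.mul ((hφ h hh i).mul (hφ h hh j)))
  · simp only [Ridge.next, Pi.add_apply, Pi.smul_apply, smul_eq_mul]
    exact (hR.bHat h hh i).add (((hσ h hh).inv.mul (hVs h hh)).mul (hφ h hh i))
  · simp only [Ridge.next, Matrix.add_apply, Matrix.vecMulVec_apply]
    exact (hR.sigTilde h hh i j).add ((hφ2 h hh i).mul (hφ2 h hh j))
  · simp only [Ridge.next, Pi.add_apply, Pi.smul_apply, smul_eq_mul]
    exact (hR.bTilde h hh i).add (((hVs h hh).pow_const 2).mul (hφ2 h hh i))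

/-- All that the agent has computed is `m`-measurable, for the steps `1, …, H`. -/
structure AgentMeasurable (m : MeasurableSpace Ω) (H : ℕ) (σ : Ω → AgentState S A d) : Prop where
  pol : StepMeasurable m H fun ω => (σ ω).pol
  Y : Measurable[m] fun ω => (σ ω).Y
  ridgeR : RidgeMeasurable m H fun ω => (σ ω).ridgeR
  ridgeG : RidgeMeasurable m H fun ω => (σ ω).ridgeG

lemma AgentMeasurable.next {σ : Ω → AgentState S A d} (hσ : AgentMeasurable m M.H σ)
    {s : Ω → ℕ → S} {a : Ω → ℕ → A} {r : Ω → ℕ → S → A → ℝ}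
    (hs : ∀ h ∈ Set.Icc 1 (M.H + 1), ∀ x, MeasurableSet[m] {ω | s ω h = x})
    (ha : ∀ h ∈ Set.Icc 1 M.H, ∀ c, MeasurableSet[m] {ω | a ω h = c})
    (hr : StepMeasurable m M.H r) :
    AgentMeasurable m M.H fun ω => (σ ω).next M p k (s ω) (a ω) (r ω) := by
  have hg : StepMeasurable m M.H fun _ : Ω => M.g := fun _ _ _ _ => measurable_const
  have hw : ∀ h ∈ Set.Icc 1 M.H, ∀ x c, Measurable[m] fun ω =>
      polWeight p (σ ω).Y ((σ ω).pol h)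
        (qEst M p k (σ ω).ridgeR (r ω) (σ ω).pol h)
        (qEst M p k (σ ω).ridgeG M.g (σ ω).pol h) x c := fun h hh x c =>
    (((hσ.pol h hh x c).const_mul _).add_const _).mul (Real.measurable_exp.comp
      (((measurable_qEst hσ.ridgeR hr hσ.pol h hh x c).add
        (hσ.Y.mul (measurable_qEst hσ.ridgeG hg hσ.pol h hh x c))).const_mul _))
  refine ⟨fun h hh x c => ?_, ?_, ?_, ?_⟩
  · exact (hw h hh x c).div (Finset.measurable_sum _ fun c' _ => hw h hh x c')
  · exact ((hσ.Y.const_mul _).add ((((measurable_const.sub (measurable_vEst hσ.ridgeG hg hσ.pol 1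
      (one_mem_Icc_succ _) M.s₁)).sub_const _).sub_const _).const_mul _)).max measurable_const
  · exact hσ.ridgeR.next (measurable_vEst hσ.ridgeR hr hσ.pol) hs ha
  · exact hσ.ridgeG.next (measurable_vEst hσ.ridgeG hg hσ.pol) hs ha

lemma agent_measurable (X : Interaction Ω S A) {k : ℕ} (hk : 1 ≤ k)
    (hs : ∀ i ∈ Set.Ico 1 k, ∀ h ∈ Set.Icc 1 (M.H + 1), ∀ x,
      MeasurableSet[m] {ω | X.state i h ω = x})
    (ha : ∀ i ∈ Set.Ico 1 k, ∀ h ∈ Set.Icc 1 M.H, ∀ c, MeasurableSet[m] {ω | X.act i h ω = c})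
    (hr : ∀ i ∈ Set.Ico 1 k, StepMeasurable m M.H fun ω h => X.rew i h ω) :
    AgentMeasurable m M.H fun ω => agent M p (fun i j => X.state i j ω) (fun i j => X.act i j ω)
      (fun i j => X.rew i j ω) k := by
  induction k, hk using Nat.le_induction with
  | base =>
    exact ⟨fun _ _ _ _ => measurable_const, measurable_const,
      ⟨fun _ _ _ _ => measurable_const, fun _ _ _ => measurable_const,
        fun _ _ _ _ => measurable_const, fun _ _ _ => measurable_const⟩,
      ⟨fun _ _ _ _ => measurable_const, fun _ _ _ => measurable_const,
        fun _ _ _ _ => measurable_const, fun _ _ _ => measurable_const⟩⟩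
  | succ k hk ih =>
    have hsub : ∀ i ∈ Set.Ico 1 k, i ∈ Set.Ico 1 (k + 1) := fun i hi =>
      ⟨hi.1, by have := hi.2; omega⟩
    have hmem : k ∈ Set.Ico 1 (k + 1) := ⟨hk, by omega⟩
    have h1 := ih (fun i hi => hs i (hsub i hi)) (fun i hi => ha i (hsub i hi))
      (fun i hi => hr i (hsub i hi))
    simp only [agent_succ M p _ _ _ hk]
    exact h1.next (hs k hmem) (ha k hmem) (hr k hmem)

lemma measurable_value {M : LinearMixtureCMDP S A d} (hℓ : StepMeasurable m M.H ℓ)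
    (hπ : StepMeasurable m M.H π) (hπ' : ∀ ω, IsPolicyUpTo M.H (π ω)) :
    ∀ h ∈ Set.Icc 1 (M.H + 1), ∀ x, Measurable[m] fun ω => value M (ℓ ω) (π ω) h x := by
  refine backward_induction (fun x => ?_) fun h hh ih x => ?_
  · simp only [value_last]; exact measurable_const
  · simp only [value_bellman (hπ' _) _ hh, LinearMixtureCMDP.next]
    exact Finset.measurable_sum _ fun c _ => (hπ h hh x c).mul ((hℓ h hh x c).add
      (Finset.measurable_sum _ fun x' _ => (ih x').const_mul _))

end AlgorithmMeasurability

/-! ### The conditional laws of actions and states -/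

section Run

variable {Ω S A : Type*} {d : ℕ}

lemma comap_top_le {T : Type*} [Fintype T] {m : MeasurableSpace Ω} {z : Ω → T}
    (hz : ∀ t, MeasurableSet[m] {ω | z ω = t}) : MeasurableSpace.comap z ⊤ ≤ m := by
  rintro _ ⟨U, -, rfl⟩
  have : z ⁻¹' U = ⋃ t ∈ U, {ω | z ω = t} := by ext ω; simp
  rw [this]
  exact MeasurableSet.biUnion (Set.to_countable U) fun t _ => hz t

lemma measurableSet_comap_top {T : Type*} (z : Ω → T) (t : T) :
    MeasurableSet[MeasurableSpace.comap z ⊤] {ω | z ω = t} := ⟨{t}, trivial, rfl⟩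

lemma episodeSigma_state (X : Interaction Ω S A) {H k i j : ℕ} (hi : i ∈ Set.Ico 1 k)
    (hj : j ∈ Set.Icc 1 (H + 1)) (x : S) :
    MeasurableSet[X.episodeSigma H k] {ω | X.state i j ω = x} :=
  have hle : MeasurableSpace.comap (X.state i j) ⊤ ≤ X.episodeSigma H k :=
    le_trans (le_iSup₂_of_le i hi (le_iSup₂_of_le
      (f := fun j _ => MeasurableSpace.comap (X.state i j) ⊤) j hj le_rfl))
      (le_sup_left.trans le_sup_left)
  hle _ (measurableSet_comap_top (X.state i j) x)

lemma episodeSigma_act (X : Interaction Ω S A) {H k i j : ℕ} (hi : i ∈ Set.Ico 1 k)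
    (hj : j ∈ Set.Icc 1 H) (c : A) :
    MeasurableSet[X.episodeSigma H k] {ω | X.act i j ω = c} :=
  have hle : MeasurableSpace.comap (X.act i j) ⊤ ≤ X.episodeSigma H k :=
    le_trans (le_iSup₂_of_le i hi (le_iSup₂_of_le
      (f := fun j _ => MeasurableSpace.comap (X.act i j) ⊤) j hj le_rfl))
      (le_sup_right.trans le_sup_left)
  hle _ (measurableSet_comap_top (X.act i j) c)

lemma episodeSigma_rew (X : Interaction Ω S A) {H k i : ℕ} (hi : i ∈ Set.Icc 1 k) :
    StepMeasurable (X.episodeSigma H k) H fun ω h => X.rew i h ω := by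
  intro j hj x c
  have h1 : MeasurableSpace.comap (fun ω => X.rew i j ω x c) (borel ℝ) ≤ X.episodeSigma H k :=
    le_trans (le_iSup₂_of_le i hi (le_iSup₂_of_le j hj (le_iSup_of_le x (le_iSup_of_le
      (f := fun c => MeasurableSpace.comap (fun ω => X.rew i j ω x c) (borel ℝ)) c le_rfl))))
      le_sup_right
  rw [← BorelSpace.measurable_eq (α := ℝ)] at h1
  exact (comap_measurable _).mono h1 le_rfl

lemma preActSigma_state (X : Interaction Ω S A) {H k h j : ℕ} (hj : j ∈ Set.Icc 1 h) (x : S) :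
    MeasurableSet[X.preActSigma H k h] {ω | X.state k j ω = x} :=
  have hle : MeasurableSpace.comap (X.state k j) ⊤ ≤ X.preActSigma H k h :=
    le_trans (le_iSup₂_of_le j hj le_rfl) (le_sup_right.trans le_sup_left)
  hle _ (measurableSet_comap_top (X.state k j) x)

lemma episodeSigma_mono (X : Interaction Ω S A) (H : ℕ) {k k' : ℕ} (hk : k ≤ k') :
    X.episodeSigma H k ≤ X.episodeSigma H k' := by
  refine sup_le_sup (sup_le_sup ?_ ?_) ?_
  · exact biSup_mono fun i hi => ⟨hi.1, hi.2.trans_le hk⟩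
  · exact biSup_mono fun i hi => ⟨hi.1, hi.2.trans_le hk⟩
  · exact biSup_mono fun i hi => ⟨hi.1, hi.2.trans hk⟩

variable [Fintype S] [Fintype A]

lemma preActSigma_le (X : Interaction Ω S A) {H k h : ℕ} {m : MeasurableSpace Ω}
    (h1 : X.episodeSigma H k ≤ m)
    (h2 : ∀ j ∈ Set.Icc 1 h, ∀ x, MeasurableSet[m] {ω | X.state k j ω = x})
    (h3 : ∀ j ∈ Set.Ico 1 h, ∀ c, MeasurableSet[m] {ω | X.act k j ω = c}) :
    X.preActSigma H k h ≤ m :=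
  sup_le (sup_le h1 (iSup₂_le fun j hj => comap_top_le (h2 j hj)))
    (iSup₂_le fun j hj => comap_top_le (h3 j hj))

lemma postActSigma_le (X : Interaction Ω S A) {H k h : ℕ} (h0 : 1 ≤ h) {m : MeasurableSpace Ω}
    (h1 : X.episodeSigma H k ≤ m)
    (h2 : ∀ j ∈ Set.Icc 1 h, ∀ x, MeasurableSet[m] {ω | X.state k j ω = x})
    (h3 : ∀ j ∈ Set.Icc 1 h, ∀ c, MeasurableSet[m] {ω | X.act k j ω = c}) :
    X.postActSigma H k h ≤ m :=
  sup_le (preActSigma_le X h1 h2 fun j hj => h3 j ⟨hj.1, hj.2.le⟩)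
    (comap_top_le (h3 h ⟨h0, le_rfl⟩))

lemma agent_measurable_episodeSigma (M : KnownModel S A d) (p : Params) (X : Interaction Ω S A)
    {k : ℕ} (hk : 1 ≤ k) : AgentMeasurable (X.episodeSigma M.H k) M.H fun ω =>
      agent M p (fun i j => X.state i j ω) (fun i j => X.act i j ω) (fun i j => X.rew i j ω) k :=
  agent_measurable X hk (fun _ hi _ hh x => episodeSigma_state X hi hh x)
    (fun _ hi _ hh c => episodeSigma_act X hi hh c)
    (fun _ hi => episodeSigma_rew X ⟨hi.1, hi.2.le⟩)

variable [mΩ : MeasurableSpace Ω] {μ : Measure Ω} {M : LinearMixtureCMDP S A d} {p : Params} {K : ℕ}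
  {X : Interaction Ω S A}

lemma IsRun.episodeSigma_le (hX : IsRun μ M p K X) {k : ℕ} (hk : k ≤ K) :
    X.episodeSigma M.H k ≤ mΩ := by
  refine sup_le (sup_le ?_ ?_) ?_
  · exact iSup₂_le fun i hi => iSup₂_le fun j hj => comap_top_le fun x =>
      hX.meas_state i ⟨hi.1, hi.2.le.trans hk⟩ j hj x
  · exact iSup₂_le fun i hi => iSup₂_le fun j hj => comap_top_le fun x =>
      hX.meas_act i ⟨hi.1, hi.2.le.trans hk⟩ j hj x
  · refine iSup₂_le fun i hi => iSup₂_le fun j hj => iSup_le fun x => iSup_le fun c => ?_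
    rw [← BorelSpace.measurable_eq (α := ℝ)]
    exact (hX.meas_rew i ⟨hi.1, hi.2.trans hk⟩ j hj x c).comap_le

/-- The law of `s_{h+1}^k` given the past, as a process in the episode `k`. -/
lemma IsRun.condLaw_state (hX : IsRun μ M p K X) {h : ℕ} (hh : h ∈ Set.Icc 1 M.H) :
    CondLaw μ K (fun k => X.postActSigma M.H k h) (fun k => X.state k (h + 1))
      (fun k ω => M.P h (X.state k h ω) (X.act k h ω)) := by
  have hmem : ∀ j ∈ Set.Icc 1 h, j ∈ Set.Icc 1 M.H := fun j hj => ⟨hj.1, hj.2.trans hh.2⟩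
  have hmem' : ∀ j ∈ Set.Icc 1 h, j ∈ Set.Icc 1 (M.H + 1) := fun j hj =>
    ⟨hj.1, by have := hj.2; have := hh.2; omega⟩
  have hh1 : h + 1 ∈ Set.Icc 1 (M.H + 1) := ⟨by omega, by have := hh.2; omega⟩
  have hnext : ∀ k, 1 ≤ k → ∀ t,
      MeasurableSet[X.postActSigma M.H (k + 1) h] {ω | X.state k (h + 1) ω = t} := fun k hk t =>
    (le_sup_left.trans (le_sup_left.trans le_sup_left) :
      X.episodeSigma M.H (k + 1) ≤ X.postActSigma M.H (k + 1) h) _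
      (episodeSigma_state X ⟨hk, by omega⟩ hh1 t)
  refine ⟨fun k hk => ?_, fun k hk => ?_, fun k hk => hX.meas_state k hk _ hh1,
    fun k hk => hnext k hk.1, fun k hk t => ?_, fun k hk ω => M.P_mem hh _ _, fun k hk t =>
      hX.state_law k hk h hh t⟩
  · exact postActSigma_le X hh.1 (hX.episodeSigma_le hk.2)
      (fun j hj x => hX.meas_state k hk j (hmem' j hj) x)
      (fun j hj x => hX.meas_act k hk j (hmem j hj) x)
  · refine le_trans (postActSigma_le X hh.1 (m := X.episodeSigma M.H (k + 1))
      (episodeSigma_mono X _ (by omega)) ?_ ?_)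
      (le_sup_left.trans (le_sup_left.trans le_sup_left))
    · exact fun j hj x => episodeSigma_state X ⟨hk.1, by omega⟩ (hmem' j hj) x
    · exact fun j hj x => episodeSigma_act X ⟨hk.1, by omega⟩ (hmem j hj) x
  · refine measurable_eval_pair (f := fun _ x c => M.P h x c t) ?_ ?_ fun _ _ => measurable_const
    · exact fun x => (le_sup_left : X.preActSigma M.H k h ≤ X.postActSigma M.H k h) _
        (preActSigma_state X ⟨hh.1, le_rfl⟩ x)
    · exact fun c => (le_sup_right : _ ≤ X.postActSigma M.H k h) _
        (measurableSet_comap_top (X.act k h) c)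

/-- The law of `a_h^k` given the past, as a process in the episode `k`. -/
lemma IsRun.condLaw_act (hX : IsRun μ M p K X)
    (hpol : ∀ ω k, 1 ≤ k → IsPolicyUpTo M.H (X.policy M.toKnownModel p ω k)) {h : ℕ}
    (hh : h ∈ Set.Icc 1 M.H) :
    CondLaw μ K (fun k => X.preActSigma M.H k h) (fun k => X.act k h)
      (fun k ω => X.policy M.toKnownModel p ω k h (X.state k h ω)) := by
  have hmem : ∀ j ∈ Set.Ico 1 h, j ∈ Set.Icc 1 M.H := fun j hj => ⟨hj.1, hj.2.le.trans hh.2⟩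
  have hmem' : ∀ j ∈ Set.Icc 1 h, j ∈ Set.Icc 1 (M.H + 1) := fun j hj =>
    ⟨hj.1, by have := hj.2; have := hh.2; omega⟩
  have hle : ∀ k, X.episodeSigma M.H k ≤ X.preActSigma M.H k h := fun k =>
    le_sup_left.trans le_sup_left
  refine ⟨fun k hk => ?_, fun k hk => ?_, fun k hk => hX.meas_act k hk _ hh,
    fun k hk t => hle _ _ (episodeSigma_act X ⟨hk.1, by omega⟩ hh t), fun k hk t => ?_,
    fun k hk ω => hpol ω k hk.1 h hh _, fun k hk t => hX.act_law k hk h hh t⟩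
  · exact preActSigma_le X (hX.episodeSigma_le hk.2)
      (fun j hj x => hX.meas_state k hk j (hmem' j hj) x)
      (fun j hj x => hX.meas_act k hk j (hmem j hj) x)
  · refine le_trans (preActSigma_le X (m := X.episodeSigma M.H (k + 1))
      (episodeSigma_mono X _ (by omega)) ?_ ?_) (hle _)
    · exact fun j hj x => episodeSigma_state X ⟨hk.1, by omega⟩ (hmem' j hj) x
    · exact fun j hj x => episodeSigma_act X ⟨hk.1, by omega⟩ (hmem j hj) x
  · exact measurable_eval_finite (f := fun ω x => X.policy M.toKnownModel p ω k h x t)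
      (fun x => preActSigma_state X ⟨hh.1, le_rfl⟩ x) fun x =>
      ((agent_measurable_episodeSigma M.toKnownModel p X hk.1).pol h hh x t).mono (hle k) le_rfl

end Run

/-! ### Summing the estimation errors -/

/-- `√(dH⁴K) + √(d²H³K)`: the common part of the two rates, which bounds the estimation error. -/
noncomputable def estimationRate (d H K : ℕ) : ℝ :=
  Real.sqrt (d * H ^ 4 * K) + Real.sqrt (d ^ 2 * H ^ 3 * K)

section Sums

variable {H K d : ℕ} {L : ℝ}

lemma sum_le_sqrt_mul_sqrt {ι : Type*} (s : Finset ι) (f : ι → ℝ) {c : ℝ}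
    (hf : ∑ i ∈ s, f i ^ 2 ≤ c) :
    ∑ i ∈ s, f i ≤ Real.sqrt s.card * Real.sqrt c := by
  have h := Real.sum_mul_le_sqrt_mul_sqrt s (fun _ => 1) f
  simp only [one_mul, one_pow, Finset.sum_const, nsmul_eq_mul, mul_one] at h
  exact h.trans (mul_le_mul_of_nonneg_left (Real.sqrt_le_sqrt hf) (Real.sqrt_nonneg _))

lemma le_add_of_sq_le {x a b : ℝ} (ha : 0 ≤ a) (hb : 0 ≤ b) (h : x ^ 2 ≤ a ^ 2 + b * x) :
    x ≤ a + b := by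
  by_contra hc
  rw [not_le] at hc
  nlinarith [mul_pos (sub_pos.2 hc) (by linarith : 0 < x + a)]

/-- Comparison of `estimationRate` with the lower-order terms. -/
lemma estimationRate_bounds (hH : 1 ≤ H) (hd : 1 ≤ d) (hK : d ^ 3 * H ^ 3 ≤ K) :
    (d : ℝ) * H ^ 4 * K + d ^ 2 * H ^ 3 * K ≤ estimationRate d H K ^ 2 ∧
      (d : ℝ) ^ 2 * H ^ 3 ≤ estimationRate d H K ∧
      (H : ℝ) ^ 2 * Real.sqrt K ≤ estimationRate d H K := by
  have hH' : (1 : ℝ) ≤ H := by exact_mod_cast hH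
  have hd' : (1 : ℝ) ≤ d := by exact_mod_cast hd
  have hKr : (d : ℝ) ^ 3 * H ^ 3 ≤ K := by exact_mod_cast hK
  set s := Real.sqrt (K : ℝ) with hs
  have hs2 : s ^ 2 = K := Real.sq_sqrt (Nat.cast_nonneg K)
  set ρ := estimationRate d H K with hρ
  have hρ1 : (Real.sqrt (d * H ^ 4 * K)) ≤ ρ := le_add_of_nonneg_right (Real.sqrt_nonneg _)
  have hρ0 : 0 ≤ ρ := (Real.sqrt_nonneg _).trans hρ1
  have hρsq : (d : ℝ) * H ^ 4 * K + d ^ 2 * H ^ 3 * K ≤ ρ ^ 2 := by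
    have e1 := Real.sq_sqrt (by positivity : (0 : ℝ) ≤ d * H ^ 4 * K)
    have e2 := Real.sq_sqrt (by positivity : (0 : ℝ) ≤ d ^ 2 * H ^ 3 * K)
    have e3 := mul_nonneg (Real.sqrt_nonneg ((d : ℝ) * H ^ 4 * K))
      (Real.sqrt_nonneg ((d : ℝ) ^ 2 * H ^ 3 * K))
    rw [hρ, estimationRate]
    nlinarith
  have hρ2 : (d : ℝ) ^ 2 * H ^ 3 ≤ ρ := by
    refine abs_le_of_sq_le_sq' ?_ hρ0 |>.2
    calc ((d : ℝ) ^ 2 * H ^ 3) ^ 2 =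
          (d : ℝ) ^ 2 * H ^ 3 * (d ^ 2 * 1 * H ^ 3) := by ring
      _ ≤ (d : ℝ) ^ 2 * H ^ 3 * (d ^ 2 * d * H ^ 3) := by gcongr
      _ = (d : ℝ) ^ 2 * H ^ 3 * (d ^ 3 * H ^ 3) := by ring
      _ ≤ (d : ℝ) ^ 2 * H ^ 3 * K := by gcongr
      _ ≤ (d : ℝ) * H ^ 4 * K + d ^ 2 * H ^ 3 * K := le_add_of_nonneg_left (by positivity)
      _ ≤ ρ ^ 2 := hρsq
  have hρ3 : (H : ℝ) ^ 2 * s ≤ ρ := by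
    refine le_trans (Real.le_sqrt_of_sq_le ?_) hρ1
    rw [mul_pow, hs2]
    have : (1 : ℝ) * (H ^ 4 * K) ≤ d * (H ^ 4 * K) := by gcongr
    linarith
  exact ⟨hρsq, hρ2, hρ3⟩

/-- The quadratic inequality for the total bonus `R`, given by Cauchy–Schwarz and by the bound on
the total weight `T`. -/
lemma total_bonus_le (hd : 1 ≤ d) (hL : 0 ≤ L) {R T ρ : ℝ} (hρ0 : 0 ≤ ρ)
    (hρsq : (d : ℝ) * H ^ 4 * K + d ^ 2 * H ^ 3 * K ≤ ρ ^ 2)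
    (hRsq : R ^ 2 ≤ 80688 * d ^ 2 * H * L ^ 4 * T)
    (hT : T ≤ 2650 * L ^ 2 * (H ^ 3 * K / d + H ^ 2 * K) + 2 * H ^ 2 * R) :
    R ≤ 15000 * L ^ 3 * ρ + 161376 * L ^ 4 * (d ^ 2 * H ^ 3) := by
  have hd' : (1 : ℝ) ≤ d := by exact_mod_cast hd
  refine le_add_of_sq_le (by positivity) (by positivity) ?_
  have h1 : 80688 * d ^ 2 * H * L ^ 4 * T ≤ 80688 * d ^ 2 * H * L ^ 4 *
      (2650 * L ^ 2 * (H ^ 3 * K / d + H ^ 2 * K) + 2 * H ^ 2 * R) := by gcongr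
  have h2 : 80688 * d ^ 2 * H * L ^ 4 *
      (2650 * L ^ 2 * (H ^ 3 * K / d + H ^ 2 * K) + 2 * H ^ 2 * R) =
      213823200 * L ^ 6 * (d * H ^ 4 * K + d ^ 2 * H ^ 3 * K) +
        161376 * L ^ 4 * (d ^ 2 * H ^ 3) * R := by
    field_simp
    ring
  have h3 : 213823200 * L ^ 6 * (d * H ^ 4 * K + d ^ 2 * H ^ 3 * K) ≤
      (15000 * L ^ 3 * ρ) ^ 2 := by
    calc _ ≤ 225000000 * L ^ 6 * ρ ^ 2 := by gcongr; norm_num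
      _ = _ := by ring
  linarith

set_option maxHeartbeats 400000 in
/-- The deterministic core of the estimation bound, for the quantities along the trajectories:
`D` is the error of the value estimate, `PD` its mean over the next state, `b` the bonus, `v` and
`u` are the variances of the estimated and the true value of the next state, `W` is the squared true
value, `sig` the weight `σ̄²`, `w` and `wt` are the normalized feature lengths, and `A`, `T`, `N`,
`N'` are martingale differences. The total bonus is controlled by the sum of `sig`, by
Cauchy–Schwarz; the sum of the variances is at most `2H²` per episode, up to noise and up to the
total bonus itself; the resulting quadratic inequality is solved at the end. -/
lemma sum_estimation_le (hH : 1 ≤ H) (hd : 1 ≤ d) (hK : d ^ 3 * H ^ 3 ≤ K) (hL : 1 ≤ L)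
    {D PD b A T v u W N N' sig E w wt : ℕ → ℕ → ℝ}
    (hDlast : ∀ k ∈ Finset.Icc 1 K, D k (H + 1) = 0)
    (hD : ∀ k ∈ Finset.Icc 1 K, ∀ h ∈ Finset.Icc 1 H, D k h ≤ PD k h + b k h + A k h)
    (hPD : ∀ k ∈ Finset.Icc 1 K, ∀ h ∈ Finset.Icc 1 H, PD k h = D k (h + 1) + T k h)
    (hb0 : ∀ k ∈ Finset.Icc 1 K, ∀ h ∈ Finset.Icc 1 H, 0 ≤ b k h)
    (hb : ∀ k ∈ Finset.Icc 1 K, ∀ h ∈ Finset.Icc 1 H,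
      b k h ≤ 82 * Real.sqrt d * L * (Real.sqrt (sig k h) * min 1 (w k h)))
    (hsig0 : ∀ k ∈ Finset.Icc 1 K, ∀ h ∈ Finset.Icc 1 H, 0 ≤ sig k h)
    (hsig : ∀ k ∈ Finset.Icc 1 K, ∀ h ∈ Finset.Icc 1 H, sig k h ≤ H ^ 2 / d + v k h + 2 * E k h)
    (hv : ∀ k ∈ Finset.Icc 1 K, ∀ h ∈ Finset.Icc 1 H, v k h ≤ u k h + 2 * H * PD k h)
    (hu : ∀ k ∈ Finset.Icc 1 K, ∀ h ∈ Finset.Icc 1 H,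
      u k h ≤ W k (h + 1) - W k h + 2 * H + N k h + N' k h)
    (hWlast : ∀ k ∈ Finset.Icc 1 K, W k (H + 1) = 0) (hW : ∀ k ∈ Finset.Icc 1 K, 0 ≤ W k 1)
    (hE : ∀ k ∈ Finset.Icc 1 K, ∀ h ∈ Finset.Icc 1 H,
      E k h ≤ 164 * H ^ 2 * d * L * (min 1 (wt k h) + min 1 (w k h)))
    (hw : ∀ h ∈ Finset.Icc 1 H, ∑ k ∈ Finset.Icc 1 K, min 1 (w k h) ^ 2 ≤ 12 * d * L)
    (hwt : ∀ h ∈ Finset.Icc 1 H, ∑ k ∈ Finset.Icc 1 K, min 1 (wt k h) ^ 2 ≤ 12 * d * L)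
    (hA : ∀ h ∈ Finset.Icc 1 H, ∑ k ∈ Finset.Icc 1 K, A k h ≤ 12 * H * Real.sqrt K * L)
    (hT : ∀ h ∈ Finset.Icc 1 H, ∑ k ∈ Finset.Icc 1 K, T k h ≤ 12 * H * Real.sqrt K * L)
    (hN : ∀ h ∈ Finset.Icc 1 H, ∑ k ∈ Finset.Icc 1 K, N k h ≤ 12 * H ^ 2 * Real.sqrt K * L)
    (hN' : ∀ h ∈ Finset.Icc 1 H, ∑ k ∈ Finset.Icc 1 K, N' k h ≤ 12 * H ^ 2 * Real.sqrt K * L) :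
    ∑ k ∈ Finset.Icc 1 K, D k 1 ≤ 180000 * L ^ 4 * estimationRate d H K := by
  have hH' : (1 : ℝ) ≤ H := by exact_mod_cast hH
  have hd' : (1 : ℝ) ≤ d := by exact_mod_cast hd
  have hKr : (d : ℝ) ^ 3 * H ^ 3 ≤ K := by exact_mod_cast hK
  set s := Real.sqrt (K : ℝ) with hs
  have hs2 : s ^ 2 = K := Real.sq_sqrt (Nat.cast_nonneg K)
  have hs0 : 0 ≤ s := Real.sqrt_nonneg _
  set az := 12 * H * s * L with haz
  have haz0 : 0 ≤ az := by positivity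
  set q := Real.sqrt (d : ℝ) with hq
  have hq2 : q ^ 2 = d := Real.sq_sqrt (by linarith)
  have hq1 : 1 ≤ q := Real.one_le_sqrt.2 hd'
  -- `K ≥ d³H³` in the forms used below
  have hs_qdH : q * d * H ≤ s := by
    refine Real.le_sqrt_of_sq_le ?_
    calc (q * d * H) ^ 2 = q ^ 2 * d ^ 2 * H ^ 2 * 1 := by ring
      _ ≤ q ^ 2 * d ^ 2 * H ^ 2 * H := by gcongr
      _ = d ^ 3 * H ^ 3 := by rw [hq2]; ring
      _ ≤ K := hKr
  have hs_dH : d * H ≤ s := by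
    refine le_trans ?_ hs_qdH
    have : (1 : ℝ) * (d * H) ≤ q * (d * H) := by gcongr
    linarith
  have hs_H : (H : ℝ) ≤ s := by nlinarith
  set B : ℕ → ℝ := fun h => ∑ k ∈ Finset.Icc 1 K, b k h with hB
  set R := ∑ h ∈ Finset.Icc 1 H, B h with hR
  have hB0 : ∀ h ∈ Finset.Icc 1 H, 0 ≤ B h := fun h hh =>
    Finset.sum_nonneg fun k hk => hb0 k hk h hh
  have hR0 : 0 ≤ R := Finset.sum_nonneg hB0
  -- the errors at step `h` are bounded by the bonuses and noises of the later steps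
  have hDh : ∀ h ∈ Set.Icc 1 (H + 1), ∑ k ∈ Finset.Icc 1 K, D k h ≤
      ∑ j ∈ Finset.Icc h H, (B j + 2 * az) := by
    refine backward_induction ?_ fun h hh ih => ?_
    · rw [Finset.sum_eq_zero hDlast]; simp
    · have hh' : h ∈ Finset.Icc 1 H := Finset.mem_Icc.2 hh
      have h1 : ∑ k ∈ Finset.Icc 1 K, D k h ≤ ∑ k ∈ Finset.Icc 1 K, D k (h + 1) +
          ∑ k ∈ Finset.Icc 1 K, T k h + B h + ∑ k ∈ Finset.Icc 1 K, A k h := by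
        rw [hB, ← Finset.sum_add_distrib, ← Finset.sum_add_distrib, ← Finset.sum_add_distrib]
        exact Finset.sum_le_sum fun k hk => by
          have := hD k hk h hh'; have := hPD k hk h hh'; linarith
      rw [← Finset.add_sum_Ioc_eq_sum_Icc hh.2, ← Finset.Icc_add_one_left_eq_Ioc]
      linarith [hA h hh', hT h hh']
  have hDle : ∀ h ∈ Set.Icc 1 (H + 1), ∑ k ∈ Finset.Icc 1 K, D k h ≤ R + 2 * H * az := by
    intro h hh
    refine (hDh h hh).trans ?_
    calc _ ≤ ∑ j ∈ Finset.Icc 1 H, (B j + 2 * az) :=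
          Finset.sum_le_sum_of_subset_of_nonneg (Finset.Icc_subset_Icc_left hh.1)
            fun j hj _ => add_nonneg (hB0 j hj) (by positivity)
      _ = R + 2 * H * az := by
          rw [Finset.sum_add_distrib]; simp; ring
  have hPDsum : ∑ h ∈ Finset.Icc 1 H, ∑ k ∈ Finset.Icc 1 K, PD k h ≤ H * (R + 3 * H * az) := by
    calc _ ≤ ∑ h ∈ Finset.Icc 1 H, (R + 3 * H * az) := by
          refine Finset.sum_le_sum fun h hh => ?_
          rw [Finset.sum_congr rfl fun k hk => hPD k hk h hh, Finset.sum_add_distrib]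
          rw [Finset.mem_Icc] at hh
          have h1 := hDle (h + 1) ⟨by omega, by omega⟩
          have h2 := hT h (Finset.mem_Icc.2 hh)
          have h3 : 1 * az ≤ H * az := by gcongr
          linarith
      _ = _ := by simp; ring
  -- the variances of the true values
  have husum : ∑ h ∈ Finset.Icc 1 H, ∑ k ∈ Finset.Icc 1 K, u k h ≤
      2 * H ^ 2 * K + 24 * H ^ 3 * s * L := by
    have hWtel : ∀ k ∈ Finset.Icc 1 K,
        ∑ h ∈ Finset.Icc 1 H, (W k (h + 1) - W k h) ≤ 0 := by
      intro k hk
      have e : ∀ n, ∑ h ∈ Finset.Icc 1 n, (W k (h + 1) - W k h) = W k (n + 1) - W k 1 := by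
        intro n
        induction n with
        | zero => simp
        | succ n ih => rw [Finset.sum_Icc_succ_top (by omega), ih]; ring
      rw [e, hWlast k hk]
      linarith [hW k hk]
    calc _ ≤ ∑ h ∈ Finset.Icc 1 H, ∑ k ∈ Finset.Icc 1 K,
          ((W k (h + 1) - W k h) + (2 * H + N k h + N' k h)) :=
          Finset.sum_le_sum fun h hh => Finset.sum_le_sum fun k hk => by
            linarith [hu k hk h hh]
      _ = ∑ k ∈ Finset.Icc 1 K, ∑ h ∈ Finset.Icc 1 H, (W k (h + 1) - W k h) +
          ∑ h ∈ Finset.Icc 1 H, ∑ k ∈ Finset.Icc 1 K, (2 * H + N k h + N' k h) := by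
          simp only [Finset.sum_add_distrib (f := fun k => W k _ - W k _)]
          rw [Finset.sum_add_distrib, Finset.sum_comm]
      _ ≤ 0 + ∑ h ∈ Finset.Icc 1 H, (2 * H * K + 24 * H ^ 2 * s * L) := by
          refine add_le_add (Finset.sum_nonpos hWtel) (Finset.sum_le_sum fun h hh => ?_)
          rw [Finset.sum_add_distrib, Finset.sum_add_distrib]
          simp only [Finset.sum_const, Nat.card_Icc, Nat.add_sub_cancel, nsmul_eq_mul]
          linarith [hN h hh, hN' h hh]
      _ = _ := by simp; ring
  -- the exploration terms
  have hEsum : ∑ h ∈ Finset.Icc 1 H, ∑ k ∈ Finset.Icc 1 K, E k h ≤ 1312 * H ^ 2 * K * L ^ 2 := by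
    have hroot : Real.sqrt (12 * d * L) ≤ 4 * q * L := by
      refine Real.sqrt_le_iff.2 ⟨by positivity, ?_⟩
      rw [mul_pow, mul_pow, hq2]
      have : 12 * d * L * 1 ≤ 16 * d * L * L := by gcongr; norm_num
      linarith
    have hmin : ∀ x : ℕ → ℕ → ℝ, (∀ h ∈ Finset.Icc 1 H,
        ∑ k ∈ Finset.Icc 1 K, min 1 (x k h) ^ 2 ≤ 12 * d * L) → ∀ h ∈ Finset.Icc 1 H,
        ∑ k ∈ Finset.Icc 1 K, min 1 (x k h) ≤ s * (4 * q * L) := by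
      intro x hx h hh
      have h1 := sum_le_sqrt_mul_sqrt _ _ (hx h hh)
      rw [Nat.card_Icc, Nat.add_sub_cancel] at h1
      exact h1.trans (mul_le_mul_of_nonneg_left hroot hs0)
    calc _ ≤ ∑ h ∈ Finset.Icc 1 H, 164 * H ^ 2 * d * L * (s * (4 * q * L) + s * (4 * q * L)) := by
          refine Finset.sum_le_sum fun h hh => ?_
          calc _ ≤ ∑ k ∈ Finset.Icc 1 K,
                164 * H ^ 2 * d * L * (min 1 (wt k h) + min 1 (w k h)) :=
                Finset.sum_le_sum fun k hk => hE k hk h hh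
            _ ≤ _ := by
                rw [← Finset.mul_sum, Finset.sum_add_distrib]
                gcongr
                · exact hmin wt hwt h hh
                · exact hmin w hw h hh
      _ = 1312 * H ^ 2 * s * L ^ 2 * (q * d * H) := by simp; ring
      _ ≤ 1312 * H ^ 2 * s * L ^ 2 * s := by gcongr
      _ = _ := by rw [← hs2]; ring
  -- the sum of the weights
  set Tσ := ∑ h ∈ Finset.Icc 1 H, ∑ k ∈ Finset.Icc 1 K, sig k h with hTσ
  have hTσ0 : 0 ≤ Tσ := Finset.sum_nonneg fun h hh => Finset.sum_nonneg fun k hk => hsig0 k hk h hh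
  have hTσle : Tσ ≤ 2650 * L ^ 2 * (H ^ 3 * K / d + H ^ 2 * K) + 2 * H ^ 2 * R := by
    have h1 : Tσ ≤ H ^ 3 * K / d + ∑ h ∈ Finset.Icc 1 H, ∑ k ∈ Finset.Icc 1 K, u k h +
        2 * H * ∑ h ∈ Finset.Icc 1 H, ∑ k ∈ Finset.Icc 1 K, PD k h +
        2 * ∑ h ∈ Finset.Icc 1 H, ∑ k ∈ Finset.Icc 1 K, E k h := by
      calc _ ≤ ∑ h ∈ Finset.Icc 1 H, ∑ k ∈ Finset.Icc 1 K,
            ((H : ℝ) ^ 2 / d + u k h + 2 * H * PD k h + 2 * E k h) :=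
            Finset.sum_le_sum fun h hh => Finset.sum_le_sum fun k hk => by
              linarith [hsig k hk h hh, hv k hk h hh]
        _ = _ := by
            simp only [Finset.sum_add_distrib, ← Finset.mul_sum]
            simp
            ring
    have hKd : 0 ≤ (H : ℝ) ^ 3 * K / d := by positivity
    have e1 : (H : ℝ) ^ 3 * s * L ≤ H ^ 2 * K * L ^ 2 := by
      rw [← hs2]
      calc (H : ℝ) ^ 3 * s * L = H ^ 2 * (H * s) * (L * 1) := by ring
        _ ≤ H ^ 2 * (s * s) * (L * L) := by gcongr
        _ = _ := by ring
    have e2 : (H : ℝ) ^ 4 * s * L ≤ H ^ 3 * K / d * L ^ 2 := by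
      rw [div_mul_eq_mul_div, le_div_iff₀ (by linarith), ← hs2]
      calc (H : ℝ) ^ 4 * s * L * d = H ^ 3 * (d * H * s) * (L * 1) := by ring
        _ ≤ H ^ 3 * (s * s) * (L * L) := by gcongr
        _ = _ := by ring
    have e3 : 2 * H * (H * (R + 3 * H * az)) = 2 * H ^ 2 * R + 72 * (H ^ 4 * s * L) := by
      rw [haz]; ring
    have e4 : (1 : ℝ) ≤ L ^ 2 := one_le_pow₀ hL
    have e5 : (H : ℝ) ^ 3 * K / d * 1 ≤ H ^ 3 * K / d * L ^ 2 := by gcongr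
    have e6 : (H : ℝ) ^ 2 * K * 1 ≤ H ^ 2 * K * L ^ 2 := by gcongr
    have e7 := mul_le_mul_of_nonneg_left hPDsum (by linarith : (0 : ℝ) ≤ 2 * H)
    have e8 : 0 ≤ (H : ℝ) ^ 3 * K / d * L ^ 2 := by positivity
    rw [e3] at e7
    linarith
  -- Cauchy–Schwarz for the bonuses
  have hRsq : R ^ 2 ≤ 80688 * d ^ 2 * H * L ^ 4 * Tσ := by
    have h1 : R ≤ 82 * q * L * (Real.sqrt Tσ * Real.sqrt (H * (12 * d * L))) := by
      calc R ≤ ∑ h ∈ Finset.Icc 1 H, ∑ k ∈ Finset.Icc 1 K,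
            82 * q * L * (Real.sqrt (sig k h) * min 1 (w k h)) :=
            Finset.sum_le_sum fun h hh => Finset.sum_le_sum fun k hk => hb k hk h hh
        _ = 82 * q * L * ∑ x ∈ Finset.Icc 1 H ×ˢ Finset.Icc 1 K,
            Real.sqrt (sig x.2 x.1) * min 1 (w x.2 x.1) := by
            rw [Finset.sum_product, Finset.mul_sum]
            exact Finset.sum_congr rfl fun h _ => by rw [Finset.mul_sum]
        _ ≤ 82 * q * L * (Real.sqrt (∑ x ∈ Finset.Icc 1 H ×ˢ Finset.Icc 1 K,
              Real.sqrt (sig x.2 x.1) ^ 2) * Real.sqrt (∑ x ∈ Finset.Icc 1 H ×ˢ Finset.Icc 1 K,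
              min 1 (w x.2 x.1) ^ 2)) := by
            gcongr
            exact Real.sum_mul_le_sqrt_mul_sqrt _ _ _
        _ ≤ _ := by
            gcongr
            · rw [Finset.sum_product]
              refine Finset.sum_le_sum fun h hh => Finset.sum_le_sum fun k hk => ?_
              exact (Real.sq_sqrt (hsig0 k hk h hh)).le
            · rw [Finset.sum_product]
              calc _ ≤ ∑ h ∈ Finset.Icc 1 H, 12 * d * L := Finset.sum_le_sum hw
                _ = _ := by simp
    have h2 := pow_le_pow_left₀ hR0 h1 2
    refine h2.trans ?_
    have e : (82 * q * L * (Real.sqrt Tσ * Real.sqrt (H * (12 * d * L)))) ^ 2 =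
        82 ^ 2 * q ^ 2 * L ^ 2 * (Real.sqrt Tσ ^ 2 * Real.sqrt (H * (12 * d * L)) ^ 2) := by ring
    rw [e, Real.sq_sqrt hTσ0, hq2, Real.sq_sqrt (by positivity)]
    calc 82 ^ 2 * d * L ^ 2 * (Tσ * (H * (12 * d * L))) =
          80688 * d ^ 2 * H * (L ^ 3 * 1) * Tσ := by ring
      _ ≤ 80688 * d ^ 2 * H * (L ^ 3 * L) * Tσ := by gcongr
      _ = _ := by ring
  set ρ := estimationRate d H K with hρ
  obtain ⟨hρsq, hρ2, hρ3⟩ : (d : ℝ) * H ^ 4 * K + d ^ 2 * H ^ 3 * K ≤ ρ ^ 2 ∧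
      (d : ℝ) ^ 2 * H ^ 3 ≤ ρ ∧ (H : ℝ) ^ 2 * s ≤ ρ := estimationRate_bounds hH hd hK
  have hρ0 : 0 ≤ ρ := le_trans (by positivity) hρ2
  have hRle := total_bonus_le hd (by linarith : 0 ≤ L) hρ0 hρsq hRsq hTσle
  have hfin := hDle 1 (one_mem_Icc_succ _)
  have f1 : L ^ 3 * ρ ≤ L ^ 4 * ρ := by
    gcongr
    norm_num
  have f2 : L ^ 4 * (d ^ 2 * H ^ 3) ≤ L ^ 4 * ρ := by gcongr
  have f3 : L * (H ^ 2 * s) ≤ L ^ 4 * ρ := by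
    gcongr
    exact le_self_pow₀ hL (by norm_num)
  have f4 : 2 * H * az = 24 * (L * (H ^ 2 * s)) := by rw [haz]; ring
  rw [f4] at hfin
  linarith

end Sums

/-! ### Confidence ellipsoids, optimism and variance estimates -/

section Confidence

variable {S A : Type*} [Fintype S] {d : ℕ} {M : LinearMixtureCMDP S A d}

lemma phiV_smul (φ : S → A → S → Fin d → ℝ) (c : ℝ) (V : S → ℝ) (s : S) (a : A) :
    phiV φ (fun x => c * V x) s a = c • phiV φ V s a := by
  simp only [phiV, Finset.smul_sum, smul_smul]

lemma phiV_dotProduct_self_le (M : LinearMixtureCMDP S A d) {V : S → ℝ} {c : ℝ} (hc : 0 < c)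
    (hV : ∀ x, V x ∈ Set.Icc 0 c) (s : S) (a : A) :
    phiV M.φ V s a ⬝ᵥ phiV M.φ V s a ≤ c ^ 2 := by
  have h1 := M.norm_phiV_le (fun x => c⁻¹ * V x)
    (fun x => ⟨mul_nonneg (inv_nonneg.2 hc.le) (hV x).1, by
      rw [inv_mul_le_iff₀ hc, mul_one]; exact (hV x).2⟩) s a
  rw [phiV_smul] at h1
  have h2 : (c⁻¹ • phiV M.φ V s a) ⬝ᵥ (c⁻¹ • phiV M.φ V s a) ≤ 1 := by
    rw [← norm_toLp_sq]
    exact pow_le_one₀ (norm_nonneg _) h1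
  rw [dotProduct_smul, smul_dotProduct, smul_eq_mul, smul_eq_mul, ← mul_assoc, ← mul_inv,
    inv_mul_le_iff₀ (by positivity)] at h2
  linarith

lemma LinearMixtureCMDP.next_mem {h : ℕ} (hh : h ∈ Set.Icc 1 M.H) {V : S → ℝ} {c c' : ℝ}
    (hV : ∀ x, V x ∈ Set.Icc c c') (s : S) (a : A) : M.next h V s a ∈ Set.Icc c c' :=
  sum_simplex_mem_Icc (M.P_mem hh s a) hV

/-- The conditional variance of `V(s_{h+1})`. -/
noncomputable def nextVar (M : LinearMixtureCMDP S A d) (h : ℕ) (V : S → ℝ) (s : S) (a : A) : ℝ :=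
  M.next h (fun x => V x ^ 2) s a - M.next h V s a ^ 2

lemma nextVar_nonneg {h : ℕ} (hh : h ∈ Set.Icc 1 M.H) (V : S → ℝ) (s : S) (a : A) :
    0 ≤ nextVar M h V s a :=
  sub_nonneg.2 (sq_sum_simplex_le (M.P_mem hh s a) V)

lemma nextVar_eq {h : ℕ} (hh : h ∈ Set.Icc 1 M.H) (V : S → ℝ) (s : S) (a : A) :
    ∑ t, M.P h s a t * (V t - M.next h V s a) ^ 2 = nextVar M h V s a := by
  have e : ∀ t, M.P h s a t * (V t - M.next h V s a) ^ 2 = M.P h s a t * V t ^ 2 -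
      2 * M.next h V s a * (M.P h s a t * V t) + M.P h s a t * M.next h V s a ^ 2 :=
    fun t => by ring
  rw [Finset.sum_congr rfl fun t _ => e t, Finset.sum_add_distrib, Finset.sum_sub_distrib,
    ← Finset.mul_sum, ← Finset.sum_mul, (M.P_mem hh s a).2]
  unfold nextVar LinearMixtureCMDP.next
  ring

/-- The variance of a larger function exceeds that of a smaller one by at most `2c` times the mean
of the difference. -/
lemma nextVar_le_add {h : ℕ} (hh : h ∈ Set.Icc 1 M.H) {V V' : S → ℝ} {c : ℝ}
    (hV' : ∀ x, 0 ≤ V' x) (hVV' : ∀ x, V' x ≤ V x) (hV : ∀ x, V x ≤ c) (s : S) (a : A) :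
    nextVar M h V s a ≤ nextVar M h V' s a + 2 * c * M.next h (fun x => V x - V' x) s a := by
  have h1 : M.next h (fun x => V x ^ 2) s a - M.next h (fun x => V' x ^ 2) s a ≤
      2 * c * M.next h (fun x => V x - V' x) s a := by
    unfold LinearMixtureCMDP.next
    rw [← Finset.sum_sub_distrib, Finset.mul_sum]
    refine Finset.sum_le_sum fun t _ => ?_
    have h2 : V t ^ 2 - V' t ^ 2 ≤ 2 * c * (V t - V' t) := by
      nlinarith [hV' t, hVV' t, hV t, mul_nonneg (sub_nonneg.2 (hVV' t))
        (by linarith [hV' t, hVV' t, hV t] : 0 ≤ 2 * c - V t - V' t)]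
    have h3 := mul_le_mul_of_nonneg_left h2 (M.P_nonneg h hh s a t)
    linarith
  have h4 := M.next_mono hh hVV' s a
  have h5 : 0 ≤ M.next h V' s a := le_sum_simplex (M.P_mem hh s a) hV'
  have h6 : M.next h V' s a ^ 2 ≤ M.next h V s a ^ 2 := pow_le_pow_left₀ h5 h4 2
  unfold nextVar
  linarith

variable {p : Params} {k : ℕ} {R : Ridge d} {h : ℕ} {V : S → ℝ}

/-- `θ*_h` lies in the ellipsoid of radius `β` around the estimate `ϑ`. -/
lemma abs_dotProduct_sub_next_le (hh : h ∈ Set.Icc 1 M.H) {Z : Matrix (Fin d) (Fin d) ℝ}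
    (hZ : Z.PosDef) {ϑ : Fin d → ℝ} {β : ℝ} (hβ : wnorm Z (ϑ - M.θstar h) ≤ β) (V : S → ℝ) (s : S)
    (a : A) : |phiV M.φ V s a ⬝ᵥ ϑ - M.next h V s a| ≤ β * wnorm Z⁻¹ (phiV M.φ V s a) := by
  rw [M.next_eq_dotProduct hh, ← dotProduct_sub, dotProduct_comm]
  exact (abs_dotProduct_le_wnorm_mul hZ _ _).trans
    (mul_le_mul_of_nonneg_right hβ (wnorm_nonneg _ _))

lemma qStep_optimistic (hh : h ∈ Set.Icc 1 M.H) (hZ : (R.sigHat h).PosDef)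
    (hβ : wnorm (R.sigHat h) (R.thetaHat h - M.θstar h) ≤ betaHat d M.H M.B p k)
    (hV : ∀ x, V x ∈ Set.Icc (0 : ℝ) ((M.H : ℝ) - h)) {ℓ : ℕ → S → A → ℝ}
    (s : S) (a : A) (hℓ : ℓ h s a ∈ Set.Icc (0 : ℝ) 1) :
    ℓ h s a + M.next h V s a ≤ qStep M.toKnownModel p k R ℓ h V s a := by
  have h1 := abs_le.1 (abs_dotProduct_sub_next_le hh hZ hβ V s a)
  have h2 := M.next_mem hh hV s a
  unfold qStep clip
  refine (le_min ?_ ?_).trans (le_max_left _ _)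
  · rw [dotProduct_comm (R.thetaHat h)]; linarith [h1.1]
  · linarith [h2.2, hℓ.2]

lemma qStep_le (hh : h ∈ Set.Icc 1 M.H) (hZ : (R.sigHat h).PosDef)
    (hβ : wnorm (R.sigHat h) (R.thetaHat h - M.θstar h) ≤ betaHat d M.H M.B p k)
    (hV : ∀ x, 0 ≤ V x) {ℓ : ℕ → S → A → ℝ}
    (s : S) (a : A) (hℓ : ℓ h s a ∈ Set.Icc (0 : ℝ) 1) :
    qStep M.toKnownModel p k R ℓ h V s a ≤ ℓ h s a + M.next h V s a +
      min (M.H : ℝ) (2 * betaHat d M.H M.B p k * wnorm (R.sigHat h)⁻¹ (phiV M.φ V s a)) := by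
  have h1 := abs_le.1 (abs_dotProduct_sub_next_le hh hZ hβ V s a)
  have h2 : 0 ≤ M.next h V s a := le_sum_simplex (M.P_mem hh s a) hV
  have hh1 : (1 : ℝ) ≤ h := by exact_mod_cast hh.1
  have hh2 : (h : ℝ) ≤ M.H := by exact_mod_cast hh.2
  have h3 : 0 ≤ betaHat d M.H M.B p k := (wnorm_nonneg _ _).trans hβ
  have h4 := mul_nonneg h3 (wnorm_nonneg (R.sigHat h)⁻¹ (phiV M.φ V s a))
  unfold qStep clip
  rw [dotProduct_comm (R.thetaHat h), ← sub_le_iff_le_add']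
  refine le_min ?_ ?_
  · have : max (min (ℓ h s a + phiV M.φ V s a ⬝ᵥ R.thetaHat h +
        betaHat d M.H M.B p k * wnorm (R.sigHat h)⁻¹ (phiV M.φ V s a)) ((M.H : ℝ) - h + 1)) 0 ≤
        (M.H : ℝ) - h + 1 := max_le (min_le_right _ _) (by linarith)
    linarith [hℓ.1]
  · rw [sub_le_iff_le_add]
    refine max_le ((min_le_left _ _).trans ?_) ?_
    · linarith [h1.2]
    · linarith [hℓ.1]

lemma offset_nonneg (hβ1 : 0 ≤ betaTilde d M.H M.B p k) (hβ2 : 0 ≤ betaCheck d M.H M.B p k)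
    (s : S) (a : A) : 0 ≤ offset M.toKnownModel p k R h V s a :=
  add_nonneg (le_min (by positivity) (mul_nonneg hβ1 (wnorm_nonneg _ _)))
    (le_min (by positivity) (mul_nonneg (by positivity) (wnorm_nonneg _ _)))

/-- The error of the variance estimate is at most the offset. -/
lemma abs_varEst_sub_le (hh : h ∈ Set.Icc 1 M.H) (hZ : (R.sigHat h).PosDef)
    (hZ' : (R.sigTilde h).PosDef)
    (hβ : wnorm (R.sigHat h) (R.thetaHat h - M.θstar h) ≤ betaCheck d M.H M.B p k)
    (hβ' : wnorm (R.sigTilde h) (R.thetaTilde h - M.θstar h) ≤ betaTilde d M.H M.B p k)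
    (hV : ∀ x, V x ∈ Set.Icc (0 : ℝ) M.H) (s : S) (a : A) :
    |varEst M.toKnownModel R h V s a - nextVar M h V s a| ≤
      offset M.toKnownModel p k R h V s a := by
  have hH : (0 : ℝ) ≤ M.H := Nat.cast_nonneg _
  have hV2 : ∀ x, V x ^ 2 ∈ Set.Icc (0 : ℝ) ((M.H : ℝ) ^ 2) := fun x =>
    ⟨sq_nonneg _, pow_le_pow_left₀ (hV x).1 (hV x).2 2⟩
  have m1 := M.next_mem hh hV s a
  have m2 := M.next_mem hh hV2 s a
  have e1 := abs_dotProduct_sub_next_le hh hZ hβ V s a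
  have e2 := abs_dotProduct_sub_next_le hh hZ' hβ' (fun x => V x ^ 2) s a
  set y := clip 0 ((M.H : ℝ) ^ 2) (phiV M.φ (fun x => V x ^ 2) s a ⬝ᵥ R.thetaTilde h) with hy
  set z := clip 0 (M.H : ℝ) (phiV M.φ V s a ⬝ᵥ R.thetaHat h) with hz
  have my : y ∈ Set.Icc (0 : ℝ) ((M.H : ℝ) ^ 2) := clip_mem (by positivity) _
  have mz : z ∈ Set.Icc (0 : ℝ) (M.H : ℝ) := clip_mem hH _
  have c1 : |z - M.next h V s a| ≤ _ := (abs_clip_sub_le m1).trans e1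
  have c2 : |y - M.next h (fun x => V x ^ 2) s a| ≤ _ := (abs_clip_sub_le m2).trans e2
  have b1 : |y - M.next h (fun x => V x ^ 2) s a| ≤ min ((M.H : ℝ) ^ 2)
      (betaTilde d M.H M.B p k * wnorm (R.sigTilde h)⁻¹ (phiV M.φ (fun x => V x ^ 2) s a)) := by
    refine le_min ?_ c2
    rw [abs_le]; constructor <;> linarith [my.1, my.2, m2.1, m2.2]
  have b2 : |z ^ 2 - M.next h V s a ^ 2| ≤ min ((M.H : ℝ) ^ 2)
      (2 * M.H * betaCheck d M.H M.B p k * wnorm (R.sigHat h)⁻¹ (phiV M.φ V s a)) := by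
    refine le_min ?_ ?_
    · have z2 := pow_le_pow_left₀ mz.1 mz.2 2
      have n2 := pow_le_pow_left₀ m1.1 m1.2 2
      have z0 := sq_nonneg z
      have n0 := sq_nonneg (M.next h V s a)
      rw [abs_le]; constructor <;> linarith
    · have e : z ^ 2 - M.next h V s a ^ 2 = (z + M.next h V s a) * (z - M.next h V s a) := by ring
      rw [e, abs_mul, abs_of_nonneg (add_nonneg mz.1 m1.1)]
      calc _ ≤ (2 * (M.H : ℝ)) *
              (betaCheck d M.H M.B p k * wnorm (R.sigHat h)⁻¹ (phiV M.φ V s a)) := by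
            gcongr
            linarith [mz.2, m1.2]
        _ = _ := by ring
  have e : varEst M.toKnownModel R h V s a - nextVar M h V s a =
      (y - M.next h (fun x => V x ^ 2) s a) - (z ^ 2 - M.next h V s a ^ 2) := by
    unfold varEst nextVar
    ring
  rw [e]
  exact (abs_sub _ _).trans (add_le_add b1 b2)

lemma nextVar_le_sigmaSq (hh : h ∈ Set.Icc 1 M.H) (hZ : (R.sigHat h).PosDef)
    (hZ' : (R.sigTilde h).PosDef)
    (hβ : wnorm (R.sigHat h) (R.thetaHat h - M.θstar h) ≤ betaCheck d M.H M.B p k)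
    (hβ' : wnorm (R.sigTilde h) (R.thetaTilde h - M.θstar h) ≤ betaTilde d M.H M.B p k)
    (hV : ∀ x, V x ∈ Set.Icc (0 : ℝ) M.H) (s : S) (a : A) :
    nextVar M h V s a ≤ sigmaSq M.toKnownModel p k R h V s a := by
  have h1 := abs_le.1 (abs_varEst_sub_le hh hZ hZ' hβ hβ' hV s a)
  refine le_trans ?_ (le_max_right _ _)
  linarith [h1.1]

lemma sigmaSq_le_add (hh : h ∈ Set.Icc 1 M.H) (hZ : (R.sigHat h).PosDef)
    (hZ' : (R.sigTilde h).PosDef)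
    (hβ : wnorm (R.sigHat h) (R.thetaHat h - M.θstar h) ≤ betaCheck d M.H M.B p k)
    (hβ' : wnorm (R.sigTilde h) (R.thetaTilde h - M.θstar h) ≤ betaTilde d M.H M.B p k)
    (hV : ∀ x, V x ∈ Set.Icc (0 : ℝ) M.H) (s : S) (a : A) :
    sigmaSq M.toKnownModel p k R h V s a ≤ (M.H : ℝ) ^ 2 / d + nextVar M h V s a +
      2 * offset M.toKnownModel p k R h V s a := by
  have h1 := abs_le.1 (abs_varEst_sub_le hh hZ hZ' hβ hβ' hV s a)
  have h2 := nextVar_nonneg hh V s a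
  have h3 : 0 ≤ offset M.toKnownModel p k R h V s a :=
    offset_nonneg ((wnorm_nonneg _ _).trans hβ') ((wnorm_nonneg _ _).trans hβ) s a
  have h4 : 0 ≤ (M.H : ℝ) ^ 2 / d := by positivity
  refine max_le ?_ ?_
  · linarith
  · linarith [h1.2]

lemma le_sigmaSq (M : KnownModel S A d) (p : Params) (k : ℕ) (R : Ridge d) (h : ℕ)
    (V : S → ℝ) (s : S) (a : A) : (M.H : ℝ) ^ 2 / d ≤ sigmaSq M p k R h V s a := le_max_left _ _

lemma sigmaSq_le (M : KnownModel S A d) (hd : 1 ≤ d) (s : S) (a : A) :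
    sigmaSq M p k R h V s a ≤ 3 * (M.H : ℝ) ^ 2 := by
  have hd' : (1 : ℝ) ≤ d := by exact_mod_cast hd
  have hH : (0 : ℝ) ≤ (M.H : ℝ) ^ 2 := by positivity
  refine max_le ?_ ?_
  · rw [div_le_iff₀ (by linarith)]; nlinarith
  · unfold varEst offset
    have h1 : clip 0 ((M.H : ℝ) ^ 2) (phiV M.φ (fun x => V x ^ 2) s a ⬝ᵥ R.thetaTilde h) ≤
      (M.H : ℝ) ^ 2 := (clip_mem hH _).2
    have h2 := sq_nonneg (clip 0 (M.H : ℝ) (phiV M.φ V s a ⬝ᵥ R.thetaHat h))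
    have h3 := min_le_left ((M.H : ℝ) ^ 2) (betaTilde d M.H M.B p k *
      wnorm (R.sigTilde h)⁻¹ (phiV M.φ (fun x => V x ^ 2) s a))
    have h4 := min_le_left ((M.H : ℝ) ^ 2) (2 * M.H * betaCheck d M.H M.B p k *
      wnorm (R.sigHat h)⁻¹ (phiV M.φ V s a))
    linarith

end Confidence

lemma min_mul_le {a b c w : ℝ} (ha : a ≤ c) (hb : b ≤ c) (hw : 0 ≤ w) :
    min a (b * w) ≤ c * min 1 w := by
  rcases le_total 1 w with h | h
  · rw [min_eq_left h]; exact (min_le_left _ _).trans (by linarith)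
  · rw [min_eq_right h]; exact (min_le_right _ _).trans (mul_le_mul_of_nonneg_right hb hw)

/-! ### The logarithmic factor -/

/-- The confidence radii and the other logarithmic quantities in terms of one factor `L`. -/
structure LogBounds (d H K nA : ℕ) (B δ L : ℝ) (p : Params) : Prop where
  one_le : 1 ≤ L
  betaHat_le : ∀ k ∈ Set.Icc 1 K, betaHat d H B p k ≤ 41 * Real.sqrt d * L
  betaCheck_le : ∀ k ∈ Set.Icc 1 K, betaCheck d H B p k ≤ 41 * d * L
  betaTilde_le : ∀ k ∈ Set.Icc 1 K, betaTilde d H B p k ≤ 57 * H ^ 2 * Real.sqrt d * L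
  log_hat_le : Real.log (1 + (K + 1 : ℕ) * d / (d * p.lam)) ≤ 6 * L
  log_tilde_le : Real.log (1 + (K + 1 : ℕ) * (H : ℝ) ^ 4 / (d * p.lam)) ≤ 6 * L
  log_azuma_le : Real.log (4 * H / δ) ≤ 2 * L
  log_card_mul_le : Real.log (nA * K) ≤ L
  log_card_le : Real.log nA ≤ L

section Radii

variable {d H k : ℕ} {B L : ℝ} {p : Params}

lemma betaHat_le_mul (hd : 1 ≤ d) (hL : 1 ≤ L) (hs : Real.sqrt p.lam * B = 1)
    (h1 : Real.log (1 + k / p.lam) ≤ 2 * L)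
    (h2 : Real.log (8 * H * (k : ℝ) ^ 2 / p.delta) ∈ Set.Icc 0 (4 * L)) :
    betaHat d H B p k ≤ 41 * Real.sqrt d * L := by
  have hd' : (1 : ℝ) ≤ d := by exact_mod_cast hd
  have hsd : 1 ≤ Real.sqrt d := Real.one_le_sqrt.2 hd'
  have hsdL : 1 * 1 ≤ Real.sqrt d * L := by gcongr
  have r : Real.sqrt (d * Real.log (1 + k / p.lam) * Real.log (8 * H * k ^ 2 / p.delta)) ≤
      3 * (Real.sqrt d * L) := by
    refine Real.sqrt_le_iff.2 ⟨by positivity, ?_⟩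
    rw [mul_pow, mul_pow, Real.sq_sqrt (by linarith)]
    calc _ ≤ d * (2 * L) * (4 * L) :=
          mul_le_mul (mul_le_mul_of_nonneg_left h1 (by linarith)) h2.2 h2.1 (by positivity)
      _ ≤ _ := by nlinarith [mul_nonneg (by linarith : (0 : ℝ) ≤ d) (sq_nonneg L)]
  have r2 := mul_le_mul_of_nonneg_left h2.2 (by positivity : 0 ≤ 4 * Real.sqrt d)
  unfold betaHat
  rw [hs]
  linarith

lemma betaCheck_le_mul (hd : 1 ≤ d) (hL : 1 ≤ L) (hs : Real.sqrt p.lam * B = 1)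
    (h1 : Real.log (1 + k / p.lam) ≤ 2 * L)
    (h2 : Real.log (8 * H * (k : ℝ) ^ 2 / p.delta) ∈ Set.Icc 0 (4 * L)) :
    betaCheck d H B p k ≤ 41 * d * L := by
  have hd' : (1 : ℝ) ≤ d := by exact_mod_cast hd
  have hsdd : Real.sqrt d ≤ d := by
    rw [Real.sqrt_le_left (by linarith)]; nlinarith
  have hdL : 1 * 1 ≤ (d : ℝ) * L := by gcongr
  have r : Real.sqrt (Real.log (1 + k / p.lam) * Real.log (8 * H * k ^ 2 / p.delta)) ≤ 3 * L := by
    refine Real.sqrt_le_iff.2 ⟨by positivity, ?_⟩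
    calc _ ≤ (2 * L) * (4 * L) := mul_le_mul h1 h2.2 h2.1 (by positivity)
      _ ≤ _ := by nlinarith [sq_nonneg L]
  have r1 := mul_le_mul_of_nonneg_left r (by positivity : (0 : ℝ) ≤ 8 * d)
  have r2 := mul_le_mul_of_nonneg_left h2.2 (by positivity : 0 ≤ 4 * Real.sqrt d)
  have r3 : Real.sqrt d * L ≤ d * L := by gcongr
  unfold betaCheck
  rw [hs]
  linarith

lemma betaTilde_le_mul (hd : 1 ≤ d) (hH : 1 ≤ H) (hL : 1 ≤ L) (hs : Real.sqrt p.lam * B = 1)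
    (h1 : Real.log (1 + k * (H : ℝ) ^ 4 / (d * p.lam)) ≤ 6 * L)
    (h2 : Real.log (8 * H * (k : ℝ) ^ 2 / p.delta) ∈ Set.Icc 0 (4 * L)) :
    betaTilde d H B p k ≤ 57 * H ^ 2 * Real.sqrt d * L := by
  have hd' : (1 : ℝ) ≤ d := by exact_mod_cast hd
  have hH' : (1 : ℝ) ≤ H := by exact_mod_cast hH
  have hsd : 1 ≤ Real.sqrt d := Real.one_le_sqrt.2 hd'
  have r : Real.sqrt (d * Real.log (1 + k * (H : ℝ) ^ 4 / (d * p.lam)) *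
      Real.log (8 * H * k ^ 2 / p.delta)) ≤ 5 * (Real.sqrt d * L) := by
    refine Real.sqrt_le_iff.2 ⟨by positivity, ?_⟩
    rw [mul_pow, mul_pow, Real.sq_sqrt (by linarith)]
    calc _ ≤ d * (6 * L) * (4 * L) :=
          mul_le_mul (mul_le_mul_of_nonneg_left h1 (by linarith)) h2.2 h2.1 (by positivity)
      _ ≤ _ := by nlinarith [mul_nonneg (by linarith : (0 : ℝ) ≤ d) (sq_nonneg L)]
  have r1 := mul_le_mul_of_nonneg_left r (by positivity : (0 : ℝ) ≤ 8 * H ^ 2)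
  have r2 := mul_le_mul_of_nonneg_left h2.2 (by positivity : (0 : ℝ) ≤ 4 * (H : ℝ) ^ 2)
  have h2 : (1 : ℝ) ≤ (H : ℝ) ^ 2 := one_le_pow₀ hH'
  have r3 : (H : ℝ) ^ 2 * (1 * L) ≤ H ^ 2 * (Real.sqrt d * L) := by gcongr
  have r4 : 1 * (1 * 1) ≤ (H : ℝ) ^ 2 * (Real.sqrt d * L) := by gcongr
  unfold betaTilde
  rw [hs]
  linarith

end Radii

set_option maxHeartbeats 400000 in
lemma logBounds {d H K nA : ℕ} {B δ : ℝ} {p : Params} (hd : 1 ≤ d) (hH : 1 ≤ H) (hK : 2 ≤ K)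
    (hA : 1 ≤ nA) (hB : 1 ≤ B) (hδ : 0 < δ) (hδ1 : δ < 1) (hlam : p.lam = 1 / B ^ 2)
    (hpδ : p.delta = δ) : LogBounds d H K nA B δ (logFactor d H K nA B δ) p := by
  have hd' : (1 : ℝ) ≤ d := by exact_mod_cast hd
  have hH' : (1 : ℝ) ≤ H := by exact_mod_cast hH
  have hK' : (2 : ℝ) ≤ K := by exact_mod_cast hK
  have hA' : (1 : ℝ) ≤ nA := by exact_mod_cast hA
  set y := d * H * K * nA * B / δ with hy
  set L := logFactor d H K nA B δ with hL
  have hLy : L = Real.log (2 + y) := rfl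
  have hprod : ∀ {a b c e f : ℝ}, 0 ≤ a → a ≤ d → 0 ≤ b → b ≤ H → 0 ≤ c → c ≤ K → 0 ≤ e → e ≤ nA →
      0 ≤ f → f ≤ B → a * b * c * e * f ≤ y := by
    intro a b c e f a0 a1 b0 b1 c0 c1 e0 e1 f0 f1
    calc a * b * c * e * f ≤ d * H * K * nA * B := by gcongr
      _ ≤ y := by
        rw [hy, le_div_iff₀ hδ]
        have : 0 ≤ d * H * K * nA * B := by positivity
        nlinarith
  have hy2 : 2 ≤ y := by
    have := hprod (by norm_num) hd' (by norm_num) hH' (by norm_num) hK' (by norm_num) hA'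
      (by norm_num) hB
    linarith
  have hlog : ∀ (n : ℕ) {x : ℝ}, 0 < x → x ≤ (2 + y) ^ n → Real.log x ≤ n * L := by
    intro n x hx h
    rw [hLy, ← Real.log_pow]
    exact Real.log_le_log hx h
  have hL1 : 1 ≤ L := by
    rw [hLy, Real.le_log_iff_exp_le (by linarith)]
    linarith [Real.exp_one_lt_d9]
  have hKB : K * B ≤ y := by
    have := hprod (by norm_num) hd' (by norm_num) hH' (by linarith) le_rfl (by norm_num) hA'
      (by linarith) le_rfl
    linarith
  have hHKB : H * K * B ≤ y := by
    have := hprod (by norm_num) hd' (by linarith) le_rfl (by linarith) le_rfl (by norm_num) hA'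
      (by linarith) le_rfl
    linarith
  have hlog1 : ∀ n : ℕ, (n : ℝ) ≤ K + 1 → Real.log (1 + n / p.lam) ≤ 2 * L := by
    intro n hn
    rw [hlam, div_div_eq_mul_div, div_one]
    refine (hlog 2 (by positivity) ?_).trans_eq (by norm_num)
    have h1 : (n : ℝ) * B ^ 2 ≤ (K * B) ^ 2 := by
      rw [mul_pow]; gcongr; nlinarith
    have h2 : ((K : ℝ) * B) ^ 2 ≤ y ^ 2 := by gcongr
    nlinarith
  have hlog2 : ∀ n : ℕ, (n : ℝ) ≤ K + 1 →
      Real.log (1 + n * (H : ℝ) ^ 4 / (d * p.lam)) ≤ 6 * L := by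
    intro n hn
    have h0 : n * (H : ℝ) ^ 4 / (d * p.lam) ≤ y ^ 4 := by
      rw [hlam]
      calc n * (H : ℝ) ^ 4 / (d * (1 / B ^ 2)) ≤ n * (H : ℝ) ^ 4 / (1 * (1 / B ^ 2)) := by gcongr
        _ = n * H ^ 4 * B ^ 2 := by field_simp
        _ ≤ K ^ 4 * H ^ 4 * B ^ 4 := by
            gcongr ?_ * _ * ?_
            · have : (2 : ℝ) ^ 2 ≤ (K : ℝ) ^ 2 := by gcongr
              nlinarith
            · exact pow_le_pow_right₀ hB (by norm_num)
        _ = (H * K * B) ^ 4 := by ring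
        _ ≤ y ^ 4 := by gcongr
    have hlp : 0 < p.lam := by rw [hlam]; positivity
    refine (hlog 6 (by positivity) ?_).trans_eq (by norm_num)
    have h1 : (2 + y) ^ 6 = (2 + y) ^ 2 * (2 + y) ^ 4 := by ring
    have h2 : y ^ 4 ≤ (2 + y) ^ 4 := by gcongr; linarith
    have h3 : (1 : ℝ) ≤ (2 + y) ^ 4 := one_le_pow₀ (by linarith)
    have h4 : (2 : ℝ) ≤ (2 + y) ^ 2 := by nlinarith
    rw [h1]
    nlinarith
  have hlog3 : ∀ n ∈ Set.Icc 1 K, Real.log (8 * H * (n : ℝ) ^ 2 / p.delta) ∈ Set.Icc 0 (4 * L) := by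
    intro n hn
    have hn1 : (1 : ℝ) ≤ n := by exact_mod_cast hn.1
    have hn2 : (n : ℝ) ≤ K := by exact_mod_cast hn.2
    rw [hpδ]
    refine ⟨Real.log_nonneg ?_, ?_⟩
    · rw [le_div_iff₀ hδ]
      nlinarith [one_le_pow₀ hn1 (n := 2)]
    refine (hlog 4 (by positivity) ?_).trans_eq (by norm_num)
    have h1 : H * K / δ ≤ y := by
      rw [hy]
      refine div_le_div_of_nonneg_right ?_ hδ.le
      calc (H : ℝ) * K = 1 * H * K * 1 * 1 := by ring
        _ ≤ d * H * K * nA * B := by gcongr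
    have h2 : 8 * H * (n : ℝ) ^ 2 / δ ≤ 8 * y ^ 2 := by
      calc 8 * H * (n : ℝ) ^ 2 / δ ≤ 8 * (H * H) * K ^ 2 / (δ * δ) := by
            gcongr
            · nlinarith
            · nlinarith
        _ = 8 * (H * K / δ) ^ 2 := by field_simp
        _ ≤ 8 * y ^ 2 := by gcongr
    have e : (2 + y) ^ 4 = y ^ 4 + 8 * y ^ 3 + 24 * y ^ 2 + 32 * y + 16 := by ring
    have p2 : 0 ≤ y ^ 2 := by positivity
    have p3 : 0 ≤ y ^ 3 := by positivity
    have p4 : 0 ≤ y ^ 4 := by positivity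
    linarith
  have hs : Real.sqrt p.lam * B = 1 := by
    rw [hlam, Real.sqrt_div zero_le_one, Real.sqrt_one, Real.sqrt_sq (by linarith)]
    field_simp
  have hnK : ∀ n ∈ Set.Icc 1 K, (n : ℝ) ≤ K + 1 := fun n hn => by
    have : (n : ℝ) ≤ K := by exact_mod_cast hn.2
    linarith
  have hlp : 0 < p.lam := by rw [hlam]; positivity
  refine ⟨hL1, fun k hk => ?_, fun k hk => ?_, fun k hk => ?_, ?_,
    hlog2 (K + 1) (by push_cast; rfl),
    ?_, ?_, ?_⟩
  · exact betaHat_le_mul hd hL1 hs (hlog1 k (hnK k hk)) (hlog3 k hk)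
  · exact betaCheck_le_mul hd hL1 hs (hlog1 k (hnK k hk)) (hlog3 k hk)
  · exact betaTilde_le_mul hd hH hL1 hs (hlog2 k (hnK k hk)) (hlog3 k hk)
  · have e : ((K + 1 : ℕ) : ℝ) * d / (d * p.lam) = (K + 1 : ℕ) / p.lam := by field_simp
    rw [e]
    exact (hlog1 (K + 1) (by push_cast; rfl)).trans (by linarith)
  · refine (hlog 2 (by positivity) ?_).trans_eq (by norm_num)
    have h1 : H / δ ≤ y := by
      rw [hy]
      refine div_le_div_of_nonneg_right ?_ hδ.le
      calc (H : ℝ) = 1 * H * 1 * 1 * 1 := by ring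
        _ ≤ d * H * K * nA * B := by gcongr; linarith
    have e : 4 * (H : ℝ) / δ = 4 * (H / δ) := by ring
    rw [e]
    nlinarith
  · have := hprod (by norm_num) hd' (by norm_num) hH' (by linarith) le_rfl (by linarith) le_rfl
      (by norm_num) hB
    have := hlog 1 (x := nA * K) (by positivity) (by linarith)
    simpa using this
  · have := hprod (by norm_num) hd' (by norm_num) hH' (by norm_num : (0:ℝ) ≤ 1) (by linarith)
      (by linarith) le_rfl (by norm_num) hB
    have := hlog 1 (x := nA) (by positivity) (by linarith)
    simpa using this

/-! ### The regression along a run, for one signal -/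

/-- What concerns one of the two signals `r`, `g` in a run: the signal, the policies, the regression
statistics, and the observed states and actions, indexed by the episode. -/
structure SignalTrace (S A : Type*) (d : ℕ) where
  signal : ℕ → ℕ → S → A → ℝ
  policy : ℕ → ℕ → S → A → ℝ
  ridge : ℕ → Ridge d
  state : ℕ → ℕ → S
  act : ℕ → ℕ → A

namespace SignalTrace

variable {S A : Type*} [Fintype S] [Fintype A] {d : ℕ}

/-- `V_{k,h}` -/
noncomputable def est (T : SignalTrace S A d) (M : LinearMixtureCMDP S A d) (p : Params)
    (k h : ℕ) : S → ℝ :=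
  vEst M.toKnownModel p k (T.ridge k) (T.signal k) (T.policy k) h

/-- The value of the policy `π^k`. -/
noncomputable def trueValue (T : SignalTrace S A d) (M : LinearMixtureCMDP S A d)
    (k h : ℕ) : S → ℝ :=
  value M (T.signal k) (T.policy k) h

/-- `φ_V(s_h^k,a_h^k)` for `V = V_{k,h+1}`. -/
noncomputable def feat (T : SignalTrace S A d) (M : LinearMixtureCMDP S A d) (p : Params)
    (k h : ℕ) : Fin d → ℝ :=
  phiV M.φ (T.est M p k (h + 1)) (T.state k h) (T.act k h)

/-- `φ_{V²}(s_h^k,a_h^k)` for `V = V_{k,h+1}`. -/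
noncomputable def featSq (T : SignalTrace S A d) (M : LinearMixtureCMDP S A d) (p : Params)
    (k h : ℕ) : Fin d → ℝ :=
  phiV M.φ (fun x => T.est M p k (h + 1) x ^ 2) (T.state k h) (T.act k h)

/-- `σ̄_{k,h}²` -/
noncomputable def weight (T : SignalTrace S A d) (M : LinearMixtureCMDP S A d) (p : Params)
    (k h : ℕ) : ℝ :=
  sigmaSq M.toKnownModel p k (T.ridge k) h (T.est M p k (h + 1)) (T.state k h) (T.act k h)

/-- The normalized feature `σ̄⁻¹ φ_V(s_h^k,a_h^k)`. -/
noncomputable def normFeat (T : SignalTrace S A d) (M : LinearMixtureCMDP S A d) (p : Params)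
    (k h : ℕ) : Fin d → ℝ :=
  (Real.sqrt (T.weight M p k h))⁻¹ • T.feat M p k h

/-- The noise of the normalized regression, as a function of the next state. -/
noncomputable def noise (T : SignalTrace S A d) (M : LinearMixtureCMDP S A d) (p : Params)
    (k h : ℕ) (t : S) : ℝ :=
  (Real.sqrt (T.weight M p k h))⁻¹ *
    (T.est M p k (h + 1) t - M.next h (T.est M p k (h + 1)) (T.state k h) (T.act k h))

/-- The noise of the second-moment regression, as a function of the next state. -/
noncomputable def noiseSq (T : SignalTrace S A d) (M : LinearMixtureCMDP S A d) (p : Params)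
    (k h : ℕ) (t : S) : ℝ :=
  T.est M p k (h + 1) t ^ 2 -
    M.next h (fun x => T.est M p k (h + 1) x ^ 2) (T.state k h) (T.act k h)

/-- `ℓ_h + P_h V_{h+1}` for the value `V` of the policy `π^k`. -/
noncomputable def trueQ (T : SignalTrace S A d) (M : LinearMixtureCMDP S A d) (k h : ℕ) (s : S)
    (a : A) : ℝ :=
  T.signal k h s a + M.next h (T.trueValue M k (h + 1)) s a

/-- The error of the `Q`-estimate at `s_h^k`, as a function of the action. -/
noncomputable def qErr (T : SignalTrace S A d) (M : LinearMixtureCMDP S A d) (p : Params)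
    (k h : ℕ) (a : A) : ℝ :=
  qEst M.toKnownModel p k (T.ridge k) (T.signal k) (T.policy k) h (T.state k h) a -
    T.trueQ M k h (T.state k h) a

/-- The deviation `E f - f(a_h^k)` of `f = f_k` at the action. -/
noncomputable def actDev (T : SignalTrace S A d) (f : ℕ → A → ℝ) (k h : ℕ) : ℝ :=
  ∑ a, T.policy k h (T.state k h) a * f k a - f k (T.act k h)

/-- The deviation `E f - f(s_{h+1}^k)` of `f = f_k` at the next state. -/
noncomputable def stateDev (T : SignalTrace S A d) (M : LinearMixtureCMDP S A d) (f : ℕ → S → ℝ)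
    (k h : ℕ) : ℝ :=
  M.next h (f k) (T.state k h) (T.act k h) - f k (T.state k (h + 1))

/-- The statistics arise by the updates of the algorithm. -/
structure IsRegression (T : SignalTrace S A d) (M : LinearMixtureCMDP S A d) (p : Params) (K : ℕ) :
    Prop where
  signal_mem : ∀ k ∈ Set.Icc 1 K, ∀ h ∈ Set.Icc 1 M.H, ∀ s a,
    T.signal k h s a ∈ Set.Icc (0 : ℝ) 1
  policy_mem : ∀ k ∈ Set.Icc 1 K, IsPolicyUpTo M.H (T.policy k)
  init : T.ridge 1 = ⟨fun _ => p.lam • 1, fun _ => 0, fun _ => p.lam • 1, fun _ => 0⟩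
  succ : ∀ k, 1 ≤ k → T.ridge (k + 1) = (T.ridge k).next M.toKnownModel p k (T.est M p k)
    (T.state k) (T.act k)

/-- The event on which the estimates of one signal are accurate: the noises of the regressions obey
their Bernstein bounds, for the normalized regression both with the trivial variance bound `d` and
with the variance bound `1`, provided that the latter is valid; and the four martingales that
compare expectations with observed values are small. -/
structure IsTypical (T : SignalTrace S A d) (M : LinearMixtureCMDP S A d) (p : Params) (K : ℕ)
    (δ ln : ℝ) : Prop where
  check : ∀ h ∈ Set.Icc 1 M.H, ∀ k ∈ Set.Icc 1 K,
    wnorm (gram p.lam (fun i => T.normFeat M p i h) k)⁻¹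
      (∑ i ∈ Finset.Ico 1 k, T.noise M p i h (T.state i (h + 1)) • T.normFeat M p i h) ≤
        bernsteinRadius d p.lam d (Real.sqrt d) (Real.sqrt d) δ k
  tilde : ∀ h ∈ Set.Icc 1 M.H, ∀ k ∈ Set.Icc 1 K,
    wnorm (gram p.lam (fun i => T.featSq M p i h) k)⁻¹
      (∑ i ∈ Finset.Ico 1 k, T.noiseSq M p i h (T.state i (h + 1)) • T.featSq M p i h) ≤
        bernsteinRadius d p.lam ((M.H : ℝ) ^ 4) ((M.H : ℝ) ^ 2) ((M.H : ℝ) ^ 2) δ k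
  hat : ∀ h ∈ Set.Icc 1 M.H, ∀ k ∈ Set.Icc 1 K,
    (∀ i ∈ Finset.Ico 1 k,
      ∑ t, M.P h (T.state i h) (T.act i h) t * T.noise M p i h t ^ 2 ≤ 1 ^ 2) →
    wnorm (gram p.lam (fun i => T.normFeat M p i h) k)⁻¹
      (∑ i ∈ Finset.Ico 1 k, T.noise M p i h (T.state i (h + 1)) • T.normFeat M p i h) ≤
        bernsteinRadius d p.lam d 1 (Real.sqrt d) δ k
  act_qErr : ∀ h ∈ Set.Icc 1 M.H, ∑ k ∈ Finset.Icc 1 K, T.actDev (fun k => T.qErr M p k h) k h ≤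
    6 * M.H * Real.sqrt K * ln
  act_sq : ∀ h ∈ Set.Icc 1 M.H, ∑ k ∈ Finset.Icc 1 K,
    T.actDev (fun k a => T.trueQ M k h (T.state k h) a ^ 2) k h ≤ 6 * M.H ^ 2 * Real.sqrt K * ln
  state_err : ∀ h ∈ Set.Icc 1 M.H, ∑ k ∈ Finset.Icc 1 K, T.stateDev M
    (fun k t => T.est M p k (h + 1) t - T.trueValue M k (h + 1) t) k h ≤
      6 * M.H * Real.sqrt K * ln
  state_sq : ∀ h ∈ Set.Icc 1 M.H, ∑ k ∈ Finset.Icc 1 K, T.stateDev M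
    (fun k t => T.trueValue M k (h + 1) t ^ 2) k h ≤ 6 * M.H ^ 2 * Real.sqrt K * ln

variable {T : SignalTrace S A d} {M : LinearMixtureCMDP S A d} {p : Params} {K : ℕ}

lemma succ_mem {H h : ℕ} (hh : h ∈ Set.Icc 1 H) : h + 1 ∈ Set.Icc 1 (H + 1) :=
  ⟨by omega, by have := hh.2; omega⟩

lemma weight_pos (hd : 1 ≤ d) (hH : 1 ≤ M.H) (k h : ℕ) : 0 < T.weight M p k h := by
  have hd' : (1 : ℝ) ≤ d := by exact_mod_cast hd
  have hH' : (1 : ℝ) ≤ M.H := by exact_mod_cast hH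
  exact lt_of_lt_of_le (by positivity) (le_sigmaSq _ _ _ _ _ _ _ _)

lemma le_sqrt_weight (hd : 1 ≤ d) (k h : ℕ) :
    (M.H : ℝ) ≤ Real.sqrt d * Real.sqrt (T.weight M p k h) := by
  have hd' : (1 : ℝ) ≤ d := by exact_mod_cast hd
  rw [← Real.sqrt_mul (by linarith)]
  refine Real.le_sqrt_of_sq_le ?_
  have h1 : (M.H : ℝ) ^ 2 / d ≤ T.weight M p k h := le_sigmaSq _ _ _ _ _ _ _ _
  rwa [div_le_iff₀ (by linarith), mul_comm] at h1

section Regression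

variable (hT : T.IsRegression M p K)
include hT

lemma IsRegression.est_mem {k : ℕ} (hk : k ∈ Set.Icc 1 K) {h : ℕ}
    (hh : h ∈ Set.Icc 1 (M.H + 1)) (s : S) :
    T.est M p k h s ∈ Set.Icc (0 : ℝ) ((M.H : ℝ) + 1 - h) :=
  vEst_mem (hT.policy_mem k hk) hh s

lemma IsRegression.est_le_H {k : ℕ} (hk : k ∈ Set.Icc 1 K) {h : ℕ}
    (hh : h ∈ Set.Icc 1 (M.H + 1)) (s : S) : T.est M p k h s ∈ Set.Icc (0 : ℝ) M.H :=
  vEst_le_H (hT.policy_mem k hk) hh s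

lemma IsRegression.trueValue_mem {k : ℕ} (hk : k ∈ Set.Icc 1 K) {h : ℕ}
    (hh : h ∈ Set.Icc 1 (M.H + 1)) (s : S) :
    T.trueValue M k h s ∈ Set.Icc (0 : ℝ) ((M.H : ℝ) + 1 - h) :=
  value_mem (hT.policy_mem k hk) (hT.signal_mem k hk) h hh s

lemma IsRegression.trueQ_mem {k : ℕ} (hk : k ∈ Set.Icc 1 K) {h : ℕ} (hh : h ∈ Set.Icc 1 M.H)
    (s : S) (a : A) : T.trueQ M k h s a ∈ Set.Icc (0 : ℝ) M.H := by
  have h1 := M.next_mem hh (hT.trueValue_mem hk (succ_mem hh)) s a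
  have h2 := hT.signal_mem k hk h hh s a
  have h3 : (1 : ℝ) ≤ h := by exact_mod_cast hh.1
  push_cast at h1
  unfold trueQ
  exact ⟨by linarith [h1.1, h2.1], by linarith [h1.2, h2.2]⟩

lemma IsRegression.est_sq_mem {k : ℕ} (hk : k ∈ Set.Icc 1 K) {h : ℕ}
    (hh : h ∈ Set.Icc 1 (M.H + 1)) (s : S) :
    T.est M p k h s ^ 2 ∈ Set.Icc (0 : ℝ) ((M.H : ℝ) ^ 2) :=
  ⟨sq_nonneg _, pow_le_pow_left₀ (hT.est_le_H hk hh s).1 (hT.est_le_H hk hh s).2 2⟩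

lemma IsRegression.normFeat_le (hd : 1 ≤ d) (hH : 1 ≤ M.H) {k : ℕ} (hk : k ∈ Set.Icc 1 K) {h : ℕ}
    (hh : h ∈ Set.Icc 1 M.H) : T.normFeat M p k h ⬝ᵥ T.normFeat M p k h ≤ d := by
  have hH' : (0 : ℝ) < M.H := by exact_mod_cast hH
  have hd' : (1 : ℝ) ≤ d := by exact_mod_cast hd
  have h1 := phiV_dotProduct_self_le M hH' (hT.est_le_H hk (succ_mem hh)) (T.state k h) (T.act k h)
  have hw := weight_pos (T := T) (p := p) hd hH k h
  have h2 : (M.H : ℝ) ^ 2 / d ≤ T.weight M p k h := le_sigmaSq _ _ _ _ _ _ _ _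
  rw [div_le_iff₀ (by linarith)] at h2
  unfold normFeat feat
  rw [dotProduct_smul, smul_dotProduct, smul_eq_mul, smul_eq_mul, ← mul_assoc, ← mul_inv,
    Real.mul_self_sqrt hw.le, inv_mul_le_iff₀ hw]
  linarith

lemma IsRegression.featSq_le (hH : 1 ≤ M.H) {k : ℕ} (hk : k ∈ Set.Icc 1 K) {h : ℕ}
    (hh : h ∈ Set.Icc 1 M.H) : T.featSq M p k h ⬝ᵥ T.featSq M p k h ≤ (M.H : ℝ) ^ 4 := by
  have hH' : (0 : ℝ) < M.H := by exact_mod_cast hH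
  have h1 := phiV_dotProduct_self_le M (by positivity) (hT.est_sq_mem hk (succ_mem hh))
    (T.state k h) (T.act k h)
  refine h1.trans (le_of_eq (by ring))

lemma IsRegression.abs_noise_le (hd : 1 ≤ d) (hH : 1 ≤ M.H) {k : ℕ} (hk : k ∈ Set.Icc 1 K) {h : ℕ}
    (hh : h ∈ Set.Icc 1 M.H) (t : S) : |T.noise M p k h t| ≤ Real.sqrt d := by
  have hw := Real.sqrt_pos.2 (weight_pos (T := T) (p := p) hd hH k h)
  have h1 := hT.est_le_H hk (succ_mem hh) t
  have h2 := M.next_mem hh (hT.est_le_H hk (succ_mem hh)) (T.state k h) (T.act k h)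
  have h3 := le_sqrt_weight (T := T) (M := M) (p := p) hd k h
  unfold noise
  rw [abs_mul, abs_of_pos (inv_pos.2 hw), inv_mul_le_iff₀ hw, mul_comm, abs_le]
  constructor <;> linarith [h1.1, h1.2, h2.1, h2.2]

lemma IsRegression.abs_noiseSq_le {k : ℕ} (hk : k ∈ Set.Icc 1 K) {h : ℕ}
    (hh : h ∈ Set.Icc 1 M.H) (t : S) : |T.noiseSq M p k h t| ≤ (M.H : ℝ) ^ 2 := by
  have h1 := hT.est_sq_mem hk (succ_mem hh) t
  have h2 := M.next_mem hh (hT.est_sq_mem hk (succ_mem hh)) (T.state k h) (T.act k h)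
  unfold noiseSq
  rw [abs_le]
  constructor <;> linarith [h1.1, h1.2, h2.1, h2.2]

omit hT in
lemma sum_mul_noise {h : ℕ} (hh : h ∈ Set.Icc 1 M.H) (k : ℕ) :
    ∑ t, M.P h (T.state k h) (T.act k h) t * T.noise M p k h t = 0 := by
  unfold noise
  simp only [mul_left_comm _ (_⁻¹), mul_sub, Finset.sum_sub_distrib, ← Finset.mul_sum,
    ← Finset.sum_mul, (M.P_mem hh _ _).2]
  unfold LinearMixtureCMDP.next
  ring

omit hT in
lemma sum_mul_noiseSq {h : ℕ} (hh : h ∈ Set.Icc 1 M.H) (k : ℕ) :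
    ∑ t, M.P h (T.state k h) (T.act k h) t * T.noiseSq M p k h t = 0 := by
  unfold noiseSq
  simp only [mul_sub, Finset.sum_sub_distrib, ← Finset.sum_mul, (M.P_mem hh _ _).2]
  unfold LinearMixtureCMDP.next
  ring

lemma IsRegression.sigHat_eq (hd : 1 ≤ d) (hH : 1 ≤ M.H) {k : ℕ} (hk : 1 ≤ k) (h : ℕ) :
    (T.ridge k).sigHat h = gram p.lam (fun i => T.normFeat M p i h) k := by
  induction k, hk using Nat.le_induction with
  | base => rw [hT.init]; simp [gram]
  | succ k hk ih =>
    have hw := weight_pos (T := T) (p := p) hd hH k h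
    rw [hT.succ k hk, gram_succ _ _ hk, ← ih]
    have e : Matrix.vecMulVec (T.normFeat M p k h) (T.normFeat M p k h) =
        (T.weight M p k h)⁻¹ • Matrix.vecMulVec (T.feat M p k h) (T.feat M p k h) := by
      unfold normFeat
      rw [Matrix.smul_vecMulVec, Matrix.vecMulVec_smul, smul_smul, ← mul_inv,
        Real.mul_self_sqrt hw.le]
    rw [e]
    rfl

lemma IsRegression.sigTilde_eq {k : ℕ} (hk : 1 ≤ k) (h : ℕ) :
    (T.ridge k).sigTilde h = gram p.lam (fun i => T.featSq M p i h) k := by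
  induction k, hk using Nat.le_induction with
  | base => rw [hT.init]; simp [gram]
  | succ k hk ih =>
    rw [hT.succ k hk, gram_succ _ _ hk, ← ih]
    rfl

lemma IsRegression.bHat_eq (hd : 1 ≤ d) (hH : 1 ≤ M.H) {k : ℕ} (hk : 1 ≤ k) {h : ℕ}
    (hh : h ∈ Set.Icc 1 M.H) : (T.ridge k).bHat h = ∑ i ∈ Finset.Ico 1 k,
      (T.normFeat M p i h ⬝ᵥ M.θstar h + T.noise M p i h (T.state i (h + 1))) •
        T.normFeat M p i h := by
  induction k, hk using Nat.le_induction with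
  | base => rw [hT.init]; simp
  | succ k hk ih =>
    have hw := weight_pos (T := T) (p := p) hd hH k h
    rw [hT.succ k hk, Finset.sum_Ico_succ_top hk, ← ih]
    have e : (T.normFeat M p k h ⬝ᵥ M.θstar h + T.noise M p k h (T.state k (h + 1))) •
        T.normFeat M p k h =
        ((T.weight M p k h)⁻¹ * T.est M p k (h + 1) (T.state k (h + 1))) • T.feat M p k h := by
      unfold normFeat noise
      rw [smul_dotProduct, smul_eq_mul, feat, ← M.next_eq_dotProduct hh, ← mul_add, smul_smul]
      congr 1
      rw [show (T.weight M p k h)⁻¹ = (Real.sqrt (T.weight M p k h))⁻¹ *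
        (Real.sqrt (T.weight M p k h))⁻¹ by rw [← mul_inv, Real.mul_self_sqrt hw.le]]
      ring
    rw [e]
    rfl

lemma IsRegression.bTilde_eq {k : ℕ} (hk : 1 ≤ k) {h : ℕ} (hh : h ∈ Set.Icc 1 M.H) :
    (T.ridge k).bTilde h = ∑ i ∈ Finset.Ico 1 k,
      (T.featSq M p i h ⬝ᵥ M.θstar h + T.noiseSq M p i h (T.state i (h + 1))) •
        T.featSq M p i h := by
  induction k, hk using Nat.le_induction with
  | base => rw [hT.init]; simp
  | succ k hk ih =>
    rw [hT.succ k hk, Finset.sum_Ico_succ_top hk, ← ih]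
    have e : (T.featSq M p k h ⬝ᵥ M.θstar h + T.noiseSq M p k h (T.state k (h + 1))) =
        T.est M p k (h + 1) (T.state k (h + 1)) ^ 2 := by
      unfold noiseSq
      rw [featSq, ← M.next_eq_dotProduct hh]
      ring
    rw [e]
    rfl

end Regression

/-! ### Consequences of accurate regressions -/

section Typical

variable {δ ln : ℝ} (hT : T.IsRegression M p K)
  (hty : T.IsTypical M p K (δ / (2 * M.H)) ln) (hd : 1 ≤ d) (hH : 1 ≤ M.H) (hlam : 0 < p.lam)
  (hδ : p.delta = δ)
include hT hd hH hlam

lemma IsRegression.sigHat_posDef {k : ℕ} (hk : 1 ≤ k) (h : ℕ) :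
    ((T.ridge k).sigHat h).PosDef := by
  rw [hT.sigHat_eq hd hH hk]; exact gram_posDef hlam _ _

omit hd hH in
lemma IsRegression.sigTilde_posDef {k : ℕ} (hk : 1 ≤ k) (h : ℕ) :
    ((T.ridge k).sigTilde h).PosDef := by
  rw [hT.sigTilde_eq hk]; exact gram_posDef hlam _ _

/-- The error of `θ̂` is at most the noise plus the bias of the regularization. -/
lemma IsRegression.thetaHat_sub_le {k : ℕ} (hk : 1 ≤ k) {h : ℕ} (hh : h ∈ Set.Icc 1 M.H) :
    wnorm ((T.ridge k).sigHat h) ((T.ridge k).thetaHat h - M.θstar h) ≤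
      wnorm (gram p.lam (fun i => T.normFeat M p i h) k)⁻¹
        (∑ i ∈ Finset.Ico 1 k, T.noise M p i h (T.state i (h + 1)) • T.normFeat M p i h) +
      Real.sqrt p.lam * M.B := by
  unfold Ridge.thetaHat
  rw [hT.sigHat_eq hd hH hk, hT.bHat_eq hd hH hk hh]
  exact wnorm_ridge_sub_le hlam _ (fun i => T.noise M p i h (T.state i (h + 1))) k _
    (M.norm_θstar_le h hh)

omit hd hH in
lemma IsRegression.thetaTilde_sub_le {k : ℕ} (hk : 1 ≤ k) {h : ℕ} (hh : h ∈ Set.Icc 1 M.H) :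
    wnorm ((T.ridge k).sigTilde h) ((T.ridge k).thetaTilde h - M.θstar h) ≤
      wnorm (gram p.lam (fun i => T.featSq M p i h) k)⁻¹
        (∑ i ∈ Finset.Ico 1 k, T.noiseSq M p i h (T.state i (h + 1)) • T.featSq M p i h) +
      Real.sqrt p.lam * M.B := by
  unfold Ridge.thetaTilde
  rw [hT.sigTilde_eq hk, hT.bTilde_eq hk hh]
  exact wnorm_ridge_sub_le hlam _ (fun i => T.noiseSq M p i h (T.state i (h + 1))) k _
    (M.norm_θstar_le h hh)

include hty hδ

lemma IsTypical.thetaHat_check {k : ℕ} (hk : k ∈ Set.Icc 1 K) {h : ℕ} (hh : h ∈ Set.Icc 1 M.H) :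
    wnorm ((T.ridge k).sigHat h) ((T.ridge k).thetaHat h - M.θstar h) ≤
      betaCheck d M.H M.B p k := by
  refine (hT.thetaHat_sub_le hd hH hlam hk.1 hh).trans ?_
  have h1 := hty.check h hh k hk
  have hd' : (0 : ℝ) < d := by exact_mod_cast hd
  have hH' : (0 : ℝ) < M.H := by exact_mod_cast hH
  have e : bernsteinRadius d p.lam d (Real.sqrt d) (Real.sqrt d) (δ / (2 * M.H)) k =
      8 * d * Real.sqrt (Real.log (1 + k / p.lam) * Real.log (8 * M.H * k ^ 2 / p.delta))
        + 4 * Real.sqrt d * Real.log (8 * M.H * k ^ 2 / p.delta) := by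
    unfold bernsteinRadius
    rw [show (4 : ℝ) * k ^ 2 / (δ / (2 * M.H)) = 8 * M.H * k ^ 2 / p.delta by
        rw [hδ]; field_simp; ring,
      show (k : ℝ) * d / (d * p.lam) = k / p.lam by field_simp, mul_assoc (d : ℝ),
      Real.sqrt_mul hd'.le, mul_assoc 8, ← mul_assoc (Real.sqrt d), Real.mul_self_sqrt hd'.le,
      ← mul_assoc 8]
  rw [e] at h1
  unfold betaCheck
  linarith

omit hd in
lemma IsTypical.thetaTilde_tilde {k : ℕ} (hk : k ∈ Set.Icc 1 K) {h : ℕ} (hh : h ∈ Set.Icc 1 M.H) :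
    wnorm ((T.ridge k).sigTilde h) ((T.ridge k).thetaTilde h - M.θstar h) ≤
      betaTilde d M.H M.B p k := by
  refine (hT.thetaTilde_sub_le hlam hk.1 hh).trans ?_
  have h1 := hty.tilde h hh k hk
  have hH' : (0 : ℝ) < M.H := by exact_mod_cast hH
  unfold bernsteinRadius at h1
  rw [show (4 : ℝ) * k ^ 2 / (δ / (2 * M.H)) = 8 * M.H * k ^ 2 / p.delta by
    rw [hδ]; field_simp; ring] at h1
  unfold betaTilde
  linarith

lemma IsTypical.nextVar_le_weight {k : ℕ} (hk : k ∈ Set.Icc 1 K) {h : ℕ}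
    (hh : h ∈ Set.Icc 1 M.H) :
    nextVar M h (T.est M p k (h + 1)) (T.state k h) (T.act k h) ≤ T.weight M p k h :=
  nextVar_le_sigmaSq hh (hT.sigHat_posDef hd hH hlam hk.1 h) (hT.sigTilde_posDef hlam hk.1 h)
    (hty.thetaHat_check hT hd hH hlam hδ hk hh) (hty.thetaTilde_tilde hT hH hlam hδ hk hh)
    (hT.est_le_H hk (succ_mem hh)) _ _

lemma IsTypical.thetaHat_hat {k : ℕ} (hk : k ∈ Set.Icc 1 K) {h : ℕ} (hh : h ∈ Set.Icc 1 M.H) :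
    wnorm ((T.ridge k).sigHat h) ((T.ridge k).thetaHat h - M.θstar h) ≤
      betaHat d M.H M.B p k := by
  refine (hT.thetaHat_sub_le hd hH hlam hk.1 hh).trans ?_
  have hd' : (0 : ℝ) < d := by exact_mod_cast hd
  have hH' : (0 : ℝ) < M.H := by exact_mod_cast hH
  have h1 := hty.hat h hh k hk fun i hi => by
    have hi' : i ∈ Set.Icc 1 K := by
      rw [Finset.mem_Ico] at hi; exact ⟨hi.1, by have := hk.2; omega⟩
    have hw := weight_pos (T := T) (p := p) hd hH i h
    have e : ∑ t, M.P h (T.state i h) (T.act i h) t * T.noise M p i h t ^ 2 =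
        (T.weight M p i h)⁻¹ *
          nextVar M h (T.est M p i (h + 1)) (T.state i h) (T.act i h) := by
      rw [← nextVar_eq hh, Finset.mul_sum]
      refine Finset.sum_congr rfl fun t _ => ?_
      unfold noise
      rw [mul_pow, inv_pow, Real.sq_sqrt hw.le]
      ring
    rw [e, one_pow, inv_mul_le_iff₀ hw, mul_one]
    exact hty.nextVar_le_weight hT hd hH hlam hδ hi' hh
  unfold bernsteinRadius at h1
  rw [show (4 : ℝ) * k ^ 2 / (δ / (2 * M.H)) = 8 * M.H * k ^ 2 / p.delta by
      rw [hδ]; field_simp; ring,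
    show (k : ℝ) * d / (d * p.lam) = k / p.lam by field_simp] at h1
  unfold betaHat
  linarith

lemma IsTypical.isOptimistic {k : ℕ} (hk : k ∈ Set.Icc 1 K) :
    IsOptimistic M p k (T.ridge k) (T.signal k) (T.policy k) := by
  intro h hh s a
  refine qStep_optimistic hh (hT.sigHat_posDef hd hH hlam hk.1 h)
    (hty.thetaHat_hat hT hd hH hlam hδ hk hh) (fun x => ?_) s a (hT.signal_mem k hk h hh s a)
  have h1 := hT.est_mem hk (succ_mem hh) x
  push_cast at h1
  exact ⟨h1.1, h1.2.trans (by linarith)⟩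

lemma IsTypical.trueValue_le_est {k : ℕ} (hk : k ∈ Set.Icc 1 K) :
    ∀ h ∈ Set.Icc 1 (M.H + 1), ∀ s, T.trueValue M k h s ≤ T.est M p k h s := by
  refine backward_induction (fun s => ?_) fun h hh ih s => ?_
  · unfold trueValue est; rw [value_last, vEst_last]
  · unfold trueValue est
    rw [value_bellman (hT.policy_mem k hk) _ hh, vEst_eq hh]
    refine Finset.sum_le_sum fun a _ => mul_le_mul_of_nonneg_left ?_
      ((hT.policy_mem k hk h hh s).1 a)
    refine le_trans ?_ (hty.isOptimistic hT hd hH hlam hδ hk h hh s a)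
    gcongr
    exact M.next_mono hh ih s a

end Typical

end SignalTrace

namespace SignalTrace

variable {S A : Type*} [Fintype S] [Fintype A] {d : ℕ}
variable {T : SignalTrace S A d} {M : LinearMixtureCMDP S A d} {p : Params} {K : ℕ}

/-! ### The total estimation error of an accurate run -/

lemma wnorm_feat (hd : 1 ≤ d) (hH : 1 ≤ M.H) (Z : Matrix (Fin d) (Fin d) ℝ) (k h : ℕ) :
    wnorm Z (T.feat M p k h) = Real.sqrt (T.weight M p k h) * wnorm Z (T.normFeat M p k h) := by
  have hw := Real.sqrt_pos.2 (weight_pos (T := T) (p := p) hd hH k h)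
  have e : T.feat M p k h = Real.sqrt (T.weight M p k h) • T.normFeat M p k h := by
    unfold normFeat
    rw [smul_smul, mul_inv_cancel₀ hw.ne', one_smul]
  rw [e, wnorm_smul, abs_of_pos hw]

variable {δ L : ℝ} {nA : ℕ}

/-- The elliptical potential bound for both regressions. -/
lemma IsRegression.sum_wnorm_le (hT : T.IsRegression M p K) (hd : 1 ≤ d) (hH : 1 ≤ M.H)
    (hlam : 0 < p.lam) (hL : LogBounds d M.H K nA M.B δ L p) {h : ℕ} (hh : h ∈ Set.Icc 1 M.H) :
    ∑ k ∈ Finset.Icc 1 K, min 1 (wnorm (gram p.lam (fun i => T.normFeat M p i h) k)⁻¹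
        (T.normFeat M p k h)) ^ 2 ≤ 12 * d * L ∧
      ∑ k ∈ Finset.Icc 1 K, min 1 (wnorm (gram p.lam (fun i => T.featSq M p i h) k)⁻¹
        (T.featSq M p k h)) ^ 2 ≤ 12 * d * L := by
  have hmem : ∀ i ∈ Finset.Ico 1 (K + 1), i ∈ Set.Icc 1 K := fun i hi => by
    rw [Finset.mem_Ico] at hi; exact ⟨hi.1, by omega⟩
  have e : Finset.Icc 1 K = Finset.Ico 1 (K + 1) := rfl
  have h1 := sum_min_one_wnorm_le hd hlam (Nat.cast_nonneg d) (by omega : 1 ≤ K + 1)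
    (x := fun i => T.normFeat M p i h) fun i hi => hT.normFeat_le hd hH (hmem i hi) hh
  have h2 := sum_min_one_wnorm_le hd hlam (by positivity : (0 : ℝ) ≤ (M.H : ℝ) ^ 4)
    (by omega : 1 ≤ K + 1)
    (x := fun i => T.featSq M p i h) fun i hi => hT.featSq_le hH (hmem i hi) hh
  have b1 := mul_le_mul_of_nonneg_left hL.log_hat_le (by positivity : (0 : ℝ) ≤ 2 * d)
  have b2 := mul_le_mul_of_nonneg_left hL.log_tilde_le (by positivity : (0 : ℝ) ≤ 2 * d)
  exact ⟨h1.trans (by linarith), h2.trans (by linarith)⟩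

section

variable (hT : T.IsRegression M p K)
  (hty : T.IsTypical M p K (δ / (2 * M.H)) (Real.log (4 * M.H / δ))) (hd : 1 ≤ d) (hH : 1 ≤ M.H)
  (hlam : 0 < p.lam) (hδ : p.delta = δ) (hL : LogBounds d M.H K nA M.B δ L p)
include hT hd hH hL

/-- The bonus in terms of the normalized feature; it is at most `H`, which is at most
`√d σ̄`. -/
lemma IsRegression.bonus_le {k : ℕ} (hk : k ∈ Set.Icc 1 K) (h : ℕ) :
    min (M.H : ℝ) (2 * betaHat d M.H M.B p k *
        wnorm ((T.ridge k).sigHat h)⁻¹ (T.feat M p k h)) ≤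
      82 * Real.sqrt d * L * (Real.sqrt (T.weight M p k h) *
        min 1 (wnorm (gram p.lam (fun i => T.normFeat M p i h) k)⁻¹ (T.normFeat M p k h))) := by
  have hw := Real.sqrt_nonneg (T.weight M p k h)
  rw [wnorm_feat hd hH, ← hT.sigHat_eq hd hH hk.1, ← mul_assoc, ← mul_assoc]
  refine min_mul_le ?_ ?_ (wnorm_nonneg _ _)
  · have h1 := le_sqrt_weight (T := T) (M := M) (p := p) hd k h
    have h2 : 1 * 1 * (Real.sqrt d * Real.sqrt (T.weight M p k h)) ≤
        82 * L * (Real.sqrt d * Real.sqrt (T.weight M p k h)) := by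
      gcongr
      · norm_num
      · exact hL.one_le
    linarith
  · refine mul_le_mul_of_nonneg_right ?_ hw
    linarith [hL.betaHat_le k hk]

lemma IsRegression.offset_le {k : ℕ} (hk : k ∈ Set.Icc 1 K) (h : ℕ) :
    offset M.toKnownModel p k (T.ridge k) h (T.est M p k (h + 1)) (T.state k h) (T.act k h) ≤
      164 * M.H ^ 2 * d * L *
        (min 1 (wnorm (gram p.lam (fun i => T.featSq M p i h) k)⁻¹ (T.featSq M p k h)) +
          min 1 (wnorm (gram p.lam (fun i => T.normFeat M p i h) k)⁻¹ (T.normFeat M p k h))) := by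
  have hd' : (1 : ℝ) ≤ d := by exact_mod_cast hd
  have hL1 := hL.one_le
  have hsdd : Real.sqrt d ≤ d := by
    rw [Real.sqrt_le_left (by linarith)]; nlinarith
  have hH2 : (M.H : ℝ) ^ 2 ≤ 164 * M.H ^ 2 * d * L := by
    calc (M.H : ℝ) ^ 2 = 1 * M.H ^ 2 * 1 * 1 := by ring
      _ ≤ 164 * M.H ^ 2 * d * L := by gcongr; norm_num
  rw [mul_add, ← hT.sigHat_eq hd hH hk.1, ← hT.sigTilde_eq hk.1]
  refine add_le_add (min_mul_le hH2 ?_ (wnorm_nonneg _ _)) ?_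
  · refine (hL.betaTilde_le k hk).trans ?_
    gcongr
    norm_num
  · have hσ : Real.sqrt (T.weight M p k h) ≤ 2 * M.H := by
      refine Real.sqrt_le_iff.2 ⟨by positivity, ?_⟩
      have := sigmaSq_le (p := p) (k := k) (R := T.ridge k) (h := h)
        (V := T.est M p k (h + 1)) M.toKnownModel hd (T.state k h) (T.act k h)
      unfold weight
      nlinarith [sq_nonneg (M.H : ℝ)]
    have e := wnorm_feat (T := T) (p := p) hd hH ((T.ridge k).sigHat h)⁻¹ k h
    unfold feat at e
    rw [e, ← mul_assoc]
    refine min_mul_le hH2 ?_ (wnorm_nonneg _ _)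
    calc 2 * M.H * betaCheck d M.H M.B p k * Real.sqrt (T.weight M p k h) ≤
          2 * M.H * (41 * d * L) * (2 * M.H) := by
          gcongr
          exact hL.betaCheck_le k hk
      _ = _ := by ring

omit hd hH hL in
/-- The variance of the true value of the next state telescopes along the trajectory, up to
martingale differences. -/
lemma IsRegression.nextVar_trueValue_le {k : ℕ} (hk : k ∈ Set.Icc 1 K) {h : ℕ}
    (hh : h ∈ Set.Icc 1 M.H) :
    nextVar M h (T.trueValue M k (h + 1)) (T.state k h) (T.act k h) ≤
      T.trueValue M k (h + 1) (T.state k (h + 1)) ^ 2 - T.trueValue M k h (T.state k h) ^ 2 +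
        2 * M.H + T.stateDev M (fun k t => T.trueValue M k (h + 1) t ^ 2) k h +
        T.actDev (fun k a => T.trueQ M k h (T.state k h) a ^ 2) k h := by
  have h1 : T.trueValue M k h (T.state k h) =
      ∑ a, T.policy k h (T.state k h) a * T.trueQ M k h (T.state k h) a :=
    value_bellman (hT.policy_mem k hk) _ hh _
  have h2 := sq_sum_simplex_le (hT.policy_mem k hk h hh (T.state k h))
    (fun a => T.trueQ M k h (T.state k h) a)
  rw [← h1] at h2
  have h3 := M.next_mem hh (hT.trueValue_mem hk (succ_mem hh)) (T.state k h) (T.act k h)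
  have h4 := hT.signal_mem k hk h hh (T.state k h) (T.act k h)
  have h5 : (1 : ℝ) ≤ h := by exact_mod_cast hh.1
  have h6 : T.trueQ M k h (T.state k h) (T.act k h) ^ 2 ≤
      M.next h (T.trueValue M k (h + 1)) (T.state k h) (T.act k h) ^ 2 + 2 * M.H := by
    unfold trueQ
    push_cast at h3
    nlinarith [h3.1, h3.2, h4.1, h4.2, mul_nonneg h4.1 (sub_nonneg.2 h4.2),
      mul_nonneg h3.1 (sub_nonneg.2 h4.2)]
  unfold nextVar stateDev actDev
  linarith

include hty hlam hδ

/-- On the event of accurate regressions, the total estimation error is of the order of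
`estimationRate`. -/
theorem IsTypical.sum_est_sub_le (hK : d ^ 3 * M.H ^ 3 ≤ K)
    (hs : ∀ k ∈ Set.Icc 1 K, T.state k 1 = M.s₁) :
    ∑ k ∈ Finset.Icc 1 K, (T.est M p k 1 M.s₁ - T.trueValue M k 1 M.s₁) ≤
      180000 * L ^ 4 * estimationRate d M.H K := by
  have hL1 := hL.one_le
  have hmem : ∀ {n i : ℕ}, i ∈ Finset.Icc 1 n → i ∈ Set.Icc 1 n := fun hi => Finset.mem_Icc.1 hi
  have hnoise : ∀ {x c : ℝ}, 0 ≤ c → x ≤ 6 * c * Real.sqrt K * Real.log (4 * M.H / δ) →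
      x ≤ 12 * c * Real.sqrt K * L := by
    intro x c hc hx
    refine hx.trans ?_
    calc _ ≤ 6 * c * Real.sqrt K * (2 * L) := by gcongr; exact hL.log_azuma_le
      _ = _ := by ring
  have hH0 : (0 : ℝ) ≤ M.H := Nat.cast_nonneg _
  rw [Finset.sum_congr rfl fun k hk => by rw [← hs k (hmem hk)]]
  refine sum_estimation_le (H := M.H) (K := K) (d := d) (L := L) hH hd hK hL1
    (D := fun k h => T.est M p k h (T.state k h) - T.trueValue M k h (T.state k h))
    (PD := fun k h => M.next h (fun x => T.est M p k (h + 1) x - T.trueValue M k (h + 1) x)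
      (T.state k h) (T.act k h))
    (b := fun k h => min (M.H : ℝ) (2 * betaHat d M.H M.B p k *
        wnorm ((T.ridge k).sigHat h)⁻¹ (T.feat M p k h)))
    (A := fun k h => T.actDev (fun k => T.qErr M p k h) k h)
    (T := fun k h => T.stateDev M
      (fun k t => T.est M p k (h + 1) t - T.trueValue M k (h + 1) t) k h)
    (v := fun k h => nextVar M h (T.est M p k (h + 1)) (T.state k h) (T.act k h))
    (u := fun k h => nextVar M h (T.trueValue M k (h + 1)) (T.state k h) (T.act k h))
    (W := fun k h => T.trueValue M k h (T.state k h) ^ 2)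
    (N := fun k h => T.stateDev M (fun k t => T.trueValue M k (h + 1) t ^ 2) k h)
    (N' := fun k h => T.actDev (fun k a => T.trueQ M k h (T.state k h) a ^ 2) k h)
    (sig := fun k h => T.weight M p k h)
    (E := fun k h => offset M.toKnownModel p k (T.ridge k) h (T.est M p k (h + 1)) (T.state k h)
      (T.act k h))
    (w := fun k h => wnorm (gram p.lam (fun i => T.normFeat M p i h) k)⁻¹ (T.normFeat M p k h))
    (wt := fun k h => wnorm (gram p.lam (fun i => T.featSq M p i h) k)⁻¹ (T.featSq M p k h))
    ?_ ?_ ?_ ?_ ?_ ?_ ?_ ?_ ?_ ?_ ?_ ?_ ?_ ?_ ?_ ?_ ?_ ?_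
  · intro k hk
    simp only [est, trueValue, vEst_last, value_last, sub_zero]
  · intro k hk h hh
    have hk := hmem hk
    have hh := hmem hh
    have h1 : T.est M p k h (T.state k h) - T.trueValue M k h (T.state k h) =
        ∑ a, T.policy k h (T.state k h) a * T.qErr M p k h a := by
      unfold est trueValue qErr
      rw [vEst_eq hh, value_bellman (hT.policy_mem k hk) _ hh, ← Finset.sum_sub_distrib]
      exact Finset.sum_congr rfl fun a _ => by unfold trueQ trueValue; ring
    have h2 := qStep_le hh (hT.sigHat_posDef hd hH hlam hk.1 h)
      (hty.thetaHat_hat hT hd hH hlam hδ hk hh) (fun x => (hT.est_mem hk (succ_mem hh) x).1)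
      (T.state k h) (T.act k h) (hT.signal_mem k hk h hh _ _)
    have h3 : T.qErr M p k h (T.act k h) ≤
        M.next h (fun x => T.est M p k (h + 1) x - T.trueValue M k (h + 1) x)
          (T.state k h) (T.act k h) + min (M.H : ℝ) (2 * betaHat d M.H M.B p k *
        wnorm ((T.ridge k).sigHat h)⁻¹ (T.feat M p k h)) := by
      rw [M.next_sub, sub_add_eq_add_sub]
      unfold qErr trueQ
      refine (sub_le_sub_right h2 _).trans (le_of_eq ?_)
      unfold feat
      ring
    simp only [actDev]
    linarith
  · intro k _ h _
    simp only [stateDev]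
    ring
  · intro k hk h hh
    exact le_min hH0 (mul_nonneg (mul_nonneg zero_le_two
      ((wnorm_nonneg _ _).trans (hty.thetaHat_hat hT hd hH hlam hδ (hmem hk) (hmem hh))))
      (wnorm_nonneg _ _))
  · intro k hk h _
    exact hT.bonus_le hd hH hL (hmem hk) h
  · intro k _ h _
    exact (weight_pos hd hH k h).le
  · intro k hk h hh
    have hk := hmem hk
    have hh := hmem hh
    exact sigmaSq_le_add hh (hT.sigHat_posDef hd hH hlam hk.1 h) (hT.sigTilde_posDef hlam hk.1 h)
      (hty.thetaHat_check hT hd hH hlam hδ hk hh) (hty.thetaTilde_tilde hT hH hlam hδ hk hh)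
      (hT.est_le_H hk (succ_mem hh)) _ _
  · intro k hk h hh
    have hk := hmem hk
    have hh := hmem hh
    exact nextVar_le_add hh (fun x => (hT.trueValue_mem hk (succ_mem hh) x).1)
      (hty.trueValue_le_est hT hd hH hlam hδ hk _ (succ_mem hh))
      (fun x => (hT.est_le_H hk (succ_mem hh) x).2) _ _
  · exact fun k hk h hh => hT.nextVar_trueValue_le (hmem hk) (hmem hh)
  · intro k _
    simp [trueValue, value_last]
  · exact fun k _ => sq_nonneg _
  · exact fun k hk h _ => hT.offset_le hd hH hL (hmem hk) h
  · exact fun h hh => (hT.sum_wnorm_le hd hH hlam hL (hmem hh)).1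
  · exact fun h hh => (hT.sum_wnorm_le hd hH hlam hL (hmem hh)).2
  · exact fun h hh => hnoise hH0 (hty.act_qErr h (hmem hh))
  · exact fun h hh => hnoise hH0 (hty.state_err h (hmem hh))
  · exact fun h hh => hnoise (sq_nonneg _) (hty.state_sq h (hmem hh))
  · exact fun h hh => hnoise (sq_nonneg _) (hty.act_sq h (hmem hh))

end

end SignalTrace

/-! ### The regressions are accurate with high probability -/

section Probability

variable {Ω S A : Type*} [Fintype S] [Fintype A] {d : ℕ}

/-- The data for the signal `ℓ` with the regression statistics `R` in the run `X`. -/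
noncomputable def Interaction.trace (X : Interaction Ω S A) (M : KnownModel S A d) (p : Params)
    (ℓ : ℕ → Ω → ℕ → S → A → ℝ) (R : ℕ → Ω → Ridge d) (ω : Ω) : SignalTrace S A d where
  signal k := ℓ k ω
  policy k := X.policy M p ω k
  ridge k := R k ω
  state k h := X.state k h ω
  act k h := X.act k h ω

/-- The signal `ℓ` is known before the episode is played, and `R` are the statistics of the
algorithm for this signal. -/
structure IsSignal (M : LinearMixtureCMDP S A d) (p : Params) (K : ℕ) (X : Interaction Ω S A)
    (ℓ : ℕ → Ω → ℕ → S → A → ℝ) (R : ℕ → Ω → Ridge d) : Prop where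
  regression : ∀ ω, (X.trace M.toKnownModel p ℓ R ω).IsRegression M p K
  meas_signal : ∀ k ∈ Set.Icc 1 K, StepMeasurable (X.episodeSigma M.H k) M.H (ℓ k)
  meas_ridge : ∀ k ∈ Set.Icc 1 K, RidgeMeasurable (X.episodeSigma M.H k) M.H (R k)

variable {M : LinearMixtureCMDP S A d} {p : Params} {K : ℕ} {X : Interaction Ω S A}
  {ℓ : ℕ → Ω → ℕ → S → A → ℝ} {R : ℕ → Ω → Ridge d}

section

variable (hS : IsSignal M p K X ℓ R) {k : ℕ} (hk : k ∈ Set.Icc 1 K)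
include hS hk

lemma IsSignal.measurable_est {h : ℕ} (hh : h ∈ Set.Icc 1 (M.H + 1)) (x : S) :
    Measurable[X.episodeSigma M.H k] fun ω =>
      (X.trace M.toKnownModel p ℓ R ω).est M p k h x :=
  measurable_vEst (hS.meas_ridge k hk) (hS.meas_signal k hk)
    (agent_measurable_episodeSigma M.toKnownModel p X hk.1).pol h hh x

lemma IsSignal.measurable_trueValue {h : ℕ} (hh : h ∈ Set.Icc 1 (M.H + 1)) (x : S) :
    Measurable[X.episodeSigma M.H k] fun ω =>
      (X.trace M.toKnownModel p ℓ R ω).trueValue M k h x :=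
  measurable_value (hS.meas_signal k hk)
    (agent_measurable_episodeSigma M.toKnownModel p X hk.1).pol
    (fun ω => (hS.regression ω).policy_mem k hk) h hh x

variable {h : ℕ} (hh : h ∈ Set.Icc 1 M.H)
include hh

lemma IsSignal.measurable_trueQ (x : S) (c : A) :
    Measurable[X.episodeSigma M.H k] fun ω =>
      (X.trace M.toKnownModel p ℓ R ω).trueQ M k h x c :=
  (hS.meas_signal k hk h hh x c).add (Finset.measurable_sum _ fun t _ =>
    (hS.measurable_trueValue hk (SignalTrace.succ_mem hh) t).const_mul _)

lemma IsSignal.measurable_trueQ_state (c : A) :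
    Measurable[X.preActSigma M.H k h] fun ω =>
      (X.trace M.toKnownModel p ℓ R ω).trueQ M k h (X.state k h ω) c :=
  measurable_eval_finite
    (f := fun ω x => (X.trace M.toKnownModel p ℓ R ω).trueQ M k h x c)
    (preActSigma_state X ⟨hh.1, le_rfl⟩) fun x =>
    (hS.measurable_trueQ hk hh x c).mono (le_sup_left.trans le_sup_left) le_rfl

lemma IsSignal.measurable_qErr (c : A) : Measurable[X.preActSigma M.H k h] fun ω =>
    (X.trace M.toKnownModel p ℓ R ω).qErr M p k h c :=
  (measurable_eval_finite
    (f := fun ω x => qEst M.toKnownModel p k (R k ω) (ℓ k ω) (X.policy M.toKnownModel p ω k) h x c)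
    (preActSigma_state X ⟨hh.1, le_rfl⟩) fun x =>
    (measurable_qEst (hS.meas_ridge k hk) (hS.meas_signal k hk)
      (agent_measurable_episodeSigma M.toKnownModel p X hk.1).pol h hh x c).mono
        (le_sup_left.trans le_sup_left) le_rfl).sub (hS.measurable_trueQ_state hk hh c)

omit hS hk in
lemma measurable_at_state_act {E : Type*} [MeasurableSpace E] {f : Ω → S → A → E}
    (hf : ∀ x c, Measurable[X.episodeSigma M.H k] fun ω => f ω x c) :
    Measurable[X.postActSigma M.H k h] fun ω => f ω (X.state k h ω) (X.act k h ω) :=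
  measurable_eval_pair
    (fun x => (le_sup_left : X.preActSigma M.H k h ≤ X.postActSigma M.H k h) _
      (preActSigma_state X ⟨hh.1, le_rfl⟩ x))
    (fun c => (le_sup_right : _ ≤ X.postActSigma M.H k h) _
      (measurableSet_comap_top (X.act k h) c))
    fun x c => (hf x c).mono ((le_sup_left.trans le_sup_left).trans le_sup_left) le_rfl

lemma IsSignal.measurable_sqrt_weight : Measurable[X.postActSigma M.H k h] fun ω =>
    (Real.sqrt ((X.trace M.toKnownModel p ℓ R ω).weight M p k h))⁻¹ :=
  ((measurable_at_state_act hh (f := fun ω x c => sigmaSq M.toKnownModel p k (R k ω) h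
    ((X.trace M.toKnownModel p ℓ R ω).est M p k (h + 1)) x c) fun x c =>
    measurable_sigmaSq (hS.meas_ridge k hk)
      (hS.measurable_est hk (SignalTrace.succ_mem hh)) hh x c).sqrt).inv

lemma IsSignal.measurable_normFeat (j : Fin d) : Measurable[X.postActSigma M.H k h] fun ω =>
    (X.trace M.toKnownModel p ℓ R ω).normFeat M p k h j :=
  (hS.measurable_sqrt_weight hk hh).mul (measurable_at_state_act hh (f := fun ω x c =>
    phiV M.φ ((X.trace M.toKnownModel p ℓ R ω).est M p k (h + 1)) x c j) fun x c =>
    measurable_phiV M.φ (hS.measurable_est hk (SignalTrace.succ_mem hh)) x c j)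

lemma IsSignal.measurable_featSq (j : Fin d) : Measurable[X.postActSigma M.H k h] fun ω =>
    (X.trace M.toKnownModel p ℓ R ω).featSq M p k h j :=
  measurable_at_state_act hh (f := fun ω x c => phiV M.φ
    (fun t => (X.trace M.toKnownModel p ℓ R ω).est M p k (h + 1) t ^ 2) x c j) fun x c =>
    measurable_phiV M.φ (fun t =>
      (hS.measurable_est hk (SignalTrace.succ_mem hh) t).pow_const 2) x c j

lemma IsSignal.measurable_noise (t : S) : Measurable[X.postActSigma M.H k h] fun ω =>
    (X.trace M.toKnownModel p ℓ R ω).noise M p k h t :=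
  (hS.measurable_sqrt_weight hk hh).mul (measurable_at_state_act hh (f := fun ω x c =>
    (X.trace M.toKnownModel p ℓ R ω).est M p k (h + 1) t -
      M.next h ((X.trace M.toKnownModel p ℓ R ω).est M p k (h + 1)) x c) fun _ _ =>
    (hS.measurable_est hk (SignalTrace.succ_mem hh) t).sub (Finset.measurable_sum _ fun t _ =>
      (hS.measurable_est hk (SignalTrace.succ_mem hh) t).const_mul _))

lemma IsSignal.measurable_noiseSq (t : S) : Measurable[X.postActSigma M.H k h] fun ω =>
    (X.trace M.toKnownModel p ℓ R ω).noiseSq M p k h t :=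
  measurable_at_state_act hh (f := fun ω x c =>
    (X.trace M.toKnownModel p ℓ R ω).est M p k (h + 1) t ^ 2 -
      M.next h (fun x => (X.trace M.toKnownModel p ℓ R ω).est M p k (h + 1) x ^ 2) x c) fun _ _ =>
    ((hS.measurable_est hk (SignalTrace.succ_mem hh) t).pow_const 2).sub
      (Finset.measurable_sum _ fun t _ =>
        ((hS.measurable_est hk (SignalTrace.succ_mem hh) t).pow_const 2).const_mul _)

end

variable [mΩ : MeasurableSpace Ω] {μ : Measure Ω} [IsProbabilityMeasure μ]

/-- The failure probability of the estimates for one signal: three confidence bounds with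
probability `δ/(2H)` each and four martingale bounds with probability `δ/(4H)` each, at each of the
`H` steps. -/
theorem IsSignal.measureReal_not_isTypical_le (hS : IsSignal M p K X ℓ R) (hX : IsRun μ M p K X)
    (hd : 1 ≤ d) (hH : 1 ≤ M.H) (hK : 1 ≤ K) (hlam : 0 < p.lam) {δ : ℝ} (hδ : 0 < δ) (hδ1 : δ < 1)
    (hpol : ∀ ω k, 1 ≤ k → IsPolicyUpTo M.H (X.policy M.toKnownModel p ω k)) :
    μ.real {ω | ¬ (X.trace M.toKnownModel p ℓ R ω).IsTypical M p K (δ / (2 * M.H))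
      (Real.log (4 * M.H / δ))} ≤ 5 / 2 * δ := by
  have hd' : (1 : ℝ) ≤ d := by exact_mod_cast hd
  have hH' : (1 : ℝ) ≤ M.H := by exact_mod_cast hH
  have hsd : 0 < Real.sqrt (d : ℝ) := Real.sqrt_pos.2 (by linarith)
  set δ' := δ / (2 * M.H) with hδ'
  have hδ'0 : 0 < δ' := by positivity
  have hδ'1 : δ' ≤ 1 := by rw [hδ', div_le_one (by linarith)]; linarith
  set ln := Real.log (4 * M.H / δ) with hln
  have hln1 : 1 ≤ ln := by
    rw [hln, Real.le_log_iff_exp_le (by positivity), le_div_iff₀ hδ]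
    nlinarith [Real.exp_one_lt_d9, Real.exp_pos 1]
  have hexp : Real.exp (-ln) = δ / (4 * M.H) := by
    rw [Real.exp_neg, hln, Real.exp_log (by positivity), inv_div]
  set T := X.trace M.toKnownModel p ℓ R
  set B1 : ℕ → Set Ω := fun h => {ω | ∃ k ∈ Set.Icc 1 K, (∀ i ∈ Finset.Ico 1 k,
      ∑ t, M.P h (X.state i h ω) (X.act i h ω) t * (T ω).noise M p i h t ^ 2 ≤ Real.sqrt d ^ 2) ∧
    bernsteinRadius d p.lam d (Real.sqrt d) (Real.sqrt d) δ' k <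
      wnorm (gram p.lam (fun i => (T ω).normFeat M p i h) k)⁻¹ (∑ i ∈ Finset.Ico 1 k,
        (T ω).noise M p i h (X.state i (h + 1) ω) • (T ω).normFeat M p i h)}
  set B2 : ℕ → Set Ω := fun h => {ω | ∃ k ∈ Set.Icc 1 K, (∀ i ∈ Finset.Ico 1 k,
      ∑ t, M.P h (X.state i h ω) (X.act i h ω) t * (T ω).noiseSq M p i h t ^ 2 ≤
        ((M.H : ℝ) ^ 2) ^ 2) ∧
    bernsteinRadius d p.lam ((M.H : ℝ) ^ 4) ((M.H : ℝ) ^ 2) ((M.H : ℝ) ^ 2) δ' k <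
      wnorm (gram p.lam (fun i => (T ω).featSq M p i h) k)⁻¹ (∑ i ∈ Finset.Ico 1 k,
        (T ω).noiseSq M p i h (X.state i (h + 1) ω) • (T ω).featSq M p i h)}
  set B3 : ℕ → Set Ω := fun h => {ω | ∃ k ∈ Set.Icc 1 K, (∀ i ∈ Finset.Ico 1 k,
      ∑ t, M.P h (X.state i h ω) (X.act i h ω) t * (T ω).noise M p i h t ^ 2 ≤ 1 ^ 2) ∧
    bernsteinRadius d p.lam d 1 (Real.sqrt d) δ' k <
      wnorm (gram p.lam (fun i => (T ω).normFeat M p i h) k)⁻¹ (∑ i ∈ Finset.Ico 1 k,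
        (T ω).noise M p i h (X.state i (h + 1) ω) • (T ω).normFeat M p i h)}
  set B4 : ℕ → Set Ω := fun h => {ω | 6 * M.H * Real.sqrt K * ln <
    ∑ k ∈ Finset.Icc 1 K, (T ω).actDev (fun k => (T ω).qErr M p k h) k h}
  set B5 : ℕ → Set Ω := fun h => {ω | 6 * M.H ^ 2 * Real.sqrt K * ln < ∑ k ∈ Finset.Icc 1 K,
    (T ω).actDev (fun k a => (T ω).trueQ M k h (X.state k h ω) a ^ 2) k h}
  set B6 : ℕ → Set Ω := fun h => {ω | 6 * M.H * Real.sqrt K * ln < ∑ k ∈ Finset.Icc 1 K,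
    (T ω).stateDev M
      (fun k t => (T ω).est M p k (h + 1) t - (T ω).trueValue M k (h + 1) t) k h}
  set B7 : ℕ → Set Ω := fun h => {ω | 6 * M.H ^ 2 * Real.sqrt K * ln < ∑ k ∈ Finset.Icc 1 K,
    (T ω).stateDev M (fun k t => (T ω).trueValue M k (h + 1) t ^ 2) k h}
  have hmem : ∀ k ∈ Set.Icc 1 K, ∀ i ∈ Finset.Ico 1 k, i ∈ Set.Icc 1 K := fun k hk i hi => by
    rw [Finset.mem_Ico] at hi; exact ⟨hi.1, by have := hk.2; omega⟩
  have hsub : {ω | ¬ (T ω).IsTypical M p K δ' ln} ⊆ ⋃ h ∈ Finset.Icc 1 M.H,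
      (B1 h ∪ B2 h ∪ B3 h ∪ B4 h ∪ B5 h ∪ B6 h ∪ B7 h) := by
    intro ω hω
    by_contra hcon
    refine hω ?_
    simp only [Set.mem_iUnion, Set.mem_union, not_exists, not_or, Finset.mem_Icc] at hcon
    refine ⟨fun h hh k hk => ?_, fun h hh k hk => ?_, fun h hh k hk hv => ?_,
      fun h hh => ?_, fun h hh => ?_, fun h hh => ?_, fun h hh => ?_⟩
    · refine not_lt.1 fun hlt => (hcon h hh).1.1.1.1.1.1 ⟨k, hk, fun i hi => ?_, hlt⟩
      have hi' := hmem k hk i hi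
      exact sum_simplex_le (M.P_mem hh _ _) fun t =>
        sq_le_sq' (abs_le.1 ((hS.regression ω).abs_noise_le hd hH hi' hh t)).1
          (abs_le.1 ((hS.regression ω).abs_noise_le hd hH hi' hh t)).2
    · refine not_lt.1 fun hlt => (hcon h hh).1.1.1.1.1.2 ⟨k, hk, fun i hi => ?_, hlt⟩
      have hi' := hmem k hk i hi
      exact sum_simplex_le (M.P_mem hh _ _) fun t =>
        sq_le_sq' (abs_le.1 ((hS.regression ω).abs_noiseSq_le hi' hh t)).1
          (abs_le.1 ((hS.regression ω).abs_noiseSq_le hi' hh t)).2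
    · exact not_lt.1 fun hlt => (hcon h hh).1.1.1.1.2 ⟨k, hk, hv, hlt⟩
    · exact not_lt.1 (hcon h hh).1.1.1.2
    · exact not_lt.1 (hcon h hh).1.1.2
    · exact not_lt.1 (hcon h hh).1.2
    · exact not_lt.1 (hcon h hh).2
  have hstep : ∀ h ∈ Finset.Icc 1 M.H, μ.real (B1 h ∪ B2 h ∪ B3 h ∪ B4 h ∪ B5 h ∪ B6 h ∪ B7 h) ≤
      5 / 2 * δ / M.H := by
    intro h hh
    rw [Finset.mem_Icc] at hh
    have hh : h ∈ Set.Icc 1 M.H := hh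
    have hcs := hX.condLaw_state hh
    have hca := hX.condLaw_act hpol hh
    have m1 : μ.real (B1 h) ≤ δ' := hcs.selfNormalized hd hlam (by linarith) hsd hsd hδ'0 hδ'1
      (fun k hk j => hS.measurable_normFeat hk hh j)
      (fun k hk ω => (hS.regression ω).normFeat_le hd hH hk hh)
      (fun k hk t => hS.measurable_noise hk hh t)
      (fun k hk ω t => (hS.regression ω).abs_noise_le hd hH hk hh t)
      (fun k _ ω => SignalTrace.sum_mul_noise (T := T ω) hh k)
    have m2 : μ.real (B2 h) ≤ δ' := hcs.selfNormalized hd hlam (by positivity) (by positivity)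
      (by positivity) hδ'0 hδ'1
      (fun k hk j => hS.measurable_featSq hk hh j)
      (fun k hk ω => (hS.regression ω).featSq_le hH hk hh)
      (fun k hk t => hS.measurable_noiseSq hk hh t)
      (fun k hk ω t => (hS.regression ω).abs_noiseSq_le hk hh t)
      (fun k _ ω => SignalTrace.sum_mul_noiseSq (T := T ω) hh k)
    have m3 : μ.real (B3 h) ≤ δ' := hcs.selfNormalized hd hlam (by linarith) one_pos hsd hδ'0 hδ'1
      (fun k hk j => hS.measurable_normFeat hk hh j)
      (fun k hk ω => (hS.regression ω).normFeat_le hd hH hk hh)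
      (fun k hk t => hS.measurable_noise hk hh t)
      (fun k hk ω t => (hS.regression ω).abs_noise_le hd hH hk hh t)
      (fun k _ ω => SignalTrace.sum_mul_noise (T := T ω) hh k)
    have m4 : μ.real (B4 h) ≤ Real.exp (-ln) := hca.azuma hK (by linarith) hln1
      (g := fun k ω a => (T ω).qErr M p k h a)
      (fun k hk a => hS.measurable_qErr hk hh a) fun k hk ω a => by
        have h1 := qEst_le_H (M := M.toKnownModel) (p := p) (k := k) (R := (T ω).ridge k)
          (ℓ := (T ω).signal k) (π := (T ω).policy k) hh ((T ω).state k h) a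
        have h2 := (hS.regression ω).trueQ_mem hk hh ((T ω).state k h) a
        unfold SignalTrace.qErr
        rw [abs_le]
        constructor <;> linarith [h1.1, h1.2, h2.1, h2.2]
    have m5 : μ.real (B5 h) ≤ Real.exp (-ln) := hca.azuma hK (by positivity) hln1
      (g := fun k ω a => (T ω).trueQ M k h (X.state k h ω) a ^ 2)
      (fun k hk a => (hS.measurable_trueQ_state hk hh a).pow_const 2) fun k hk ω a => by
        have h2 := (hS.regression ω).trueQ_mem hk hh (X.state k h ω) a
        rw [abs_of_nonneg (sq_nonneg _)]
        exact pow_le_pow_left₀ h2.1 h2.2 2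
    have hval : ∀ k ∈ Set.Icc 1 K, ∀ ω t, (T ω).trueValue M k (h + 1) t ∈ Set.Icc (0 : ℝ) M.H :=
      fun k hk ω t => by
        have h1 := (hS.regression ω).trueValue_mem hk (SignalTrace.succ_mem hh) t
        push_cast at h1
        exact ⟨h1.1, h1.2.trans (by linarith [(Nat.cast_nonneg h : (0 : ℝ) ≤ h)])⟩
    have m6 : μ.real (B6 h) ≤ Real.exp (-ln) := hcs.azuma hK (by linarith) hln1
      (g := fun k ω t => (T ω).est M p k (h + 1) t - (T ω).trueValue M k (h + 1) t)
      (fun k hk t => ((hS.measurable_est hk (SignalTrace.succ_mem hh) t).sub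
        (hS.measurable_trueValue hk (SignalTrace.succ_mem hh) t)).mono
          ((le_sup_left.trans le_sup_left).trans le_sup_left) le_rfl) fun k hk ω t => by
        have h1 := (hS.regression ω).est_le_H hk (SignalTrace.succ_mem hh) t
        have h2 := hval k hk ω t
        rw [abs_le]
        constructor <;> linarith [h1.1, h1.2, h2.1, h2.2]
    have m7 : μ.real (B7 h) ≤ Real.exp (-ln) := hcs.azuma hK (by positivity) hln1
      (g := fun k ω t => (T ω).trueValue M k (h + 1) t ^ 2)
      (fun k hk t => ((hS.measurable_trueValue hk (SignalTrace.succ_mem hh) t).pow_const 2).mono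
          ((le_sup_left.trans le_sup_left).trans le_sup_left) le_rfl) fun k hk ω t => by
        have h2 := hval k hk ω t
        rw [abs_of_nonneg (sq_nonneg _)]
        exact pow_le_pow_left₀ h2.1 h2.2 2
    rw [hexp] at m4 m5 m6 m7
    have e : 5 / 2 * δ / M.H = 3 * δ' + 4 * (δ / (4 * M.H)) := by
      rw [hδ']; field_simp; ring
    have u1 := measureReal_union_le (μ := μ) (B1 h) (B2 h)
    have u2 := measureReal_union_le (μ := μ) (B1 h ∪ B2 h) (B3 h)
    have u3 := measureReal_union_le (μ := μ) (B1 h ∪ B2 h ∪ B3 h) (B4 h)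
    have u4 := measureReal_union_le (μ := μ) (B1 h ∪ B2 h ∪ B3 h ∪ B4 h) (B5 h)
    have u5 := measureReal_union_le (μ := μ) (B1 h ∪ B2 h ∪ B3 h ∪ B4 h ∪ B5 h) (B6 h)
    have u6 := measureReal_union_le (μ := μ) (B1 h ∪ B2 h ∪ B3 h ∪ B4 h ∪ B5 h ∪ B6 h) (B7 h)
    linarith
  calc _ ≤ μ.real (⋃ h ∈ Finset.Icc 1 M.H, (B1 h ∪ B2 h ∪ B3 h ∪ B4 h ∪ B5 h ∪ B6 h ∪ B7 h)) :=
        measureReal_mono hsub (measure_ne_top _ _)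
    _ ≤ ∑ h ∈ Finset.Icc 1 M.H, 5 / 2 * δ / M.H :=
        (measureReal_biUnion_finset_le _ _).trans (Finset.sum_le_sum hstep)
    _ = 5 / 2 * δ := by
        rw [Finset.sum_const, Nat.card_Icc, Nat.add_sub_cancel, nsmul_eq_mul]
        field_simp

end Probability

/-! ### Regret and violation -/

section Final

/-- An event whose complement has small outer measure contains a large measurable event. -/
lemma exists_measurableSet_forall {Ω : Type*} [MeasurableSpace Ω] {μ : Measure Ω}
    [IsProbabilityMeasure μ] {P : Ω → Prop} {ε : ℝ} (h : μ.real {ω | ¬ P ω} ≤ ε) :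
    ∃ G, MeasurableSet G ∧ ENNReal.ofReal (1 - ε) ≤ μ G ∧ ∀ ω ∈ G, P ω := by
  refine ⟨(toMeasurable μ {ω | ¬ P ω})ᶜ, (measurableSet_toMeasurable _ _).compl, ?_,
    fun ω hω => not_not.1 fun hn => hω (subset_toMeasurable μ _ hn)⟩
  rw [← ofReal_measureReal (measure_ne_top _ _),
    probReal_compl_eq_one_sub (measurableSet_toMeasurable _ _)]
  refine ENNReal.ofReal_le_ofReal (sub_le_sub_left ?_ _)
  rwa [Measure.real, measure_toMeasurable]

variable {S A : Type*} [Fintype S] [Fintype A] {d : ℕ} {M : LinearMixtureCMDP S A d}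

lemma Slater.one_le_H {γ : ℝ} (hγ : Slater M γ) : 1 ≤ M.H := by
  obtain ⟨hγ0, π, -, hπ⟩ := hγ
  by_contra hlt
  have h0 : M.H = 0 := by omega
  have h1 : value M M.g π 1 M.s₁ = 0 := by
    have := value_last (M := M) M.g π M.s₁
    rwa [h0] at this
  linarith [M.b_mem.1]

lemma Slater.le_H {γ : ℝ} (hγ : Slater M γ) : γ ≤ M.H := by
  obtain ⟨-, π, hπ, hb⟩ := hγ
  have := (value_mem (hπ.upTo M.H) M.g_mem 1 (one_mem_Icc_succ _) M.s₁).2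
  push_cast at this
  linarith [M.b_mem.1]

lemma Slater.nonempty {γ : ℝ} (hγ : Slater M γ) : Nonempty A := by
  obtain ⟨-, π, hπ, -⟩ := hγ
  by_contra hA
  rw [not_nonempty_iff] at hA
  simpa using (hπ 1 M.s₁).2

omit [Fintype A] in
/-- Since the transition probabilities sum up to `1`, the bound `B` is at least `1`. -/
lemma LinearMixtureCMDP.one_le_B [Nonempty A] (M : LinearMixtureCMDP S A d) (hH : 1 ≤ M.H) :
    1 ≤ M.B := by
  have hh : 1 ∈ Set.Icc 1 M.H := ⟨le_rfl, hH⟩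
  let a : A := Classical.arbitrary A
  have h1 : M.next 1 (fun _ => 1) M.s₁ a = 1 := by
    simpa [LinearMixtureCMDP.next] using M.P_sum 1 hh M.s₁ a
  rw [M.next_eq_dotProduct hh] at h1
  have h2 := abs_dotProduct_le_norm (phiV M.φ (fun _ => 1) M.s₁ a) (M.θstar 1)
  rw [h1, abs_one] at h2
  calc 1 ≤ _ := h2
    _ ≤ 1 * ‖WithLp.toLp 2 (M.θstar 1)‖ := by
        gcongr
        exact M.norm_phiV_le _ (fun _ => by simp) _ _
    _ ≤ M.B := by rw [one_mul]; exact M.norm_θstar_le 1 hh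

omit [Fintype A] in
lemma LinearMixtureCMDP.one_le_d [Nonempty A] (M : LinearMixtureCMDP S A d) (hH : 1 ≤ M.H) :
    1 ≤ d := by
  by_contra hlt
  obtain rfl : d = 0 := by omega
  have h1 := M.P_sum 1 ⟨le_rfl, hH⟩ M.s₁ (Classical.arbitrary A)
  rw [Finset.sum_congr rfl fun s' _ => M.P_linear 1 ⟨le_rfl, hH⟩ M.s₁ _ s'] at h1
  simp at h1

variable {Ω : Type*} [mΩ : MeasurableSpace Ω] {μ : Measure Ω} {p : Params} {K : ℕ}
  {X : Interaction Ω S A}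

lemma isSignal_rew (hX : IsRun μ M p K X)
    (hpol : ∀ ω k, 1 ≤ k → IsPolicyUpTo M.H (X.policy M.toKnownModel p ω k)) :
    IsSignal M p K X (fun k ω h => X.rew k h ω) (fun k ω => (agent M.toKnownModel p
      (fun i j => X.state i j ω) (fun i j => X.act i j ω) (fun i j => X.rew i j ω) k).ridgeR) where
  regression ω :=
    { signal_mem := fun k hk h hh s a => hX.rew_mem k hk h hh ω s a
      policy_mem := fun k hk => hpol ω k hk.1
      init := rfl
      succ := fun k hk => by
        simp only [Interaction.trace]
        rw [agent_succ _ _ _ _ _ hk]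
        rfl }
  meas_signal k hk := episodeSigma_rew X ⟨hk.1, le_rfl⟩
  meas_ridge k hk := (agent_measurable_episodeSigma M.toKnownModel p X hk.1).ridgeR

omit mΩ in
lemma isSignal_constraint
    (hpol : ∀ ω k, 1 ≤ k → IsPolicyUpTo M.H (X.policy M.toKnownModel p ω k)) :
    IsSignal M p K X (fun _ _ => M.g) (fun k ω => (agent M.toKnownModel p
      (fun i j => X.state i j ω) (fun i j => X.act i j ω) (fun i j => X.rew i j ω) k).ridgeG) where
  regression ω :=
    { signal_mem := fun _ _ => M.g_mem
      policy_mem := fun k hk => hpol ω k hk.1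
      init := rfl
      succ := fun k hk => by
        simp only [Interaction.trace]
        rw [agent_succ _ _ _ _ _ hk]
        rfl }
  meas_signal _ _ := fun _ _ _ _ => measurable_const
  meas_ridge k hk := (agent_measurable_episodeSigma M.toKnownModel p X hk.1).ridgeG

variable {st : ℕ → ℕ → S} {ac : ℕ → ℕ → A} {rw : ℕ → ℕ → S → A → ℝ}

/-- Regret bound from optimism and small estimation errors. -/
lemma regret_le_of_estimates [Nonempty A] (hp : p.IsTuned M.H K)
    (hr : ∀ k ∈ Set.Icc 1 K, IsOptimistic M p k (agent M.toKnownModel p st ac rw k).ridgeR (rw k)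
      (agent M.toKnownModel p st ac rw k).pol)
    (hg : ∀ k ∈ Set.Icc 1 K, IsOptimistic M p k (agent M.toKnownModel p st ac rw k).ridgeG M.g
      (agent M.toKnownModel p st ac rw k).pol)
    {π : ℕ → S → A → ℝ} (hπ : IsFeasible M π) {γ : ℝ} (hγ : Slater M γ) {L : ℝ} (hL1 : 1 ≤ L)
    (hLA : Real.log (Fintype.card A * K) ≤ L) (hLA' : Real.log (Fintype.card A) ≤ L)
    (hest : ∑ k ∈ Finset.Icc 1 K, (rewardEst M.toKnownModel p st ac rw k -
      value M (rw k) (agent M.toKnownModel p st ac rw k).pol 1 M.s₁) ≤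
        180000 * L ^ 4 * estimationRate d M.H K) :
    regret M K rw π (fun k => (agent M.toKnownModel p st ac rw k).pol) ≤
      200000 * L ^ 4 * regretRate d M.H K γ := by
  have h1 := drift_sum hp hr hg hπ hL1 hLA hLA'
  have hsplit : regret M K rw π (fun k => (agent M.toKnownModel p st ac rw k).pol) =
      ∑ k ∈ Finset.Icc 1 K, (value M (rw k) π 1 M.s₁ - rewardEst M.toKnownModel p st ac rw k) +
      ∑ k ∈ Finset.Icc 1 K, (rewardEst M.toKnownModel p st ac rw k -
        value M (rw k) (agent M.toKnownModel p st ac rw k).pol 1 M.s₁) := by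
    unfold regret
    rw [← Finset.sum_add_distrib]
    exact Finset.sum_congr rfl fun k _ => by ring
  have hγ0 := hγ.1
  have h2 : (M.H : ℝ) ^ 3 * Real.sqrt K ≤ M.H ^ 5 * Real.sqrt K / γ ^ 2 := by
    rw [le_div_iff₀ (by positivity)]
    have : γ ^ 2 ≤ (M.H : ℝ) ^ 2 := pow_le_pow_left₀ hγ0.le hγ.le_H 2
    calc (M.H : ℝ) ^ 3 * Real.sqrt K * γ ^ 2 ≤ M.H ^ 3 * Real.sqrt K * M.H ^ 2 := by gcongr
      _ = _ := by ring
  have h3 : L ≤ L ^ 4 := le_self_pow₀ hL1 (by norm_num)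
  have h4 : 20 * (M.H : ℝ) ^ 3 * Real.sqrt K * L ≤
      200000 * L ^ 4 * (M.H ^ 5 * Real.sqrt K / γ ^ 2) := by
    calc 20 * (M.H : ℝ) ^ 3 * Real.sqrt K * L = 20 * L * (M.H ^ 3 * Real.sqrt K) := by ring
      _ ≤ 200000 * L ^ 4 * (M.H ^ 5 * Real.sqrt K / γ ^ 2) := by gcongr; norm_num
  have h5 : 0 ≤ L ^ 4 * estimationRate d M.H K := by unfold estimationRate; positivity
  have h6 : regretRate d M.H K γ = estimationRate d M.H K + M.H ^ 5 * Real.sqrt K / γ ^ 2 := rfl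
  rw [hsplit, h6]
  linarith

/-- Violation bound from optimism and small estimation errors. -/
lemma violation_le_of_estimates [Nonempty A] (hp : p.IsTuned M.H K)
    (hr : ∀ k ∈ Set.Icc 1 K, IsOptimistic M p k (agent M.toKnownModel p st ac rw k).ridgeR (rw k)
      (agent M.toKnownModel p st ac rw k).pol)
    (hg : ∀ k ∈ Set.Icc 1 K, IsOptimistic M p k (agent M.toKnownModel p st ac rw k).ridgeG M.g
      (agent M.toKnownModel p st ac rw k).pol)
    (hrw : ∀ k ∈ Set.Icc 1 K, ∀ h ∈ Set.Icc 1 M.H, ∀ s a, rw k h s a ∈ Set.Icc (0 : ℝ) 1)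
    {γ : ℝ} (hγ : Slater M γ) {L : ℝ} (hL1 : 1 ≤ L)
    (hLA : Real.log (Fintype.card A * K) ≤ L) (hLA' : Real.log (Fintype.card A) ≤ L)
    (hest : ∑ k ∈ Finset.Icc 1 K, (constraintEst M.toKnownModel p st ac rw k -
      value M M.g (agent M.toKnownModel p st ac rw k).pol 1 M.s₁) ≤
        180000 * L ^ 4 * estimationRate d M.H K) :
    violation M K (fun k => (agent M.toKnownModel p st ac rw k).pol) ≤
      200000 * L ^ 4 * violationRate d M.H K γ := by
  have h1 := violation_est_le hp (dual_variable_le hp hr hg hrw hγ hL1 hLA hLA')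
  have hsplit : ∑ k ∈ Finset.Icc 1 K,
        (M.b - value M M.g (agent M.toKnownModel p st ac rw k).pol 1 M.s₁) =
      ∑ k ∈ Finset.Icc 1 K, (M.b - constraintEst M.toKnownModel p st ac rw k) +
      ∑ k ∈ Finset.Icc 1 K, (constraintEst M.toKnownModel p st ac rw k -
        value M M.g (agent M.toKnownModel p st ac rw k).pol 1 M.s₁) := by
    rw [← Finset.sum_add_distrib]
    exact Finset.sum_congr rfl fun k _ => by ring
  have hγ0 := hγ.1
  have hH := hp.H_pos
  have hγ2 : 1 ≤ (M.H : ℝ) ^ 2 / γ := by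
    rw [le_div_iff₀ hγ0]; nlinarith [hγ.le_H]
  have h3 : L ≤ L ^ 4 := le_self_pow₀ hL1 (by norm_num)
  have h4 : (2 * (40 * M.H ^ 2 * L / γ) + 3) * (M.H * Real.sqrt K) ≤
      200000 * L ^ 4 * (M.H ^ 3 * Real.sqrt K / γ) := by
    calc (2 * (40 * M.H ^ 2 * L / γ) + 3) * (M.H * Real.sqrt K) =
          (80 * (M.H ^ 2 / γ * L) + 3 * (1 * 1)) * (M.H * Real.sqrt K) := by ring
      _ ≤ (80 * (M.H ^ 2 / γ * L) + 3 * (M.H ^ 2 / γ * L)) * (M.H * Real.sqrt K) := by gcongr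
      _ = 83 * L * (M.H ^ 3 * Real.sqrt K / γ) := by ring
      _ ≤ 200000 * L ^ 4 * (M.H ^ 3 * Real.sqrt K / γ) := by gcongr; norm_num
  have h5 : 0 ≤ L ^ 4 * estimationRate d M.H K := by unfold estimationRate; positivity
  have h6 : violationRate d M.H K γ = estimationRate d M.H K + M.H ^ 3 * Real.sqrt K / γ := rfl
  have h7 : 0 ≤ L ^ 4 * (M.H ^ 3 * Real.sqrt K / γ) := by positivity
  unfold violation
  rw [hsplit, h6]
  refine max_le ?_ ?_ <;> linarith

end Final

end PDPowers

theorem theorem1 :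
    ∃ (C : ℝ) (m : ℕ), 0 < C ∧
      ∀ (S A : Type*) [Fintype S] [Fintype A] (d : ℕ) (M : PDPowers.LinearMixtureCMDP S A d)
        (γ δ : ℝ) (K : ℕ),
        PDPowers.Slater M γ → 0 < δ → δ < 1 →
        max (2 * M.H) (max (M.H ^ 2) (d ^ 3 * M.H ^ 3)) ≤ K →
        ∀ p : PDPowers.Params,
          p.lam = 1 / M.B ^ 2 → p.alpha = 1 / ((M.H : ℝ) ^ 2 * Real.sqrt K) →
          p.eta = 1 / ((M.H : ℝ) * Real.sqrt K) → p.theta = 1 / (K : ℝ) → p.delta = δ →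
        ∀ (Ω : Type*) [MeasurableSpace Ω] (μ : MeasureTheory.Measure Ω)
          [MeasureTheory.IsProbabilityMeasure μ] (X : PDPowers.Interaction Ω S A),
          PDPowers.IsRun μ M p K X →
          ∃ G : Set Ω, MeasurableSet G ∧ ENNReal.ofReal (1 - 6 * δ) ≤ μ G ∧
            ∀ ω ∈ G,
              (∀ πstar, PDPowers.IsOptimal M K (fun k h => X.rew k h ω) πstar →
                PDPowers.regret M K (fun k h => X.rew k h ω) πstar
                    (X.policy M.toKnownModel p ω)
                  ≤ C * PDPowers.logFactor d M.H K (Fintype.card A) M.B δ ^ m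
                      * PDPowers.regretRate d M.H K γ) ∧
              PDPowers.violation M K (X.policy M.toKnownModel p ω)
                ≤ C * PDPowers.logFactor d M.H K (Fintype.card A) M.B δ ^ m
                    * PDPowers.violationRate d M.H K γ := by
  refine ⟨200000, 4, by norm_num, ?_⟩
  intro S A _ _ d M γ δ K hγ hδ hδ1 hK p hlam hα hη hθ hpδ Ω _ μ _ X hX
  have hA := hγ.nonempty
  have hH := hγ.one_le_H
  have hd := M.one_le_d hH
  have hB := M.one_le_B hH
  obtain ⟨hK1, hK2, hK3⟩ : 2 * M.H ≤ K ∧ M.H ^ 2 ≤ K ∧ d ^ 3 * M.H ^ 3 ≤ K := by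
    simpa only [max_le_iff] using hK
  have hp : p.IsTuned M.H K := ⟨hα, hη, hθ, hH, by omega, hK2⟩
  have hlam0 : 0 < p.lam := by rw [hlam]; positivity
  have hL := PDPowers.logBounds hd hH hp.two_le_K (Fintype.card_pos (α := A)) hB hδ hδ1 hlam hpδ
  have hpol : ∀ ω k, 1 ≤ k → PDPowers.IsPolicyUpTo M.H (X.policy M.toKnownModel p ω k) :=
    fun ω k hk => (PDPowers.agent_isPositivePolicy M.toKnownModel hp.theta_pos hp.theta_le_one
      _ _ _ hk).1
  have hr := PDPowers.isSignal_rew hX hpol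
  have hg := PDPowers.isSignal_constraint (K := K) hpol
  have hK0 : 1 ≤ K := by omega
  have br := hr.measureReal_not_isTypical_le hX hd hH hK0 hlam0 hδ hδ1 hpol
  have bg := hg.measureReal_not_isTypical_le hX hd hH hK0 hlam0 hδ hδ1 hpol
  obtain ⟨G, hG, hGμ, hGP⟩ := PDPowers.exists_measurableSet_forall
    (((MeasureTheory.measureReal_mono (Set.ofPred_subset_ofPred.2 fun ω => not_and_or.1)).trans
      (MeasureTheory.measureReal_union_le _ _)).trans (add_le_add br bg))
  refine ⟨G, hG, (ENNReal.ofReal_le_ofReal (by linarith)).trans hGμ, fun ω hω => ?_⟩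
  obtain ⟨tr, tg⟩ := hGP ω hω
  have Tr := hr.regression ω
  have Tg := hg.regression ω
  have er := tr.sum_est_sub_le Tr hd hH hlam0 hpδ hL hK3 fun k hk => hX.state_one k hk ω
  have eg := tg.sum_est_sub_le Tg hd hH hlam0 hpδ hL hK3 fun k hk => hX.state_one k hk ω
  have hor := fun k hk => tr.isOptimistic Tr hd hH hlam0 hpδ (k := k) hk
  have hog := fun k hk => tg.isOptimistic Tg hd hH hlam0 hpδ (k := k) hk
  exact ⟨fun πstar hπ => PDPowers.regret_le_of_estimates hp hor hog hπ.1 hγ hL.one_le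
      hL.log_card_mul_le hL.log_card_le er,
    PDPowers.violation_le_of_estimates hp hor hog (fun k hk h hh => hX.rew_mem k hk h hh ω) hγ
      hL.one_le hL.log_card_mul_le hL.log_card_le eg⟩
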